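/- Let $n\ge 2$ be an integer and let $b>0$, $\nu>0$, $\gamma\in(1,5/3]$ be fixed real numbers. For $\kappa>0$ put $\delta=b\nu+(\gamma-1)\kappa$, and let $\psi$ be the solution of the linear Blackstock model on $[0,\infty)\times\mathbb{R}^n$ $$(\partial_t-\kappa\Delta)(\psi_{tt}-\Delta\psi-\delta\Delta\psi_t)+\kappa(\gamma-1)(b\nu-\kappa)\Delta^2\psi_t=0,\qquad (\psi,\psi_t,\psi_{tt})(0,\cdot)=(\psi_0,\psi_1,\psi_2).$$ Let $\psi^{(0)}$, $\psi^{I,1}$ (functions of $(t,x)$) and $\psi^{L,1}$ (a function of $(z,x)$) be the solutions of $$\psi^{(0)}_{tt}-\Delta\psi^{(0)}-b\nu\Delta\psi^{(0)}_t=0,\qquad (\psi^{(0)},\psi^{(0)}_t)(0,\cdot)=(\psi_0,\psi_1);$$ $$\psi^{I,1}_{tt}-\Delta\psi^{I,1}-b\nu\Delta\psi^{I,1}_t=(\gamma-1)\Delta\big(\psi^{(0)}_t-b\nu\Delta\psi^{(0)}\big),\qquad (\psi^{I,1},\psi^{I,1}_t)(0,\cdot)=\big((1-\gamma)(\psi_1-b\nu\Delta\psi_0),\,0\big);$$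 $$\partial_z\psi^{L,1}-\Delta\psi^{L,1}=0,\qquad \psi^{L,1}(0,\cdot)=(\gamma-1)(\psi_1-b\nu\Delta\psi_0).$$ Solutions are understood as curves of tempered distributions on $\mathbb{R}^n$ indexed by time in $[0,\infty)$: time derivatives are taken after pairing with Schwartz functions (one-sided at time $0$), spatial derivatives in the sense of distributions. Let $\langle D\rangle^s$ be the Fourier multiplier with symbol $(1+|\xi|^2)^{s/2}$, where $D=-i\nabla$. There is $\kappa_0>0$ (depending only on $n,b,\nu,\gamma$) and, for every real $s_0>n+3$, a constant $C>0$ independent of $\kappa$ and of the data, such that the following holds for all $0<\kappa\le\kappa_0$ and all (complex-valued) tempered distributions $\psi_0,\psi_1$ with $\langle D\rangle^{s_0+2}\psi_0\in L^1(\mathbb{R}^n)$ and $\langle D\rangle^{s_0}\psi_1\in L^1(\mathbb{R}^n)$, when $\psi_2$ is given by the consistency condition $\psi_2=b\nu\Delta\psi_1+\Delta\psi_0$. The four Cauchy problems have solutions $\psi,\psi^{(0)},\psi^{I,1},\psi^{L,1}$, and for any such solutions, for every $t\ge0$, the distribution $\psi(t,\cdot)-\big(\psi^{(0)}(t,\cdot)+\kappa\psi^{I,1}(t,\cdot)+\kappa\psi^{L,1}(\kappa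 t,\cdot)\big)$ is an $L^\infty$ function, with $$\sup_{t\in[0,\infty)}\left\|\psi(t,\cdot)-\left(\psi^{(0)}(t,\cdot)+\kappa\psi^{I,1}(t,\cdot)+\kappa\psi^{L,1}(\kappa t,\cdot)\right)\right\|_{L^\infty}\le C\kappa\sqrt{\kappa}\left(\|\langle D\rangle^{s_0+2}\psi_0\|_{L^1}+\|\langle D\rangle^{s_0}\psi_1\|_{L^1}\right).$$ -/

import Mathlib

open MeasureTheory
open scoped SchwartzMap Laplacian ENNReal

/-- Euclidean space `ℝⁿ`. -/
abbrev Rn (n : ℕ) := EuclideanSpace ℝ (Fin n)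

/-- The symbol of `⟨D⟩ˢ`. Mathlib's Fourier transform uses the kernel `exp (-2πi x·ξ)`, so the
frequency variable in which `D = -i∇` acts as multiplication is `2πξ`. -/
noncomputable def japaneseSymbol {n : ℕ} (s : ℝ) (ξ : Rn n) : ℝ :=
  (1 + ‖(2 * Real.pi) • ξ‖ ^ 2) ^ (s / 2)

/-- The symbol has temperate growth, so that the Fourier multiplier below is the genuine one. -/
theorem japaneseSymbol_hasTemperateGrowth {n : ℕ} (s : ℝ) :
    (fun ξ : Rn n ↦ ((japaneseSymbol s ξ : ℝ) : ℂ)).HasTemperateGrowth := by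
  have h1 : (fun x : Rn n ↦ (1 + ‖x‖ ^ 2) ^ (s / 2)).HasTemperateGrowth := by fun_prop
  have h2 : (fun ξ : Rn n ↦ (2 * Real.pi) • ξ).HasTemperateGrowth := by fun_prop
  have h3 : (fun ξ : Rn n ↦ japaneseSymbol s ξ).HasTemperateGrowth := h1.comp h2
  fun_prop

/-- The operator `⟨D⟩ˢ = (1 - Δ)^(s/2)` on tempered distributions. -/
noncomputable def japaneseD (n : ℕ) (s : ℝ) : 𝓢'(Rn n, ℂ) →L[ℂ] 𝓢'(Rn n, ℂ) :=
  TemperedDistribution.fourierMultiplierCLM ℂ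
    (fun ξ : Rn n ↦ ((japaneseSymbol s ξ : ℝ) : ℂ))

/-- `v = ∂ₜ u` on `[0,∞)` (one-sided at `0`) for curves of tempered distributions: after testing
with any Schwartz function, `u` is differentiable in time with derivative `v`. -/
def IsTimeDeriv {n : ℕ} (u v : ℝ → 𝓢'(Rn n, ℂ)) : Prop :=
  ∀ φ : 𝓢(Rn n, ℂ), ∀ t : ℝ, 0 ≤ t →
    HasDerivWithinAt (fun τ : ℝ ↦ u τ φ) (v t φ) (Set.Ici 0) t

/-- `ψ` solves the linear Blackstock equation
`(∂ₜ - κΔ)(ψ_tt - Δψ - δΔψ_t) + κ(γ-1)(bν-κ)Δ²ψ_t = 0`, `δ = bν + (γ-1)κ`,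
with `ψ(0) = ψ₀`, `ψ_t(0) = ψ₁`, `ψ_tt(0) = ψ₂`. -/
def IsBlackstockSolution {n : ℕ} (b ν γ κ : ℝ) (ψ₀ ψ₁ ψ₂ : 𝓢'(Rn n, ℂ))
    (ψ : ℝ → 𝓢'(Rn n, ℂ)) : Prop :=
  ∃ ψt ψtt ψttt : ℝ → 𝓢'(Rn n, ℂ),
    IsTimeDeriv ψ ψt ∧ IsTimeDeriv ψt ψtt ∧ IsTimeDeriv ψtt ψttt ∧
    (∀ t : ℝ, 0 ≤ t →
      (ψttt t - Δ (ψt t) - ((b * ν + (γ - 1) * κ : ℝ) : ℂ) • Δ (ψtt t))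
        - (κ : ℂ) • Δ (ψtt t - Δ (ψ t) - ((b * ν + (γ - 1) * κ : ℝ) : ℂ) • Δ (ψt t))
        + ((κ * (γ - 1) * (b * ν - κ) : ℝ) : ℂ) • Δ (Δ (ψt t)) = 0) ∧
    ψ 0 = ψ₀ ∧ ψt 0 = ψ₁ ∧ ψtt 0 = ψ₂

/-- `u`, with `∂ₜ u = ut`, solves the viscoelastic damped wave equation
`u_tt - Δu - bνΔu_t = f` with `u(0) = u₀`, `u_t(0) = u₁`. -/
def IsDampedWaveSolution {n : ℕ} (b ν : ℝ) (f : ℝ → 𝓢'(Rn n, ℂ)) (u₀ u₁ : 𝓢'(Rn n, ℂ))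
    (u ut : ℝ → 𝓢'(Rn n, ℂ)) : Prop :=
  ∃ utt : ℝ → 𝓢'(Rn n, ℂ),
    IsTimeDeriv u ut ∧ IsTimeDeriv ut utt ∧
    (∀ t : ℝ, 0 ≤ t → utt t - Δ (u t) - ((b * ν : ℝ) : ℂ) • Δ (ut t) = f t) ∧
    u 0 = u₀ ∧ ut 0 = u₁

/-- `u` solves the heat equation `∂_z u - Δu = 0` with `u(0) = u₀`. -/
def IsHeatSolution {n : ℕ} (u₀ : 𝓢'(Rn n, ℂ)) (u : ℝ → 𝓢'(Rn n, ℂ)) : Prop :=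
  ∃ uz : ℝ → 𝓢'(Rn n, ℂ),
    IsTimeDeriv u uz ∧ (∀ z : ℝ, 0 ≤ z → uz z - Δ (u z) = 0) ∧ u 0 = u₀

/-- The solution `ψ` of Blackstock's model together with the profiles of its second-order
expansion: `ψZ = ψ⁽⁰⁾` (whose time derivative is `ψZt`), `ψI = ψ^{I,1}` and `ψL = ψ^{L,1}`. -/
def AreSolutionAndProfiles {n : ℕ} (b ν γ κ : ℝ) (ψ₀ ψ₁ ψ₂ : 𝓢'(Rn n, ℂ))
    (ψ ψZ ψI ψL : ℝ → 𝓢'(Rn n, ℂ)) : Prop :=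
  IsBlackstockSolution b ν γ κ ψ₀ ψ₁ ψ₂ ψ ∧
  (∃ ψZt : ℝ → 𝓢'(Rn n, ℂ),
    IsDampedWaveSolution b ν (fun _ ↦ 0) ψ₀ ψ₁ ψZ ψZt ∧
    ∃ ψIt : ℝ → 𝓢'(Rn n, ℂ),
      IsDampedWaveSolution b ν
        (fun t ↦ ((γ - 1 : ℝ) : ℂ) • Δ (ψZt t - ((b * ν : ℝ) : ℂ) • Δ (ψZ t)))
        (((1 - γ : ℝ) : ℂ) • (ψ₁ - ((b * ν : ℝ) : ℂ) • Δ ψ₀)) 0 ψI ψIt) ∧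
  IsHeatSolution (((γ - 1 : ℝ) : ℂ) • (ψ₁ - ((b * ν : ℝ) : ℂ) • Δ ψ₀)) ψL

/-! With x = |2πξ|², a = bν, θ = γ - 1 and δ = a + θκ, Blackstock's equation becomes, frequency by
frequency, (∂ₜ + κx)(u″ + δx u′ + x u) + κθ(a - κ)x² u′ = 0. Putting Y = u″ + δx u′ + x u gives a
damped wave equation driven by Y, coupled to a heat equation for Y. For κ < a let β² = κθ(a - κ). In
the energy β²x²(|u′|² + x|u|²) + |Y|² the two couplings cancel, so forcing is simply integrated in
time (`coupled_energy_le`).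

The profiles v, I and the layer κ e^{-κxt} θ(v′(0) + ax v(0)) match the initial data and the
equation up to O(κ²). What v + κI leaves in the equation is, up to sign, an exact time derivative H′
(`residualPrimitive`). Subtracting H from Y turns it into a force of size κ² that decays like the
damped oscillator, at a rate comparable to x/(1 + x), hence is integrable over all times. The heat
factor annihilates the layer; the coupling term leaves a source of size κ³x³e^{-κxt}, whose time
integral is of size κ²x². The energy norm of the remainder R is therefore O(κ²) uniformly in time.
It controls β|2πξ|³|R| with β of order √κ, which yields κ^{3/2} and explains the loss of half a
power.

The resulting weight |ξ|⁻¹ + |ξ|³ (`exists_expansionRemainder_le`) is integrable against ⟨ξ⟩^{-s₀}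
because n ≥ 2 and s₀ > n + 3 (`integrable_remainder_weight`), and the inverse Fourier transform maps
L¹ to L^∞.

The estimate concerns solutions built mode by mode, and it passes to arbitrary solutions by
uniqueness in 𝓢′ (`laplacian_system_eq_zero`). After a Fourier transform, testing against compactly
supported functions makes the symbol effectively bounded; equicontinuity from Banach–Steinhaus then
lets the Picard iteration converge to zero. -/

/-- Comparison principle for the square root of an energy. -/
theorem sqrt_le_of_deriv_le {F F' G G' g : ℝ → ℝ} {c : ℝ} (hc : 0 ≤ c)
    (hF : ∀ t, HasDerivAt F (F' t) t) (hFn : ∀ t, 0 ≤ F t)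
    (hG : ∀ t, HasDerivAt G (G' t) t) (hGn : ∀ t, 0 ≤ t → 0 ≤ G t)
    (h : ∀ t, 0 ≤ t → F' t ≤ -2 * c * F t + 2 * g t * √(F t))
    (hg : ∀ t, 0 ≤ t → g t - c * G t ≤ G' t) (h0 : √(F 0) ≤ G 0) {t : ℝ} (ht : 0 ≤ t) :
    √(F t) ≤ G t := by
  -- Adding ε(1 + t) makes G a strict supersolution, so only a first contact point has to be
  -- excluded. There √F equals a positive number, and √ is never differentiated at zeros of F.
  have key : ∀ ε : ℝ, 0 < ε → √(F t) ≤ G t + ε * (1 + t) := by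
    intro ε hε
    have hB : ∀ s, HasDerivAt (fun s ↦ (G s + ε * (1 + s)) ^ 2)
        (2 * (G s + ε * (1 + s)) * (G' s + ε)) s := by
      intro s
      have := ((hG s).add (((hasDerivAt_id s).const_add 1).const_mul ε)).pow 2
      convert! this using 1
      simp
    have hle : F t ≤ (G t + ε * (1 + t)) ^ 2 := by
      refine image_le_of_deriv_right_lt_deriv_boundary' (f := F) (f' := F') (a := 0) (b := t)
        (fun s _ ↦ (hF s).continuousAt.continuousWithinAt)
        (fun s _ ↦ (hF s).hasDerivWithinAt)
        (B := fun s ↦ (G s + ε * (1 + s)) ^ 2) ?_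
        (fun s _ ↦ (hB s).continuousAt.continuousWithinAt)
        (fun s _ ↦ (hB s).hasDerivWithinAt) ?_ ⟨ht, le_rfl⟩
      · have : F 0 = √(F 0) ^ 2 := (Real.sq_sqrt (hFn 0)).symm
        rw [this]
        have := Real.sqrt_nonneg (F 0)
        gcongr
        linarith
      · intro s hs hEq
        have hp : 0 < G s + ε * (1 + s) := by
          have := hGn s hs.1
          have := hs.1
          positivity
        have hsq : √(F s) = G s + ε * (1 + s) := by
          rw [hEq, Real.sqrt_sq hp.le]
        have h1 := h s hs.1
        rw [hsq, hEq] at h1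
        have h2 := hg s hs.1
        have h3 : g s - c * (G s + ε * (1 + s)) < G' s + ε := by
          have : 0 ≤ c * (ε * (1 + s)) := by
            have := hs.1
            positivity
          linarith
        nlinarith [mul_lt_mul_of_pos_left h3 hp]
    have := hGn t ht
    exact Real.sqrt_le_iff.2 ⟨by positivity, hle⟩
  refine le_of_forall_pos_le_add fun ε hε ↦ ?_
  have := key (ε / (1 + t)) (by positivity)
  rwa [div_mul_cancel₀ _ (by positivity)] at this

/-! ### Energy of the damped oscillator. -/

section SecondOrder

variable {E : Type*} [NormedAddCommGroup E] [InnerProductSpace ℝ E]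

/-- The energy of the damped oscillator `v'' + a x v' + x v = f`. -/
def oscillatorEnergy (a x : ℝ) (v w : E) : ℝ :=
  ‖w + (a * x) • v‖ ^ 2 + ‖w‖ ^ 2 + 2 * x * ‖v‖ ^ 2

/-- The decay rate of the damped oscillator. -/
noncomputable def oscillatorRate (a x : ℝ) : ℝ := a / (3 + 2 * a ^ 2) * (x / (1 + x))

theorem oscillatorRate_pos {a x : ℝ} (ha : 0 < a) (hx : 0 < x) : 0 < oscillatorRate a x := by
  unfold oscillatorRate; positivity

theorem oscillatorEnergy_nonneg {a x : ℝ} (hx : 0 < x) (v w : E) :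
    0 ≤ oscillatorEnergy a x v w := by
  unfold oscillatorEnergy; positivity

/-- The energy is at most (3 + 2a²)(1 + x)(‖w‖² + x‖v‖²), while it dissipates ax(‖w‖² + x‖v‖²) up to
a factor 2. The quotient of the two is the rate: of order x at low frequency, bounded at high
frequency. -/
theorem oscillatorRate_mul_energy_le {a x : ℝ} (ha : 0 < a) (hx : 0 < x) (v w : E) :
    oscillatorRate a x * oscillatorEnergy a x v w ≤ a * x * (‖w‖ ^ 2 + x * ‖v‖ ^ 2) := by
  have h1 : ‖w + (a * x) • v‖ ^ 2 ≤ 2 * ‖w‖ ^ 2 + 2 * (a * x) ^ 2 * ‖v‖ ^ 2 := by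
    have := norm_add_le w ((a * x) • v)
    rw [norm_smul, Real.norm_of_nonneg (by positivity : 0 ≤ a * x)] at this
    calc _ ≤ (‖w‖ + a * x * ‖v‖) ^ 2 := by gcongr
      _ ≤ _ := by nlinarith [sq_nonneg (‖w‖ - a * x * ‖v‖)]
  have h2 : oscillatorEnergy a x v w ≤
      (3 + 2 * a ^ 2) * (1 + x) * (‖w‖ ^ 2 + x * ‖v‖ ^ 2) := by
    unfold oscillatorEnergy
    have e1 : 0 ≤ x * ‖w‖ ^ 2 := by positivity
    have e2 : 0 ≤ a ^ 2 * ‖w‖ ^ 2 := by positivity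
    have e3 : 0 ≤ a ^ 2 * (x * ‖w‖ ^ 2) := by positivity
    have e4 : 0 ≤ x * ‖v‖ ^ 2 := by positivity
    have e5 : 0 ≤ x * (x * ‖v‖ ^ 2) := by positivity
    have e6 : 0 ≤ a ^ 2 * (x * ‖v‖ ^ 2) := by positivity
    nlinarith
  calc _ ≤ oscillatorRate a x * ((3 + 2 * a ^ 2) * (1 + x) * (‖w‖ ^ 2 + x * ‖v‖ ^ 2)) := by
        gcongr
        exact (oscillatorRate_pos ha hx).le
    _ = _ := by unfold oscillatorRate; field_simp

theorem norm_le_sqrt_energy {a x : ℝ} (hx : 0 < x) (v w : E) :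
    ‖w‖ ≤ √(oscillatorEnergy a x v w) ∧ ‖w + (a * x) • v‖ ≤ √(oscillatorEnergy a x v w) ∧
      √x * ‖v‖ ≤ √(oscillatorEnergy a x v w) := by
  have e : 0 ≤ x * ‖v‖ ^ 2 := by positivity
  refine ⟨?_, ?_, ?_⟩ <;> apply Real.le_sqrt_of_sq_le <;> unfold oscillatorEnergy
  · nlinarith [sq_nonneg ‖w + (a * x) • v‖]
  · nlinarith [sq_nonneg ‖w‖]
  · rw [mul_pow, Real.sq_sqrt hx.le]
    nlinarith [sq_nonneg ‖w‖, sq_nonneg ‖w + (a * x) • v‖]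

/-- The weight 2x is the one for which the cross terms ⟨v, w⟩ cancel. The square of w + axv, whose
derivative is f - xv, is what makes ‖v‖² dissipate along with ‖w‖². -/
theorem hasDerivAt_oscillatorEnergy {a x : ℝ} {v w : ℝ → E} {f : E} {t : ℝ}
    (hv : HasDerivAt v (w t) t) (hw : HasDerivAt w (f - (a * x) • w t - x • v t) t) :
    HasDerivAt (fun s ↦ oscillatorEnergy a x (v s) (w s))
      (-2 * (a * x * (‖w t‖ ^ 2 + x * ‖v t‖ ^ 2)) +
        2 * inner ℝ (w t + (w t + (a * x) • v t)) f) t := by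
  have h1 := (hw.add (hv.const_smul (a * x))).norm_sq
  have h2 := hw.norm_sq
  have h3 := hv.norm_sq.const_mul (2 * x)
  have := (h1.add h2).add h3
  refine (this.congr_deriv ?_)
  simp only [inner_add_left, inner_add_right, inner_sub_right, real_inner_smul_left,
    real_inner_smul_right, Pi.add_apply, Pi.smul_apply, real_inner_self_eq_norm_sq,
    real_inner_comm (v t) (w t)]
  ring

/-- Decay of the damped oscillator: the energy is dominated by any supersolution of the
corresponding scalar inequality. -/
theorem sqrt_oscillatorEnergy_le {a x : ℝ} (ha : 0 < a) (hx : 0 < x) {v w f : ℝ → E}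
    (hv : ∀ t, HasDerivAt v (w t) t)
    (hw : ∀ t, HasDerivAt w (f t - (a * x) • w t - x • v t) t)
    {G G' : ℝ → ℝ} (hG : ∀ t, HasDerivAt G (G' t) t) (hGn : ∀ t, 0 ≤ t → 0 ≤ G t)
    (hg : ∀ t, 0 ≤ t → 2 * ‖f t‖ - oscillatorRate a x * G t ≤ G' t)
    (h0 : √(oscillatorEnergy a x (v 0) (w 0)) ≤ G 0) {t : ℝ} (ht : 0 ≤ t) :
    √(oscillatorEnergy a x (v t) (w t)) ≤ G t := by
  refine sqrt_le_of_deriv_le (g := fun t ↦ 2 * ‖f t‖) (oscillatorRate_pos ha hx).le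
    (fun t ↦ hasDerivAt_oscillatorEnergy (hv t) (hw t))
    (fun t ↦ oscillatorEnergy_nonneg hx _ _) hG hGn (fun s hs ↦ ?_) hg h0 ht
  have h1 := oscillatorRate_mul_energy_le ha hx (v s) (w s)
  have h2 : inner ℝ (w s + (w s + (a * x) • v s)) (f s) ≤
      (√(oscillatorEnergy a x (v s) (w s)) + √(oscillatorEnergy a x (v s) (w s))) * ‖f s‖ := by
    refine (real_inner_le_norm _ _).trans ?_
    gcongr
    exact (norm_add_le _ _).trans
      (add_le_add (norm_le_sqrt_energy hx _ _).1 (norm_le_sqrt_energy hx _ _).2.1)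
  linarith

end SecondOrder

/-! ### Decay of the profiles and energy of the coupled third-order equation. -/

section Blackstock

variable {E : Type*} [NormedAddCommGroup E] [InnerProductSpace ℝ E]

/-- Free decay of the damped oscillator. -/
theorem sqrt_oscillatorEnergy_le_exp {a x : ℝ} (ha : 0 < a) (hx : 0 < x) {v w : ℝ → E}
    (hv : ∀ t, HasDerivAt v (w t) t)
    (hw : ∀ t, HasDerivAt w (-(a * x) • w t - x • v t) t) {t : ℝ} (ht : 0 ≤ t) :
    √(oscillatorEnergy a x (v t) (w t)) ≤
      √(oscillatorEnergy a x (v 0) (w 0)) * Real.exp (-oscillatorRate a x * t) := by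
  set m := oscillatorRate a x
  set N := √(oscillatorEnergy a x (v 0) (w 0))
  have hG : ∀ t : ℝ, HasDerivAt (fun t ↦ N * Real.exp (-m * t))
      (N * (Real.exp (-m * t) * (-m))) t := fun t ↦ by
    have := ((hasDerivAt_id t).const_mul (-m)).exp.const_mul N
    simpa using this
  refine sqrt_oscillatorEnergy_le (f := fun _ ↦ 0) ha hx hv (fun t ↦ ?_) hG
    (fun t _ ↦ by positivity) (fun t _ ↦ ?_) (by simp [N]) ht
  · convert! hw t using 1
    rw [zero_sub, neg_smul]
  · simp only [norm_zero]
    exact le_of_eq (by ring)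

/-- Decay of the damped oscillator driven resonantly by another one. -/
theorem sqrt_oscillatorEnergy_le_forced {a x θ : ℝ} (ha : 0 < a) (hx : 0 < x) (hθ : 0 ≤ θ)
    {v v1 I I1 : ℝ → E}
    (hv : ∀ t, HasDerivAt v (v1 t) t)
    (hv1 : ∀ t, HasDerivAt v1 (-(a * x) • v1 t - x • v t) t)
    (hI : ∀ t, HasDerivAt I (I1 t) t)
    (hI1 : ∀ t, HasDerivAt I1
      (-(a * x) • I1 t - x • I t - (θ * x) • (v1 t + (a * x) • v t)) t) {t : ℝ} (ht : 0 ≤ t) :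
    √(oscillatorEnergy a x (I t) (I1 t)) ≤
      (√(oscillatorEnergy a x (I 0) (I1 0)) +
        2 * θ * x * √(oscillatorEnergy a x (v 0) (v1 0)) * t) *
        Real.exp (-oscillatorRate a x * t) := by
  set m := oscillatorRate a x
  set N := √(oscillatorEnergy a x (v 0) (v1 0))
  set N' := √(oscillatorEnergy a x (I 0) (I1 0))
  -- The force has norm at most θxN e^{-mt}, with the same rate m as the free decay. This resonance
  -- produces the factor linear in t.
  have hG : ∀ t : ℝ, HasDerivAt (fun t ↦ (N' + 2 * θ * x * N * t) * Real.exp (-m * t))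
      (2 * θ * x * N * Real.exp (-m * t) +
        (N' + 2 * θ * x * N * t) * (Real.exp (-m * t) * (-m))) t := fun t ↦ by
    have h1 := ((hasDerivAt_id t).const_mul (-m)).exp
    have h2 := ((hasDerivAt_id t).const_mul (2 * θ * x * N)).const_add N'
    exact (h2.mul h1).congr_deriv (by simp)
  refine sqrt_oscillatorEnergy_le (f := fun t ↦ -((θ * x) • (v1 t + (a * x) • v t)))
    ha hx hI (fun t ↦ ?_) hG
    (fun t _ ↦ by positivity) (fun t h ↦ ?_) (by simp [N']) ht
  · convert! hI1 t using 1
    module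
  · have h1 := (norm_le_sqrt_energy hx (v t) (v1 t) (a := a)).2.1.trans
      (sqrt_oscillatorEnergy_le_exp ha hx hv hv1 h)
    rw [norm_neg, norm_smul, Real.norm_of_nonneg (by positivity)]
    have h2 := mul_le_mul_of_nonneg_left h1 (by positivity : 0 ≤ 2 * (θ * x))
    simp only [N, m] at *
    linarith

/-- Energy estimate for Blackstock's third-order equation written as a damped wave equation
coupled to a heat equation. The coupling terms cancel in the energy. -/
theorem coupled_energy_le {β κ δ s : ℝ} (hβ : 0 < β) (hκ : 0 < κ) (hδ : 0 < δ) (hs : 0 < s)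
    {R R1 Y H Z : ℝ → E} {h z G G' : ℝ → ℝ}
    (hR : ∀ t, HasDerivAt R (R1 t) t)
    (hR1 : ∀ t, HasDerivAt R1 (Y t + H t - (δ * s ^ 2) • R1 t - s ^ 2 • R t) t)
    (hY : ∀ t, HasDerivAt Y (-(κ * s ^ 2) • Y t - (β ^ 2 * s ^ 4) • R1 t + Z t) t)
    (hH : ∀ t, 0 ≤ t → ‖H t‖ ≤ h t) (hZ : ∀ t, 0 ≤ t → ‖Z t‖ ≤ z t)
    (hG : ∀ t, HasDerivAt G (G' t) t) (hGn : ∀ t, 0 ≤ t → 0 ≤ G t)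
    (hg : ∀ t, 0 ≤ t → β * s ^ 2 * h t + z t ≤ G' t)
    (h0 : β * s ^ 2 * ‖R1 0‖ + β * s ^ 3 * ‖R 0‖ + ‖Y 0‖ ≤ G 0) {t : ℝ} (ht : 0 ≤ t) :
    β * s ^ 2 * ‖R1 t‖ ≤ G t ∧ ‖Y t‖ ≤ G t ∧ β * s ^ 3 * ‖R t‖ ≤ G t := by
  set F : ℝ → ℝ := fun t ↦
    β ^ 2 * s ^ 4 * (‖R1 t‖ ^ 2 + s ^ 2 * ‖R t‖ ^ 2) + ‖Y t‖ ^ 2 with hFdef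
  have hF : ∀ t, HasDerivAt F (2 * (-(β ^ 2 * s ^ 4 * (δ * s ^ 2)) * ‖R1 t‖ ^ 2
      - κ * s ^ 2 * ‖Y t‖ ^ 2 + β ^ 2 * s ^ 4 * inner ℝ (R1 t) (H t) + inner ℝ (Y t) (Z t))) t := by
    intro t
    have := (((hR1 t).norm_sq.add ((hR t).norm_sq.const_mul (s ^ 2))).const_mul
      (β ^ 2 * s ^ 4)).add (hY t).norm_sq
    refine this.congr_deriv ?_
    simp only [inner_add_right, inner_sub_right, real_inner_smul_right,
      real_inner_self_eq_norm_sq, real_inner_comm (R t) (R1 t), real_inner_comm (Y t) (R1 t)]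
    ring
  have hsq : ∀ t, β * s ^ 2 * ‖R1 t‖ ≤ √(F t) ∧ ‖Y t‖ ≤ √(F t) ∧ β * s ^ 3 * ‖R t‖ ≤ √(F t) := by
    intro t
    have e1 : 0 ≤ β ^ 2 * s ^ 4 * ‖R1 t‖ ^ 2 := by positivity
    have e2 : 0 ≤ β ^ 2 * s ^ 4 * (s ^ 2 * ‖R t‖ ^ 2) := by positivity
    refine ⟨?_, ?_, ?_⟩ <;> apply Real.le_sqrt_of_sq_le <;> simp only [hFdef]
    · nlinarith [sq_nonneg ‖Y t‖]
    · nlinarith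
    · nlinarith [sq_nonneg ‖Y t‖]
  have main : √(F t) ≤ G t := by
    -- Rate zero: the dissipative terms are used only through their sign, and all decay in time has
    -- to come from the forcing.
    refine sqrt_le_of_deriv_le (c := 0) (g := fun t ↦ β * s ^ 2 * h t + z t) le_rfl hF
      (fun t ↦ by positivity) hG hGn (fun t ht ↦ ?_) (fun t ht ↦ by simpa using hg t ht) ?_ ht
    · have i1 : β ^ 2 * s ^ 4 * inner ℝ (R1 t) (H t) ≤ β * s ^ 2 * h t * √(F t) := by
        calc _ ≤ β ^ 2 * s ^ 4 * (‖R1 t‖ * ‖H t‖) := by gcongr; exact real_inner_le_norm _ _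
          _ = β * s ^ 2 * ‖H t‖ * (β * s ^ 2 * ‖R1 t‖) := by ring
          _ ≤ β * s ^ 2 * ‖H t‖ * √(F t) := by gcongr; exact (hsq t).1
          _ ≤ _ := by gcongr; exact hH t ht
      have i2 : inner ℝ (Y t) (Z t) ≤ z t * √(F t) := by
        calc _ ≤ ‖Y t‖ * ‖Z t‖ := real_inner_le_norm _ _
          _ ≤ √(F t) * z t := mul_le_mul (hsq t).2.1 (hZ t ht) (norm_nonneg _) (Real.sqrt_nonneg _)
          _ = _ := mul_comm _ _
      have i3 : 0 ≤ β ^ 2 * s ^ 4 * (δ * s ^ 2) * ‖R1 t‖ ^ 2 := by positivity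
      have i4 : 0 ≤ κ * s ^ 2 * ‖Y t‖ ^ 2 := by positivity
      linarith
    · refine le_trans ?_ h0
      rw [Real.sqrt_le_left (by positivity)]
      simp only [hFdef]
      have h1 : 0 ≤ β * s ^ 2 * ‖R1 0‖ * ‖Y 0‖ := by positivity
      have h2 : 0 ≤ β * s ^ 2 * ‖R1 0‖ * (β * s ^ 3 * ‖R 0‖) := by positivity
      have h3 : 0 ≤ β * s ^ 3 * ‖R 0‖ * ‖Y 0‖ := by positivity
      linarith
  exact ⟨(hsq t).1.trans main, (hsq t).2.1.trans main, (hsq t).2.2.trans main⟩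

end Blackstock

/-! ### The equation satisfied by the remainder of the expansion. -/

section Remainder

variable {E : Type*} [NormedAddCommGroup E] [InnerProductSpace ℝ E]

/-- The Fourier-side ordinary differential equations satisfied, at the frequency `√x`, by the
solution `u` of Blackstock's model, and by its profiles `v` and `I`. -/
structure BlackstockModes (a θ κ x : ℝ) (u u1 u2 v v1 I I1 : ℝ → E) : Prop where
  deriv_u : ∀ t, HasDerivAt u (u1 t) t
  deriv_u1 : ∀ t, HasDerivAt u1 (u2 t) t
  -- Expanded form of (∂ₜ + κx)(u″ + δx u′ + x u) + κθ(a - κ)x² u′ = 0 with δ = a + θκ: the terms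
  -- θκ² cancel in κδ + κθ(a - κ) = (1 + θ)aκ.
  deriv_u2 : ∀ t, HasDerivAt u2 (-((a + (1 + θ) * κ) * x) • u2 t
    - (x + (1 + θ) * a * κ * x ^ 2) • u1 t - (κ * x ^ 2) • u t) t
  deriv_v : ∀ t, HasDerivAt v (v1 t) t
  deriv_v1 : ∀ t, HasDerivAt v1 (-(a * x) • v1 t - x • v t) t
  deriv_I : ∀ t, HasDerivAt I (I1 t) t
  deriv_I1 : ∀ t, HasDerivAt I1
    (-(a * x) • I1 t - x • I t - (θ * x) • (v1 t + (a * x) • v t)) t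
  u_zero : u 0 = v 0
  u1_zero : u1 0 = v1 0
  u2_zero : u2 0 = -(a * x) • v1 0 - x • v 0
  I_zero : I 0 = -θ • (v1 0 + (a * x) • v 0)
  I1_zero : I1 0 = 0

/-- The difference between the solution and its two-scale expansion. -/
noncomputable def expansionRemainder (a θ κ x : ℝ) (u v v1 I : ℝ → E) (t : ℝ) : E :=
  u t - (v t + κ • I t + κ • (Real.exp (-(κ * t) * x) • θ • (v1 0 + (a * x) • v 0)))

/-- The primitive of the oscillating part of the residual. -/
noncomputable def residualPrimitive (a θ κ x : ℝ) (v v1 I I1 : ℝ → E) (t : ℝ) : E :=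
  (θ * κ ^ 2 * x ^ 2) • (v t - a • (v1 t + (a * x) • v t)) -
    (θ * κ ^ 2 * x) • (I1 t + (a * x) • I t)

/-- Half of the decay rate m is spent on the resonant factor, through t e^{-mt/2} ≤ 2/m. This is the
origin of the term 4θN/m and of the remaining rate m/2. -/
theorem norm_residualPrimitive_le {a θ κ s : ℝ} (ha : 0 < a) (hθ : 0 < θ) (hκ : 0 < κ)
    (hs : 0 < s) {u u1 u2 v v1 I I1 : ℝ → E}
    (h : BlackstockModes a θ κ (s ^ 2) u u1 u2 v v1 I I1) {N N' : ℝ}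
    (hN : √(oscillatorEnergy a (s ^ 2) (v 0) (v1 0)) ≤ N)
    (hN' : √(oscillatorEnergy a (s ^ 2) (I 0) (I1 0)) ≤ N') {t : ℝ} (ht : 0 ≤ t) :
    ‖residualPrimitive a θ κ (s ^ 2) v v1 I I1 t‖ ≤
      θ * κ ^ 2 * s ^ 4 * (N / s + a * N + N' / s ^ 2 + 4 * θ * N / oscillatorRate a (s ^ 2)) *
        Real.exp (-(oscillatorRate a (s ^ 2) / 2) * t) := by
  have hx : 0 < s ^ 2 := by positivity
  have hm : 0 < oscillatorRate a (s ^ 2) := oscillatorRate_pos ha hx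
  set m := oscillatorRate a (s ^ 2)
  have hN0 : 0 ≤ N := (Real.sqrt_nonneg _).trans hN
  have hN0' : 0 ≤ N' := (Real.sqrt_nonneg _).trans hN'
  have hv := sqrt_oscillatorEnergy_le_exp ha hx h.deriv_v h.deriv_v1 ht
  have hI := sqrt_oscillatorEnergy_le_forced ha hx hθ.le h.deriv_v h.deriv_v1 h.deriv_I
    h.deriv_I1 ht
  set e := Real.exp (-(m / 2) * t) with he
  have he0 : 0 < e := Real.exp_pos _
  have hee : Real.exp (-m * t) = e * e := by
    rw [he, ← Real.exp_add]; congr 1; ring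
  have he1 : e ≤ 1 := Real.exp_le_one_iff.2 (by nlinarith)
  have hte : t * e ≤ 2 / m := by
    have : m / 2 * t * e ≤ 1 := by
      have h1 := Real.add_one_le_exp (m / 2 * t)
      have h2 : Real.exp (m / 2 * t) * e = 1 := by
        rw [he, ← Real.exp_add]; simp
      nlinarith
    rw [le_div_iff₀ hm]
    linarith
  have hv' : √(oscillatorEnergy a (s ^ 2) (v t) (v1 t)) ≤ N * e := by
    refine hv.trans ?_
    change _ * Real.exp (-m * t) ≤ _
    rw [hee, ← mul_assoc]
    calc _ ≤ N * e * 1 := by gcongr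
      _ = _ := by ring
  have hI' : √(oscillatorEnergy a (s ^ 2) (I t) (I1 t)) ≤
      (N' + 4 * θ * s ^ 2 * N / m) * e := by
    refine hI.trans ?_
    change _ * Real.exp (-m * t) ≤ _
    rw [hee, ← mul_assoc]
    refine mul_le_mul_of_nonneg_right ?_ he0.le
    calc _ ≤ (N' + 2 * θ * s ^ 2 * N * t) * e := by gcongr
      _ = N' * e + 2 * θ * s ^ 2 * N * (t * e) := by ring
      _ ≤ N' * 1 + 2 * θ * s ^ 2 * N * (2 / m) := by gcongr
      _ = _ := by ring
  have n1 := (norm_le_sqrt_energy hx (v t) (v1 t) (a := a)).2.1.trans hv'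
  have n2 := (norm_le_sqrt_energy hx (v t) (v1 t) (a := a)).2.2.trans hv'
  have n3 := (norm_le_sqrt_energy hx (I t) (I1 t) (a := a)).2.1.trans hI'
  rw [Real.sqrt_sq hs.le] at n2
  have n2' : ‖v t‖ ≤ N / s * e := by
    rw [div_mul_eq_mul_div, le_div_iff₀ hs]; linarith
  unfold residualPrimitive
  calc _ ≤ θ * κ ^ 2 * (s ^ 2) ^ 2 * (‖v t‖ + a * ‖v1 t + (a * s ^ 2) • v t‖)
        + θ * κ ^ 2 * s ^ 2 * ‖I1 t + (a * s ^ 2) • I t‖ := by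
        refine (norm_sub_le _ _).trans ?_
        rw [norm_smul, norm_smul, Real.norm_of_nonneg (by positivity),
          Real.norm_of_nonneg (by positivity)]
        gcongr
        refine (norm_sub_le _ _).trans ?_
        rw [norm_smul, Real.norm_of_nonneg ha.le]
    _ ≤ θ * κ ^ 2 * (s ^ 2) ^ 2 * (N / s * e + a * (N * e))
        + θ * κ ^ 2 * s ^ 2 * ((N' + 4 * θ * s ^ 2 * N / m) * e) := by gcongr
    _ = _ := by field_simp; ring

/-- The coupled energy estimate is applied to the remainder with β = σb. On the right stand, in
order, the initial energy, the time integral of the terms containing H, and that of the layer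
source. -/
theorem expansionRemainder_le_of_bounds {a θ σ s : ℝ} (ha : 0 < a) (hθ : 0 < θ) (hσ : 0 < σ)
    (hσa : σ ^ 2 < a) (hs : 0 < s) {u u1 u2 v v1 I I1 : ℝ → E}
    (h : BlackstockModes a θ (σ ^ 2) (s ^ 2) u u1 u2 v v1 I I1) {K m P b : ℝ}
    (hb : b ^ 2 = θ * (a - σ ^ 2)) (hb0 : 0 < b) (hK : 0 ≤ K) (hm : 0 < m)
    (hP : ‖θ • (v1 0 + (a * s ^ 2) • v 0)‖ ≤ P)
    (hH : ∀ t, 0 ≤ t → ‖residualPrimitive a θ (σ ^ 2) (s ^ 2) v v1 I I1 t‖ ≤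
      K * Real.exp (-m * t)) {t : ℝ} (ht : 0 ≤ t) :
    σ * b * s ^ 3 * ‖expansionRemainder a θ (σ ^ 2) (s ^ 2) u v v1 I t‖ ≤
      (σ * b * σ ^ 4 * s ^ 4 + (a + θ * σ ^ 2 + σ ^ 2) * σ ^ 4 * s ^ 4) * P + K +
      (σ * b + σ ^ 2) * s ^ 2 * K / m + σ ^ 4 * s ^ 4 * b ^ 2 * P := by
  set κ := σ ^ 2 with hκ
  set x := s ^ 2 with hx
  have hκ0 : 0 < κ := by positivity
  have hx0 : 0 < x := by positivity
  set L0 := θ • (v1 0 + (a * x) • v 0) with hL0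
  have hP0 : 0 ≤ P := (norm_nonneg _).trans hP
  have hexp : ∀ c t : ℝ, HasDerivAt (fun t ↦ Real.exp (-c * t)) (-c * Real.exp (-c * t)) t := by
    intro c t
    have := ((hasDerivAt_id t).const_mul (-c)).exp
    exact this.congr_deriv (by simp [mul_comm])
  have hexpL : ∀ t : ℝ, HasDerivAt (fun t ↦ Real.exp (-(κ * t) * x) • L0)
      ((-(κ * x) * Real.exp (-(κ * t) * x)) • L0) t := by
    intro t
    have := (hexp (κ * x) t).smul_const L0
    have e : ∀ t, -(κ * t) * x = -(κ * x) * t := fun t ↦ by ring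
    simp only [e]
    exact this
  let v2 : ℝ → E := fun t ↦ -(a * x) • v1 t - x • v t
  let I2 : ℝ → E := fun t ↦ -(a * x) • I1 t - x • I t - (θ * x) • (v1 t + (a * x) • v t)
  let EL : ℝ → E := fun t ↦ Real.exp (-(κ * t) * x) • L0
  have hEL : ∀ t, HasDerivAt EL (-(κ * x) • EL t) t := fun t ↦
    (hexpL t).congr_deriv (by simp only [EL]; module)
  have hv2 : ∀ t, HasDerivAt v2 (-(a * x) • v2 t - x • v1 t) t := fun t ↦
    ((h.deriv_v1 t).const_smul (-(a * x))).sub ((h.deriv_v t).const_smul x)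
  have hI2 : ∀ t, HasDerivAt I2 (-(a * x) • I2 t - x • I1 t -
      (θ * x) • (v2 t + (a * x) • v1 t)) t := fun t ↦
    (((h.deriv_I1 t).const_smul (-(a * x))).sub ((h.deriv_I t).const_smul x)).sub
      (((h.deriv_v1 t).add ((h.deriv_v t).const_smul (a * x))).const_smul (θ * x))
  let δ := a + θ * κ
  let R : ℝ → E := fun t ↦ u t - (v t + κ • I t + κ • EL t)
  let R1 : ℝ → E := fun t ↦ u1 t - (v1 t + κ • I1 t + κ • (-(κ * x) • EL t))
  let R2 : ℝ → E := fun t ↦ u2 t - (v2 t + κ • I2 t + κ • (-(κ * x) • (-(κ * x) • EL t)))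
  let H : ℝ → E := residualPrimitive a θ κ x v v1 I I1
  -- Without subtracting H, the derivative of Y would contain the residual H′. With it, H moves into
  -- the wave equation as a force and enters the heat equation only with the small factor κx.
  let Y : ℝ → E := fun t ↦ R2 t + (δ * x) • R1 t + x • R t - H t
  let Z : ℝ → E := fun t ↦ (κ ^ 3 * x ^ 3 * (θ * (a - κ))) • EL t - (κ * x) • H t
  have hR : ∀ t, HasDerivAt R (R1 t) t := fun t ↦
    (h.deriv_u t).sub (((h.deriv_v t).add ((h.deriv_I t).const_smul κ)).add
      ((hEL t).const_smul κ))
  have hR1 : ∀ t, HasDerivAt R1 (R2 t) t := fun t ↦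
    (h.deriv_u1 t).sub (((h.deriv_v1 t).add ((h.deriv_I1 t).const_smul κ)).add
      (((hEL t).const_smul (-(κ * x))).const_smul κ))
  have hR2 := fun t ↦
    (h.deriv_u2 t).sub (((hv2 t).add ((hI2 t).const_smul κ)).add
      ((((hEL t).const_smul (-(κ * x))).const_smul (-(κ * x))).const_smul κ))
  have hHd := fun t ↦
    (((h.deriv_v t).sub (((h.deriv_v1 t).add ((h.deriv_v t).const_smul (a * x))).const_smul
      a)).const_smul (θ * κ ^ 2 * x ^ 2)).sub
      (((h.deriv_I1 t).add ((h.deriv_I t).const_smul (a * x))).const_smul (θ * κ ^ 2 * x))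
  -- The order-κ contributions of v and of κI cancel by the choice of source for I. The order-κ²
  -- contributions form H′, because v″ + axv′ = -xv.
  have hY : ∀ t, HasDerivAt Y (-(κ * x) • Y t - ((σ * b) ^ 2 * s ^ 4) • R1 t + Z t) t := by
    intro t
    have e : (σ * b) ^ 2 * s ^ 4 = κ * (θ * (a - κ)) * x ^ 2 := by
      rw [mul_pow, hb, hx, hκ]; ring
    rw [e]
    refine (((((hR2 t).add ((hR1 t).const_smul (δ * x))).add ((hR t).const_smul x)).sub
      (hHd t))).congr_deriv ?_
    simp only [Y, Z, R, R1, R2, v2, I2, H, δ, residualPrimitive]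
    module
  have hELn : ∀ t, ‖EL t‖ ≤ Real.exp (-(κ * x) * t) * P := by
    intro t
    simp only [EL]
    rw [norm_smul, Real.norm_of_nonneg (Real.exp_pos _).le,
      show -(κ * t) * x = -(κ * x) * t by ring]
    gcongr
  have hZ : ∀ t, 0 ≤ t → ‖Z t‖ ≤ κ ^ 3 * x ^ 3 * b ^ 2 * (Real.exp (-(κ * x) * t) * P) +
      κ * x * (K * Real.exp (-m * t)) := by
    intro t ht
    refine (norm_sub_le _ _).trans (add_le_add ?_ ?_)
    · rw [← hb, norm_smul, Real.norm_of_nonneg (by positivity)]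
      exact mul_le_mul_of_nonneg_left (hELn t) (by positivity)
    · rw [norm_smul, Real.norm_of_nonneg (by positivity)]
      exact mul_le_mul_of_nonneg_left (hH t ht) (by positivity)
  have hEL0 : EL 0 = L0 := by simp [EL]
  have hH0 := hH 0 le_rfl
  rw [mul_zero, Real.exp_zero, mul_one] at hH0
  set G0 := (σ * b * σ ^ 4 * s ^ 4 + (a + θ * σ ^ 2 + σ ^ 2) * σ ^ 4 * s ^ 4) * P + K
  have hG0 : 0 ≤ G0 := by positivity
  -- The layer corrects the value of κI at time 0 but brings its own velocity -κ²x L0, the only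
  -- mismatch in the first two data.
  have hR10 : R1 0 = (κ ^ 2 * x) • L0 := by
    simp only [R1, hEL0, h.u1_zero, h.I1_zero]; module
  have hR0 : R 0 = 0 := by
    simp only [R, hEL0, h.u_zero, h.I_zero, hL0]; module
  have hY0 : Y 0 = ((δ - κ) * κ ^ 2 * x ^ 2) • L0 - H 0 := by
    simp only [Y, hR0, hR10]
    simp only [R2, hEL0, h.u2_zero, v2, I2, h.I_zero, h.I1_zero, hL0]
    module
  -- Initial bound plus the integrals over [0, t] of the forces e^{-mt} and e^{-κxt}; dividing by κx
  -- lowers κ³x³ to κ²x² in the last one.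
  let G : ℝ → ℝ := fun t ↦ G0 + (σ * b + κ) * x * K / m * (1 - Real.exp (-m * t)) +
    κ ^ 2 * x ^ 2 * b ^ 2 * P * (1 - Real.exp (-(κ * x) * t))
  have hG : ∀ t, HasDerivAt G ((σ * b + κ) * x * K / m * (-(-m * Real.exp (-m * t))) +
      κ ^ 2 * x ^ 2 * b ^ 2 * P * (-(-(κ * x) * Real.exp (-(κ * x) * t)))) t := fun t ↦
    (((((hexp m t).const_sub 1).const_mul _).const_add G0)).add
      (((hexp (κ * x) t).const_sub 1).const_mul _)
  have hle1 : ∀ c t : ℝ, 0 ≤ c → 0 ≤ t → 0 ≤ 1 - Real.exp (-c * t) := fun c t hc ht ↦ by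
    have : Real.exp (-c * t) ≤ 1 := Real.exp_le_one_iff.2 (by nlinarith)
    linarith
  have hfin : σ * b * s ^ 3 * ‖R t‖ ≤ G t := by
    refine (coupled_energy_le (β := σ * b) (κ := κ) (δ := δ) (s := s) (by positivity) hκ0
      (by positivity) hs (R1 := R1) (Y := Y) (H := H) (Z := Z)
      (h := fun t ↦ K * Real.exp (-m * t)) hR (fun t ↦ ?_) hY hH hZ hG (fun t ht ↦ ?_)
      (fun t ht ↦ ?_) ?_ ht).2.2
    · refine (hR1 t).congr_deriv ?_
      simp only [Y, hx]
      module
    · have := hle1 m t hm.le ht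
      have := hle1 (κ * x) t (by positivity) ht
      positivity
    · apply le_of_eq
      simp only [← hx]
      field_simp
      ring
    · rw [hR10, hY0, hR0, norm_zero, mul_zero, add_zero]
      have h1 : ‖((δ - κ) * κ ^ 2 * x ^ 2) • L0 - H 0‖ ≤
          (a + θ * κ + κ) * κ ^ 2 * x ^ 2 * P + K := by
        refine (norm_sub_le _ _).trans (add_le_add ?_ hH0)
        rw [norm_smul, norm_mul, norm_mul, Real.norm_of_nonneg (by positivity : 0 ≤ κ ^ 2),
          Real.norm_of_nonneg (by positivity : 0 ≤ x ^ 2)]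
        gcongr
        rw [Real.norm_eq_abs, abs_le]
        have : 0 < θ * κ := by positivity
        constructor <;> simp only [δ] <;> linarith
      have h2 : ‖(κ ^ 2 * x) • L0‖ ≤ κ ^ 2 * x * P := by
        rw [norm_smul, Real.norm_of_nonneg (by positivity)]
        gcongr
      have h3 : G 0 = G0 := by simp [G]
      rw [h3]
      calc _ ≤ σ * b * s ^ 2 * (κ ^ 2 * x * P) + ((a + θ * κ + κ) * κ ^ 2 * x ^ 2 * P + K) := by
            gcongr
        _ = G0 := by simp only [G0, hκ, hx]; ring
  refine hfin.trans ?_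
  have h1 : G t ≤ G0 + (σ * b + κ) * x * K / m * 1 + κ ^ 2 * x ^ 2 * b ^ 2 * P * 1 := by
    simp only [G]
    gcongr <;> linarith [Real.exp_pos (-m * t), Real.exp_pos (-(κ * x) * t)]
  refine h1.trans (le_of_eq ?_)
  simp only [hκ, hx]
  ring

end Remainder

/-! ### Uniform estimate of the remainder at each frequency. -/

section Remainder

variable {E : Type*} [NormedAddCommGroup E] [InnerProductSpace ℝ E]

/-- The initial energies of the profiles are controlled by the data. -/
theorem BlackstockModes.initial_bounds {a θ κ s : ℝ} (ha : 0 < a) (hθ : 0 < θ) (hθ1 : θ ≤ 1)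
    (hs : 0 < s) {u u1 u2 v v1 I I1 : ℝ → E}
    (h : BlackstockModes a θ κ (s ^ 2) u u1 u2 v v1 I I1) {M : ℝ}
    (hM : M = (1 + s ^ 2) * ‖v 0‖ + ‖v1 0‖) :
    ‖v1 0 + (a * s ^ 2) • v 0‖ ≤ (1 + a) * M ∧
    √(oscillatorEnergy a (s ^ 2) (v 0) (v1 0)) ≤ (3 + a) * M ∧
    √(oscillatorEnergy a (s ^ 2) (I 0) (I1 0)) ≤ (a * s ^ 2 + 2 * s) * ((1 + a) * M) := by
  have hM0 : 0 ≤ M := by rw [hM]; positivity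
  have n0 := norm_nonneg (v 0)
  have n1 := norm_nonneg (v1 0)
  have e4 : 0 ≤ s ^ 2 * ‖v 0‖ := by positivity
  have hv1M : ‖v1 0‖ ≤ M := by rw [hM]; linarith
  have hp0 : ‖v1 0 + (a * s ^ 2) • v 0‖ ≤ (1 + a) * M := by
    refine (norm_add_le _ _).trans ?_
    rw [norm_smul, Real.norm_of_nonneg (by positivity)]
    have e2 : 0 ≤ a * ‖v 0‖ := by positivity
    have e3 : 0 ≤ a * ‖v1 0‖ := by positivity
    rw [hM]
    linarith
  have hsv : s * ‖v 0‖ * 2 ≤ M := by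
    have := mul_nonneg (sq_nonneg (s - 1)) n0
    rw [hM]
    linarith
  refine ⟨hp0, ?_, ?_⟩
  · rw [Real.sqrt_le_left (by positivity)]
    unfold oscillatorEnergy
    have e1 : ‖v1 0 + (a * s ^ 2) • v 0‖ ^ 2 ≤ ((1 + a) * M) ^ 2 := by gcongr
    have e2 : ‖v1 0‖ ^ 2 ≤ M ^ 2 := by gcongr
    have e3 : (s * ‖v 0‖ * 2) ^ 2 ≤ M ^ 2 := by gcongr
    have e5 : 2 * s ^ 2 * ‖v 0‖ ^ 2 = (s * ‖v 0‖ * 2) ^ 2 / 2 := by ring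
    have e6 : 0 ≤ a * M ^ 2 := by positivity
    have e7 : 0 ≤ M ^ 2 := by positivity
    rw [e5]
    linarith
  · have hI0 : ‖I 0‖ ≤ (1 + a) * M := by
      rw [h.I_zero, norm_smul, norm_neg, Real.norm_of_nonneg hθ.le]
      calc _ ≤ 1 * ((1 + a) * M) := by gcongr
        _ = _ := one_mul _
    rw [Real.sqrt_le_left (by positivity)]
    unfold oscillatorEnergy
    rw [h.I1_zero, zero_add, norm_smul, norm_zero, Real.norm_of_nonneg (by positivity)]
    calc _ ≤ ((a * s ^ 2 + 2 * s) * ‖I 0‖) ^ 2 := by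
          have h1 : 0 ≤ a * s ^ 2 * s * ‖I 0‖ ^ 2 := by positivity
          have h2 : 0 ≤ (s * ‖I 0‖) ^ 2 := by positivity
          linarith
      _ ≤ _ := by gcongr

/-- The arithmetic that turns the energy bound into the bound on the remainder. -/
theorem remainder_le_of_energy_le {a θ σ s b b₁ c₁ c₂ M w m K r : ℝ} (ha : 0 < a)
    (hθ1 : θ ≤ 1) (hσ : 0 < σ) (hσ1 : σ ≤ 1) (hs : 0 < s) (hM0 : 0 ≤ M) (hb0 : 0 < b)
    (hba : b ≤ a + 1) (hb2 : b ^ 2 ≤ a) (hb₁0 : 0 < b₁) (hbb : b₁ ≤ b) (hc₁0 : 0 < c₁)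
    (hc₂0 : 0 < c₂) (hmw : 1 / m = c₁ * w) (hw : w = 1 + 1 / s ^ 2)
    (hKdef : K = σ ^ 4 * s ^ 4 * (c₂ * w * M)) (hr : 0 ≤ r)
    (key : σ * b * s ^ 3 * r ≤
      (σ * b * σ ^ 4 * s ^ 4 + (a + θ * σ ^ 2 + σ ^ 2) * σ ^ 4 * s ^ 4) * ((1 + a) * M) + K +
        (σ * b + σ ^ 2) * s ^ 2 * K / (m / 2) + σ ^ 4 * s ^ 4 * b ^ 2 * ((1 + a) * M)) :
    r ≤ 4 * ((((a + 1) + (a + 2)) * (1 + a) + c₂ + (a + 2) * c₂ * (2 * c₁) + a * (1 + a)) / b₁) *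
      σ ^ 3 * (1 / s + s ^ 3) * M := by
  have hκ1 : σ ^ 2 ≤ 1 := by nlinarith
  obtain ⟨c₃, hc₃⟩ : ∃ c₃, c₃ = ((a + 1) + (a + 2)) * (1 + a) + c₂ + (a + 2) * c₂ * (2 * c₁) +
    a * (1 + a) := ⟨_, rfl⟩
  have hc₃0 : 0 < c₃ := by rw [hc₃]; positivity
  rw [← hc₃]
  have hs4 : 0 < s ^ 4 := by positivity
  have hwle : s ^ 4 * w ≤ s ^ 4 + s ^ 2 := by rw [hw]; field_simp; rfl
  have hsw0 : 0 ≤ s ^ 2 * (s ^ 4 * w * w) := by rw [hw]; positivity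
  have hw2 : s ^ 2 * (s ^ 4 * w * w) = s ^ 2 * (s ^ 2 + 1) ^ 2 := by rw [hw]; field_simp
  have total : σ * b * s ^ 3 * r ≤ c₃ * σ ^ 4 * M * (s ^ 4 + s ^ 2 + s ^ 2 * (s ^ 2 + 1) ^ 2) := by
    refine key.trans ?_
    have t1 : (σ * b * σ ^ 4 * s ^ 4 + (a + θ * σ ^ 2 + σ ^ 2) * σ ^ 4 * s ^ 4) * ((1 + a) * M) ≤
        ((a + 1) + (a + 2)) * (1 + a) * (σ ^ 4 * M * s ^ 4) := by
      have f1 : σ * b ≤ 1 * (a + 1) := by gcongr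
      have f2 : θ * σ ^ 2 ≤ 1 * 1 := by gcongr
      calc _ = (σ * b + (a + θ * σ ^ 2 + σ ^ 2)) * (1 + a) * (σ ^ 4 * M * s ^ 4) := by ring
        _ ≤ _ := by
          have f3 : σ * b + (a + θ * σ ^ 2 + σ ^ 2) ≤ a + 1 + (a + 2) := by linarith
          gcongr
    have t2 : K ≤ c₂ * (σ ^ 4 * M * (s ^ 4 + s ^ 2)) := by
      calc K = c₂ * (σ ^ 4 * M * (s ^ 4 * w)) := by rw [hKdef]; ring
        _ ≤ _ := by gcongr
    have t3 : (σ * b + σ ^ 2) * s ^ 2 * K / (m / 2) ≤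
        (a + 2) * c₂ * (2 * c₁) * (σ ^ 4 * M * (s ^ 2 * (s ^ 2 + 1) ^ 2)) := by
      have f1 : σ * b ≤ 1 * (a + 1) := by gcongr
      calc _ = (σ * b + σ ^ 2) * s ^ 2 * K * (2 * (1 / m)) := by field_simp
        _ = (σ * b + σ ^ 2) * (c₂ * (2 * c₁) * (σ ^ 4 * M * (s ^ 2 * (s ^ 4 * w * w)))) := by
          rw [hmw, hKdef]; ring
        _ ≤ (a + 2) * (c₂ * (2 * c₁) * (σ ^ 4 * M * (s ^ 2 * (s ^ 4 * w * w)))) := by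
          have f3 : σ * b + σ ^ 2 ≤ a + 2 := by linarith
          gcongr
        _ = _ := by rw [hw2]; ring
    have t4 : σ ^ 4 * s ^ 4 * b ^ 2 * ((1 + a) * M) ≤ a * (1 + a) * (σ ^ 4 * M * s ^ 4) := by
      calc _ ≤ σ ^ 4 * s ^ 4 * a * ((1 + a) * M) := by gcongr
        _ = _ := by ring
    have z1 : 0 ≤ σ ^ 4 * M * s ^ 4 := by positivity
    have z2 : 0 ≤ σ ^ 4 * M * s ^ 2 := by positivity
    have z3 : 0 ≤ σ ^ 4 * M * (s ^ 2 * (s ^ 2 + 1) ^ 2) := by positivity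
    obtain ⟨q, hq⟩ : ∃ q, q = σ ^ 4 * M * (s ^ 4 + s ^ 2 + s ^ 2 * (s ^ 2 + 1) ^ 2) := ⟨_, rfl⟩
    have hq1 : σ ^ 4 * M * s ^ 4 ≤ q := by rw [hq, mul_add, mul_add]; linarith
    have hq2 : σ ^ 4 * M * (s ^ 4 + s ^ 2) ≤ q := by rw [hq, mul_add _ (s ^ 4 + s ^ 2)]; linarith
    have hq3 : σ ^ 4 * M * (s ^ 2 * (s ^ 2 + 1) ^ 2) ≤ q := by
      rw [hq, mul_add, mul_add]; linarith
    have hq0 : 0 ≤ q := z1.trans hq1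
    calc _ ≤ ((a + 1) + (a + 2)) * (1 + a) * q + c₂ * q + (a + 2) * c₂ * (2 * c₁) * q +
          a * (1 + a) * q := by
          refine add_le_add (add_le_add (add_le_add (t1.trans ?_) (t2.trans ?_)) (t3.trans ?_))
            (t4.trans ?_) <;> gcongr
      _ = c₃ * q := by rw [hc₃]; ring
      _ = _ := by rw [hq]; ring
  -- The middle powers are dominated by s² and s⁶. Dividing by the energy weight σ b s³ then leaves
  -- σ³ and 1/s + s³.
  have hpoly : s ^ 4 + s ^ 2 + s ^ 2 * (s ^ 2 + 1) ^ 2 ≤ s ^ 3 * (4 * (1 / s + s ^ 3)) := by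
    have : s ^ 3 * (4 * (1 / s + s ^ 3)) = 4 * (s ^ 2 + s ^ 6) := by field_simp
    rw [this]
    nlinarith [mul_nonneg (sq_nonneg s) (sq_nonneg (s ^ 2 - 1))]
  have h5 : (σ * s ^ 3) * (b₁ * r) ≤ (σ * s ^ 3) * (c₃ * σ ^ 3 * M * (4 * (1 / s + s ^ 3))) := by
    calc _ ≤ (σ * s ^ 3) * (b * r) := by gcongr
      _ = σ * b * s ^ 3 * r := by ring
      _ ≤ _ := total
      _ ≤ c₃ * σ ^ 4 * M * (s ^ 3 * (4 * (1 / s + s ^ 3))) := by gcongr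
      _ = _ := by ring
  have h6 := le_of_mul_le_mul_left h5 (by positivity)
  calc r = (b₁ * r) / b₁ := by field_simp
    _ ≤ (c₃ * σ ^ 3 * M * (4 * (1 / s + s ^ 3))) / b₁ := by gcongr
    _ = _ := by ring

set_option maxHeartbeats 400000 in
/-- The remainder of the second-order expansion, uniformly in time, frequency and `κ = σ²`. -/
theorem exists_expansionRemainder_le (a θ : ℝ) (ha : 0 < a) (hθ : 0 < θ) (hθ1 : θ ≤ 1) :
    ∃ C : ℝ, 0 < C ∧ ∀ σ s : ℝ, 0 < σ → σ ≤ 1 → σ ^ 2 ≤ a / 2 → 0 < s →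
      ∀ u u1 u2 v v1 I I1 : ℝ → E,
        BlackstockModes a θ (σ ^ 2) (s ^ 2) u u1 u2 v v1 I I1 → ∀ t, 0 ≤ t →
        ‖expansionRemainder a θ (σ ^ 2) (s ^ 2) u v v1 I t‖ ≤
          C * σ ^ 3 * (1 / s + s ^ 3) * ((1 + s ^ 2) * ‖v 0‖ + ‖v1 0‖) := by
  set c₁ : ℝ := (3 + 2 * a ^ 2) / a with hc₁
  have hc₁0 : 0 < c₁ := by positivity
  set c₂ : ℝ := (3 + a) + a * (3 + a) + (a + 2) * (1 + a) + 4 * (3 + a) * c₁ with hc₂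
  have hc₂0 : 0 < c₂ := by positivity
  -- Since κ ≤ a/2, this bounds √(θ(a - κ)) from below independently of κ, so dividing by β costs
  -- only a factor of order 1/√κ.
  set b₁ : ℝ := √(θ * a / 2) with hb₁
  have hb₁0 : 0 < b₁ := Real.sqrt_pos.2 (by positivity)
  set c₃ : ℝ := ((a + 1) + (a + 2)) * (1 + a) + c₂ + (a + 2) * c₂ * (2 * c₁) + a * (1 + a)
    with hc₃
  have hc₃0 : 0 < c₃ := by positivity
  refine ⟨4 * (c₃ / b₁), by positivity, ?_⟩
  intro σ s hσ hσ1 hσa hs u u1 u2 v v1 I I1 h t ht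
  have hx : 0 < s ^ 2 := by positivity
  set M : ℝ := (1 + s ^ 2) * ‖v 0‖ + ‖v1 0‖ with hM
  have hM0 : 0 ≤ M := by positivity
  have hκ1 : σ ^ 2 ≤ 1 := by nlinarith
  have hB : 0 < θ * (a - σ ^ 2) := mul_pos hθ (by linarith)
  set b := √(θ * (a - σ ^ 2)) with hbdef
  have hb : b ^ 2 = θ * (a - σ ^ 2) := Real.sq_sqrt hB.le
  have hb0 : 0 < b := Real.sqrt_pos.2 hB
  have hbb : b₁ ≤ b := Real.sqrt_le_sqrt (by nlinarith)
  have hb2 : b ^ 2 ≤ a := by rw [hb]; nlinarith [sq_nonneg σ]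
  have hba : b ≤ a + 1 := by nlinarith [sq_nonneg (b - 1)]
  obtain ⟨hp0, hN, hN'⟩ := h.initial_bounds ha hθ hθ1 hs hM
  have hH := fun t ht ↦ norm_residualPrimitive_le ha hθ (by positivity : 0 < σ ^ 2) hs h hN hN'
    (t := t) ht
  have hm := oscillatorRate_pos ha hx
  set m := oscillatorRate a (s ^ 2) with hmdef
  -- All the low-frequency losses are measured by w: 1/m is a multiple of it, and 1/s is at most w.
  set w : ℝ := 1 + 1 / s ^ 2 with hw
  have hw1 : 1 ≤ w := by rw [hw]; linarith [show 0 < 1 / s ^ 2 by positivity]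
  have hmw : 1 / m = c₁ * w := by
    rw [hmdef, hc₁, hw, oscillatorRate]; field_simp; ring
  have hsw : 1 / s ≤ w := by
    have e : 1 / s ^ 2 = (1 / s) ^ 2 := by rw [div_pow, one_pow]
    rw [hw, e]
    nlinarith [sq_nonneg (1 / s - 1 / 2)]
  set K : ℝ := σ ^ 4 * s ^ 4 * (c₂ * w * M) with hKdef
  have hK0 : 0 ≤ K := by positivity
  have hKle : θ * (σ ^ 2) ^ 2 * s ^ 4 * ((3 + a) * M / s + a * ((3 + a) * M) +
      (a * s ^ 2 + 2 * s) * ((1 + a) * M) / s ^ 2 + 4 * θ * ((3 + a) * M) / m) ≤ K := by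
    have e1 : (3 + a) * M / s ≤ (3 + a) * M * w := by
      rw [div_eq_mul_one_div]; gcongr
    have e2 : a * ((3 + a) * M) ≤ a * ((3 + a) * M) * w :=
      le_mul_of_one_le_right (by positivity) hw1
    have e3 : (a * s ^ 2 + 2 * s) * ((1 + a) * M) / s ^ 2 ≤ (a + 2) * (1 + a) * M * w := by
      have : (a * s ^ 2 + 2 * s) * ((1 + a) * M) / s ^ 2 =
          (a + 2 * (1 / s)) * ((1 + a) * M) := by field_simp
      rw [this]
      have : a + 2 * (1 / s) ≤ (a + 2) * w := by nlinarith
      calc _ ≤ (a + 2) * w * ((1 + a) * M) := by gcongr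
        _ = _ := by ring
    have e4 : 4 * θ * ((3 + a) * M) / m ≤ 4 * (3 + a) * c₁ * M * w := by
      rw [div_eq_mul_one_div, hmw]
      calc _ ≤ 4 * 1 * ((3 + a) * M) * (c₁ * w) := by gcongr
        _ = _ := by ring
    calc _ ≤ 1 * (σ ^ 2) ^ 2 * s ^ 4 * ((3 + a) * M * w + a * ((3 + a) * M) * w +
          (a + 2) * (1 + a) * M * w + 4 * (3 + a) * c₁ * M * w) := by gcongr
      _ = K := by rw [hKdef, hc₂]; ring
  have hP : ‖θ • (v1 0 + (a * s ^ 2) • v 0)‖ ≤ (1 + a) * M := by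
    rw [norm_smul, Real.norm_of_nonneg hθ.le]
    calc _ ≤ 1 * ((1 + a) * M) := by gcongr
      _ = _ := one_mul _
  have key := expansionRemainder_le_of_bounds ha hθ hσ (by linarith) hs h hb hb0 hK0
    (half_pos hm) hP (fun t ht ↦ (hH t ht).trans (by gcongr)) ht
  set r := ‖expansionRemainder a θ (σ ^ 2) (s ^ 2) u v v1 I t‖
  exact remainder_le_of_energy_le ha hθ1 hσ hσ1 hs hM0 hb0 hba hb2 hb₁0 hbb hc₁0 hc₂0 hmw hw hKdef
    (norm_nonneg _) key

end Remainder

/-! ### Completeness of the Schwartz space and equicontinuity. -/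

namespace SchwartzMap

open Filter Topology

variable {E F : Type*} [NormedAddCommGroup E] [NormedSpace ℝ E] [NormedAddCommGroup F]
  [NormedSpace ℝ F]

theorem seminorm_sub_lt_of_cauchySeq {f : ℕ → 𝓢(E, F)} (hf : CauchySeq f) (k n : ℕ) {ε : ℝ}
    (hε : 0 < ε) : ∃ N, ∀ i ≥ N, ∀ j ≥ N, SchwartzMap.seminorm ℝ k n (f i - f j) < ε := by
  have hc : Continuous (SchwartzMap.seminorm ℝ k n : 𝓢(E, F) → ℝ) :=
    (schwartz_withSeminorms ℝ E F).continuous_seminorm (k, n)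
  have hU : {p : 𝓢(E, F) × 𝓢(E, F) | SchwartzMap.seminorm ℝ k n (p.1 - p.2) < ε} ∈
      uniformity 𝓢(E, F) := by
    rw [uniformity_eq_comap_nhds_zero_swapped]
    exact preimage_mem_comap ((isOpen_lt hc continuous_const).mem_nhds (by simpa using hε))
  obtain ⟨N, hN⟩ := cauchySeq_iff.1 hf _ hU
  exact ⟨N, fun i hi j hj ↦ hN i hi j hj⟩

/-- For a Cauchy sequence the derivatives of each order converge uniformly, and the limits `G n`
form a Taylor series of the limit of the functions. The weighted estimates pass to the limit
pointwise. Completeness is needed for the uniform boundedness principle. -/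
instance instCompleteSpace [CompleteSpace F] : CompleteSpace 𝓢(E, F) := by
  have : (uniformity 𝓢(E, F)).IsCountablyGenerated :=
    IsUniformAddGroup.uniformity_countably_generated
  refine UniformSpace.complete_of_cauchySeq_tendsto fun f hf ↦ ?_
  have hpt : ∀ n k : ℕ, ∀ ε > 0, ∃ N, ∀ i ≥ N, ∀ j ≥ N, ∀ x,
      ‖x‖ ^ k * ‖iteratedFDeriv ℝ n (f i) x - iteratedFDeriv ℝ n (f j) x‖ < ε := by
    intro n k ε hε
    obtain ⟨N, hN⟩ := seminorm_sub_lt_of_cauchySeq hf k n hε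
    refine ⟨N, fun i hi j hj x ↦ lt_of_le_of_lt ?_ (hN i hi j hj)⟩
    have := le_seminorm ℝ k n (f i - f j) x
    rwa [FunLike.coe_sub, iteratedFDeriv_sub ((f i).smooth n) ((f j).smooth n)] at this
  have hlim : ∀ n x, ∃ y, Tendsto (fun i ↦ iteratedFDeriv ℝ n (f i) x) atTop (𝓝 y) := by
    intro n x
    refine cauchySeq_tendsto_of_complete (Metric.cauchySeq_iff.2 fun ε hε ↦ ?_)
    obtain ⟨N, hN⟩ := hpt n 0 ε hε
    refine ⟨N, fun i hi j hj ↦ ?_⟩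
    simpa [dist_eq_norm] using hN i hi j hj x
  choose G hG using hlim
  have hle : ∀ n k : ℕ, ∀ ε > 0, ∃ N, ∀ i ≥ N, ∀ x,
      ‖x‖ ^ k * ‖iteratedFDeriv ℝ n (f i) x - G n x‖ ≤ ε := by
    intro n k ε hε
    obtain ⟨N, hN⟩ := hpt n k ε hε
    refine ⟨N, fun i hi x ↦ ?_⟩
    refine le_of_tendsto (((tendsto_const_nhds.sub (hG n x)).norm).const_mul _) ?_
    filter_upwards [eventually_ge_atTop N] with j hj using (hN i hi j hj x).le
  have hunif : ∀ n, TendstoUniformly (fun i ↦ iteratedFDeriv ℝ n (f i)) (G n) atTop := by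
    intro n
    refine Metric.tendstoUniformly_iff.2 fun ε hε ↦ ?_
    obtain ⟨N, hN⟩ := hle n 0 (ε / 2) (half_pos hε)
    filter_upwards [eventually_ge_atTop N] with i hi x
    have := hN i hi x
    rw [pow_zero, one_mul, ← dist_eq_norm, dist_comm] at this
    linarith
  have hder : ∀ n x, HasFDerivAt (G n) (G (n + 1) x).curryLeft x := by
    intro n x
    have hcurry : UniformContinuous
        (fun m : E [×(n + 1)]→L[ℝ] F ↦ m.curryLeft) :=
      (continuousMultilinearCurryLeftEquiv ℝ (fun _ : Fin (n + 1) ↦ E) F).isometry.uniformContinuous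
    refine hasFDerivAt_of_tendstoUniformly (l := atTop)
      (f' := fun i x ↦ (iteratedFDeriv ℝ (n + 1) (f i) x).curryLeft)
      (hcurry.comp_tendstoUniformly (hunif (n + 1))) (fun i x ↦ ?_) (hG n) x
    have := ((f i).smooth ⊤).ftaylorSeries.fderiv n (by exact_mod_cast WithTop.coe_lt_top _) x
    exact this
  have htaylor : HasFTaylorSeriesUpTo (⊤ : ℕ∞) (fun x ↦ (G 0 x).curry0) (fun x n ↦ G n x) :=
    ⟨fun x ↦ rfl, fun n _ x ↦ hder n x,
      fun n _ ↦ continuous_iff_continuousAt.2 fun x ↦ (hder n x).continuousAt⟩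
  have hit : ∀ n x, iteratedFDeriv ℝ n (fun x ↦ (G 0 x).curry0) x = G n x := fun n x ↦
    (htaylor.eq_iteratedFDeriv (by exact_mod_cast le_top) x).symm
  let g : 𝓢(E, F) :=
    { toFun := fun x ↦ (G 0 x).curry0
      smooth' := htaylor.contDiff
      decay' := by
        intro k n
        obtain ⟨N, hN⟩ := hle n k 1 one_pos
        refine ⟨SchwartzMap.seminorm ℝ k n (f N) + 1, fun x ↦ ?_⟩
        rw [hit]
        have h1 := hN N le_rfl x
        have h2 := le_seminorm ℝ k n (f N) x
        have h3 : ‖G n x‖ ≤ ‖iteratedFDeriv ℝ n (f N) x‖ +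
            ‖iteratedFDeriv ℝ n (f N) x - G n x‖ := by
          have := norm_sub_le (iteratedFDeriv ℝ n (f N) x) (iteratedFDeriv ℝ n (f N) x - G n x)
          rwa [sub_sub_cancel] at this
        calc _ ≤ ‖x‖ ^ k * (‖iteratedFDeriv ℝ n (f N) x‖ +
              ‖iteratedFDeriv ℝ n (f N) x - G n x‖) := by gcongr
          _ ≤ _ := by rw [mul_add]; exact add_le_add h2 h1 }
  refine ⟨g, ((schwartz_withSeminorms ℝ E F).tendsto_nhds _ _).2 fun ⟨k, n⟩ ε hε ↦ ?_⟩
  obtain ⟨N, hN⟩ := hle n k (ε / 2) (half_pos hε)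
  filter_upwards [eventually_ge_atTop N] with i hi
  refine lt_of_le_of_lt (seminorm_le_bound ℝ k n _ (half_pos hε).le fun x ↦ ?_)
    (half_lt_self hε)
  have : iteratedFDeriv ℝ n (⇑(f i - g)) x = iteratedFDeriv ℝ n (f i) x - G n x := by
    rw [FunLike.coe_sub, iteratedFDeriv_sub ((f i).smooth n) (g.smooth n), ← hit n x]
    rfl
  rw [this]
  exact hN i hi x

/-- Uniform boundedness principle on the Schwartz space. -/
theorem exists_norm_le_sup_seminorm {ι : Type*} {u : ι → 𝓢(E, ℂ) →ₗ[ℂ] ℂ}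
    (hu : ∀ i, Continuous (u i)) (hb : ∀ φ, ∃ C, ∀ i, ‖u i φ‖ ≤ C) :
    ∃ (s : Finset (ℕ × ℕ)) (C : ℝ), 0 ≤ C ∧ ∀ i φ,
      ‖u i φ‖ ≤ C * (s.sup (schwartzSeminormFamily ℂ E ℂ)) φ := by
  -- Together with completeness this makes the Schwartz space a Baire space, hence barrelled, so
  -- that a pointwise finite supremum of continuous seminorms is continuous.
  have : (uniformity 𝓢(E, ℂ)).IsCountablyGenerated :=
    IsUniformAddGroup.uniformity_countably_generated
  let p : ι → Seminorm ℂ 𝓢(E, ℂ) := fun i ↦ (normSeminorm ℂ ℂ).comp (u i)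
  have hbdd : BddAbove (Set.range p) := by
    rw [Seminorm.bddAbove_range_iff]
    intro φ
    obtain ⟨C, hC⟩ := hb φ
    exact ⟨C, by rintro _ ⟨i, rfl⟩; exact hC i⟩
  have hcont : Continuous (⨆ i, p i : Seminorm ℂ 𝓢(E, ℂ)) := by
    rw [Seminorm.coe_iSup_eq hbdd]
    exact Seminorm.continuous_iSup p (fun i ↦ (hu i).norm) hbdd
  obtain ⟨s, C, -, hC⟩ := Seminorm.bound_of_continuous (schwartz_withSeminorms ℂ E ℂ) _ hcont
  refine ⟨s, C, C.2, fun i φ ↦ ?_⟩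
  refine le_trans ?_ (hC φ)
  rw [Seminorm.iSup_apply hbdd]
  exact le_ciSup (f := fun i ↦ p i φ) (Seminorm.bddAbove_range_iff.1 hbdd φ) i

end SchwartzMap

/-! ### Uniqueness for multiplication systems, tested on compact supports. -/

namespace SchwartzMap

open Filter Topology

variable {E : Type*} [NormedAddCommGroup E] [NormedSpace ℝ E]

/-- Iterated multiplication of a compactly supported function by a fixed smooth function grows at
most geometrically in every Schwartz seminorm. -/
theorem exists_seminorm_iterate_smulLeft_le {X : E → ℂ} (hX : X.HasTemperateGrowth)
    {φ : 𝓢(E, ℂ)} (hφ : HasCompactSupport φ) (l n : ℕ) :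
    ∃ K B : ℝ, 0 ≤ K ∧ 1 ≤ B ∧ ∀ k : ℕ,
      SchwartzMap.seminorm ℂ l n ((smulLeftCLM ℂ X)^[k] φ) ≤ K * B ^ k := by
  have hcomp : IsCompact (tsupport φ) := hφ
  have hXb : ∃ b : ℝ, 1 ≤ b ∧ ∀ j ≤ n, ∀ x ∈ tsupport φ, ‖iteratedFDeriv ℝ j X x‖ ≤ b := by
    have h1 : ∀ j, ∃ b : ℝ, ∀ x ∈ tsupport φ, ‖iteratedFDeriv ℝ j X x‖ ≤ b := fun j ↦
      hcomp.exists_bound_of_continuousOn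
        ((hX.1.continuous_iteratedFDeriv (by exact_mod_cast le_top)).continuousOn)
    choose b hb using h1
    refine ⟨1 + ∑ j ∈ Finset.range (n + 1), |b j|, by
      linarith [Finset.sum_nonneg fun j (_ : j ∈ Finset.range (n + 1)) ↦ abs_nonneg (b j)],
      fun j hj x hx ↦ (hb j x hx).trans ?_⟩
    have := Finset.single_le_sum (fun j _ ↦ abs_nonneg (b j))
      (Finset.mem_range.2 (Nat.lt_succ_of_le hj))
    linarith [le_abs_self (b j)]
  obtain ⟨b, hb1, hb⟩ := hXb
  obtain ⟨r, hr⟩ := hcomp.isBounded.exists_norm_le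
  set M : ℝ := ∑ j ∈ Finset.range (n + 1), SchwartzMap.seminorm ℂ 0 j φ with hM
  have hM0 : 0 ≤ M := Finset.sum_nonneg fun _ _ ↦ apply_nonneg _ _
  have hsupp : ∀ k, tsupport ((smulLeftCLM ℂ X)^[k] φ) ⊆ tsupport φ := by
    intro k
    induction k with
    | zero => simp
    | succ k ih =>
      rw [Function.iterate_succ_apply']
      exact (tsupport_smulLeftCLM_subset _ _).trans (Set.inter_subset_left.trans ih)
  have hB1 : 1 ≤ 2 ^ n * b := by
    have : (1 : ℝ) ≤ 2 ^ n := one_le_pow₀ one_le_two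
    nlinarith
  -- On the support of φ the derivatives of X up to order n are bounded by b, and the binomial
  -- coefficients in the Leibniz rule sum to at most 2ⁿ: each multiplication costs a factor 2ⁿb. Off
  -- the support everything vanishes.
  have main : ∀ k, ∀ j ≤ n, ∀ x,
      ‖iteratedFDeriv ℝ j ((smulLeftCLM ℂ X)^[k] φ) x‖ ≤ M * (2 ^ n * b) ^ k := by
    intro k
    induction k with
    | zero =>
      intro j hj x
      rw [pow_zero, mul_one]
      have h1 := norm_iteratedFDeriv_le_seminorm ℂ φ j x
      refine h1.trans ?_
      exact Finset.single_le_sum (f := fun j ↦ SchwartzMap.seminorm ℂ 0 j φ)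
        (fun j _ ↦ apply_nonneg _ _) (Finset.mem_range.2 (Nat.lt_succ_of_le hj))
    | succ k ih =>
      intro j hj x
      by_cases hx : x ∈ tsupport φ
      · rw [Function.iterate_succ_apply', smulLeftCLM_apply hX]
        set ψ := (smulLeftCLM ℂ X)^[k] φ
        have h1 := norm_iteratedFDeriv_smul_le (𝕜 := ℝ) (f := X) (g := ψ) (n := j)
          (N := (⊤ : ℕ∞)) hX.1 (ψ.smooth ⊤) x (by exact_mod_cast le_top)
        refine h1.trans ?_
        calc _ ≤ ∑ i ∈ Finset.range (j + 1), (j.choose i : ℝ) * b * (M * (2 ^ n * b) ^ k) := by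
              refine Finset.sum_le_sum fun i hi ↦ ?_
              have hi' : i ≤ j := Nat.lt_succ_iff.1 (Finset.mem_range.1 hi)
              have := hb i (hi'.trans hj) x hx
              have := ih (j - i) (by omega) x
              gcongr
          _ = 2 ^ j * b * (M * (2 ^ n * b) ^ k) := by
              rw [← Finset.sum_mul, ← Finset.sum_mul]
              congr 2
              exact_mod_cast Nat.sum_range_choose j
          _ ≤ 2 ^ n * b * (M * (2 ^ n * b) ^ k) := by
              gcongr
              exact one_le_two
          _ = _ := by ring
      · have : iteratedFDeriv ℝ j ((smulLeftCLM ℂ X)^[k + 1] φ) x = 0 := by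
          by_contra hne
          exact hx (hsupp _ (support_iteratedFDeriv_subset (𝕜 := ℝ) j hne))
        rw [this, norm_zero]
        positivity
  refine ⟨|r| ^ l * M, 2 ^ n * b, by positivity, hB1, fun k ↦ ?_⟩
  refine seminorm_le_bound ℂ l n _ (by positivity) fun x ↦ ?_
  by_cases hx : x ∈ tsupport φ
  · have h1 := (hr x hx).trans (le_abs_self r)
    have h2 := main k n le_rfl x
    rw [mul_assoc]
    gcongr
  · have : iteratedFDeriv ℝ n ((smulLeftCLM ℂ X)^[k] φ) x = 0 := by
      by_contra hne
      exact hx (hsupp _ (support_iteratedFDeriv_subset (𝕜 := ℝ) n hne))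
    rw [this, norm_zero, mul_zero]
    positivity

theorem exists_sup_seminorm_iterate_smulLeft_le {X : E → ℂ} (hX : X.HasTemperateGrowth)
    {φ : 𝓢(E, ℂ)} (hφ : HasCompactSupport φ) (s : Finset (ℕ × ℕ)) :
    ∃ K B : ℝ, 0 ≤ K ∧ 1 ≤ B ∧ ∀ k : ℕ,
      (s.sup (schwartzSeminormFamily ℂ E ℂ)) ((smulLeftCLM ℂ X)^[k] φ) ≤ K * B ^ k := by
  classical
  induction s using Finset.induction_on with
  | empty => exact ⟨0, 1, le_rfl, le_rfl, fun k ↦ by simp⟩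
  | insert a s _ ih =>
    obtain ⟨K, B, hK, hB, h⟩ := ih
    obtain ⟨K', B', hK', hB', h'⟩ := exists_seminorm_iterate_smulLeft_le hX hφ a.1 a.2
    refine ⟨max K K', max B B', hK.trans (le_max_left _ _), hB.trans (le_max_left _ _),
      fun k ↦ ?_⟩
    rw [Finset.sup_insert, Seminorm.sup_apply]
    refine sup_le ((h' k).trans ?_) ((h k).trans ?_)
    · gcongr
      · exact le_max_right _ _
      · exact le_max_right _ _
    · gcongr
      · exact le_max_left _ _
      · exact le_max_left _ _

/-- A first-order linear system of evolution equations in `𝓢'` whose coefficients are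
polynomials in a multiplication operator has at most one solution, tested on compactly supported
functions. -/
theorem system_apply_eq_zero {ι : Type*} [Fintype ι] {X : E → ℂ} (hX : X.HasTemperateGrowth)
    {d : ℕ} (c : ι → ι → Fin d → ℂ) {u : ι → ℝ → 𝓢'(E, ℂ)}
    (hu : ∀ i φ t, 0 ≤ t → HasDerivWithinAt (fun τ ↦ u i τ φ)
      (∑ j, ∑ l : Fin d, c i j l * u j t ((smulLeftCLM ℂ X)^[(l : ℕ)] φ)) (Set.Ici 0) t)
    (h0 : ∀ i, u i 0 = 0) {T : ℝ} (hT : 0 ≤ T) {φ : 𝓢(E, ℂ)} (hφ : HasCompactSupport φ) (i : ι) :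
    u i T φ = 0 := by
  have hcont : ∀ i φ, ContinuousOn (fun τ ↦ u i τ φ) (Set.Icc 0 T) := fun i φ t ht ↦
    ((hu i φ t ht.1).continuousWithinAt).mono Set.Icc_subset_Ici_self
  -- Each pairing is continuous in time, hence bounded on [0, T]; equicontinuity gives one seminorm
  -- that serves for all components and all times.
  obtain ⟨s, C, hC, hbound⟩ := exists_norm_le_sup_seminorm
    (u := fun p : ι × Set.Icc (0 : ℝ) T ↦ (u p.1 p.2 : 𝓢(E, ℂ) →ₗ[ℂ] ℂ))
    (fun p ↦ (u p.1 p.2).continuous) (fun ψ ↦ by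
      have h1 : ∀ i, ∃ b, ∀ t ∈ Set.Icc (0 : ℝ) T, ‖u i t ψ‖ ≤ b := fun i ↦
        isCompact_Icc.exists_bound_of_continuousOn (hcont i ψ)
      choose b hb using h1
      refine ⟨∑ i, |b i|, fun p ↦ (hb p.1 p.2 p.2.2).trans ?_⟩
      exact (le_abs_self _).trans
        (Finset.single_le_sum (fun i _ ↦ abs_nonneg (b i)) (Finset.mem_univ p.1)))
  obtain ⟨K, B, hK, hB, hKB⟩ := exists_sup_seminorm_iterate_smulLeft_le hX hφ s
  set D : ℝ := ∑ i, ∑ j, ∑ l : Fin d, ‖c i j l‖ * B ^ (l : ℕ) with hD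
  have hD0 : 0 ≤ D := by positivity
  -- Picard iteration: each integration in time gains t/(m + 1) and applies X further to the test
  -- function, which costs a power of B already included in D. The bound must hold for all k at once
  -- for the induction to close.
  have main : ∀ m k : ℕ, ∀ i, ∀ t ∈ Set.Icc (0 : ℝ) T,
      ‖u i t ((smulLeftCLM ℂ X)^[k] φ)‖ ≤ C * K * B ^ k * ((D * t) ^ m / m.factorial) := by
    intro m
    induction m with
    | zero =>
      intro k i t ht
      have h1 := hbound (i, ⟨t, ht⟩) ((smulLeftCLM ℂ X)^[k] φ)
      have h2 := mul_le_mul_of_nonneg_left (hKB k) hC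
      simp only [pow_zero, Nat.factorial_zero, Nat.cast_one, div_one, mul_one]
      exact h1.trans (h2.trans_eq (by ring))
    | succ m ih =>
      intro k i t ht
      have hder : ∀ t, HasDerivAt
          (fun t ↦ C * K * B ^ k * ((D * t) ^ (m + 1) / (m + 1).factorial))
          (C * K * B ^ k * (D * ((D * t) ^ m / m.factorial))) t := by
        intro t
        have := ((((hasDerivAt_id t).const_mul D).pow (m + 1)).div_const
          ((m + 1).factorial : ℝ)).const_mul (C * K * B ^ k)
        refine this.congr_deriv ?_
        rw [Nat.factorial_succ]
        push_cast
        simp only [id, mul_one]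
        field_simp
      refine image_norm_le_of_norm_deriv_right_le_deriv_boundary'
        (f := fun τ ↦ u i τ ((smulLeftCLM ℂ X)^[k] φ)) (hcont i _)
        (fun t ht ↦ (hu i _ t ht.1).mono (Set.Ici_subset_Ici.2 ht.1)) ?_
        (fun t _ ↦ (hder t).continuousAt.continuousWithinAt)
        (fun t _ ↦ (hder t).hasDerivWithinAt) ?_ ht
      · simp [h0 i]
      · intro t ht
        have ht' : t ∈ Set.Icc (0 : ℝ) T := ⟨ht.1, ht.2.le⟩
        have ht0 := ht.1
        set Q := C * K * B ^ k * ((D * t) ^ m / m.factorial) with hQ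
        have hQ0 : 0 ≤ Q := by positivity
        calc _ ≤ ∑ j, ∑ l : Fin d, ‖c i j l‖ * B ^ (l : ℕ) * Q := by
              refine (norm_sum_le _ _).trans (Finset.sum_le_sum fun j _ ↦
                (norm_sum_le _ _).trans (Finset.sum_le_sum fun l _ ↦ ?_))
              rw [norm_mul, ← Function.iterate_add_apply, mul_assoc]
              refine mul_le_mul_of_nonneg_left ((ih (l + k) j t ht').trans_eq ?_) (norm_nonneg _)
              rw [hQ, pow_add]; ring
          _ = (∑ j, ∑ l : Fin d, ‖c i j l‖ * B ^ (l : ℕ)) * Q := by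
              simp only [Finset.sum_mul]
          _ ≤ D * Q := by
              refine mul_le_mul_of_nonneg_right ?_ hQ0
              exact Finset.single_le_sum
                (f := fun i ↦ ∑ j, ∑ l : Fin d, ‖c i j l‖ * B ^ (l : ℕ))
                (fun i _ ↦ by positivity) (Finset.mem_univ i)
          _ = _ := by rw [hQ]; ring
  have hlim : Tendsto (fun m : ℕ ↦ C * K * B ^ 0 * ((D * T) ^ m / m.factorial)) atTop (𝓝 0) := by
    have := (FloorSemiring.tendsto_pow_div_factorial_atTop (D * T)).const_mul (C * K * B ^ 0)
    rwa [mul_zero] at this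
  have := ge_of_tendsto' hlim (fun m ↦ main m 0 i T ⟨hT, le_rfl⟩)
  simpa using this

end SchwartzMap

/-! ### Density of compactly supported functions and uniqueness on all test functions. -/

namespace SchwartzMap

open Filter Topology

variable {E : Type*} [NormedAddCommGroup E] [InnerProductSpace ℝ E] [FiniteDimensional ℝ E]

/-- Smooth compactly supported functions are dense in the Schwartz space. -/
theorem exists_seq_hasCompactSupport_tendsto (φ : 𝓢(E, ℂ)) :
    ∃ ψ : ℕ → 𝓢(E, ℂ), (∀ j, HasCompactSupport (ψ j)) ∧ Tendsto ψ atTop (𝓝 φ) := by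
  let χ : ContDiffBump (0 : E) := ⟨1, 2, one_pos, one_lt_two⟩
  have hχs : ContDiff ℝ (⊤ : ℕ∞) (fun x ↦ (χ x : ℂ)) :=
    Complex.ofRealCLM.contDiff.comp χ.contDiff
  have hχc : HasCompactSupport (fun x ↦ (χ x : ℂ)) :=
    χ.hasCompactSupport.comp_left (g := fun r : ℝ ↦ (r : ℂ)) Complex.ofReal_zero
  let ε : ℕ → ℝ := fun j ↦ 1 / ((j : ℝ) + 1)
  have hε0 : ∀ j, 0 < ε j := fun j ↦ by positivity
  have hε1 : ∀ j, ε j ≤ 1 := fun j ↦ by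
    simp only [ε]
    rw [div_le_one (by positivity)]
    linarith [show (0 : ℝ) ≤ j from Nat.cast_nonneg j]
  let g : ℕ → E → ℂ := fun j x ↦ (χ (ε j • x) : ℂ)
  have hgs : ∀ j, ContDiff ℝ (⊤ : ℕ∞) (g j) := fun j ↦
    hχs.comp (contDiff_const_smul (ε j))
  have hgc : ∀ j, HasCompactSupport (g j) := fun j ↦
    hχc.comp_homeomorph (Homeomorph.smulOfNeZero (ε j) (hε0 j).ne')
  have hgt : ∀ j, (g j).HasTemperateGrowth := fun j ↦ (hgc j).hasTemperateGrowth (hgs j)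
  have hgb : ∀ n, ∃ C, 0 ≤ C ∧ ∀ j x, ‖iteratedFDeriv ℝ n (g j) x‖ ≤ C := by
    intro n
    obtain ⟨C, hC⟩ := (hχc.iteratedFDeriv (𝕜 := ℝ) n).exists_bound_of_continuous
      (hχs.continuous_iteratedFDeriv (by exact_mod_cast le_top))
    have hC0 : 0 ≤ C := (norm_nonneg _).trans (hC 0)
    refine ⟨C, hC0, fun j x ↦ ?_⟩
    have h1 := ContinuousLinearMap.iteratedFDeriv_comp_right
      (ε j • ContinuousLinearMap.id ℝ E) hχs x (i := n) (by exact_mod_cast le_top)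
    have h2 : (fun x ↦ (χ x : ℂ)) ∘ (ε j • ContinuousLinearMap.id ℝ E) = g j := rfl
    rw [h2] at h1
    rw [h1]
    refine (ContinuousMultilinearMap.norm_compContinuousLinearMap_le _ _).trans ?_
    have h3 : ‖ε j • ContinuousLinearMap.id ℝ E‖ ≤ 1 := by
      rw [norm_smul, Real.norm_of_nonneg (hε0 j).le]
      exact mul_le_one₀ (hε1 j) (norm_nonneg _) ContinuousLinearMap.norm_id_le
    calc _ ≤ C * 1 := by
          gcongr
          · exact hC _
          · exact Finset.prod_le_one (fun _ _ ↦ norm_nonneg _) fun _ _ ↦ h3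
      _ = C := mul_one C
  choose C hC0 hC using hgb
  refine ⟨fun j ↦ smulLeftCLM ℂ (g j) φ, fun j ↦ ?_, ?_⟩
  · exact (hgc j).of_isClosed_subset (isClosed_tsupport _)
      ((tsupport_smulLeftCLM_subset _ _).trans Set.inter_subset_right)
  refine ((schwartz_withSeminorms ℝ E ℂ).tendsto_nhds _ _).2 fun ⟨k, n⟩ δ hδ ↦ ?_
  set K : ℝ := (∑ i ∈ Finset.range (n + 1),
    (n.choose i : ℝ) * C i * SchwartzMap.seminorm ℝ (k + 1) (n - i) φ) +
    SchwartzMap.seminorm ℝ (k + 1) n φ with hK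
  have hK0 : 0 ≤ K := by
    refine add_nonneg (Finset.sum_nonneg fun i _ ↦ ?_) (apply_nonneg _ _)
    have := hC0 i
    positivity
  -- Where ‖ε x‖ < 1 the cutoff is locally 1 and the difference vanishes. Elsewhere 1 ≤ ε‖x‖, so one
  -- factor ε is bought with one more power of ‖x‖.
  have key : ∀ j, SchwartzMap.seminorm ℝ k n (smulLeftCLM ℂ (g j) φ - φ) ≤ K * ε j := by
    intro j
    refine seminorm_le_bound ℝ k n _ (mul_nonneg hK0 (hε0 j).le) fun x ↦ ?_
    by_cases hx : ‖ε j • x‖ < 1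
    · have hev : (⇑(smulLeftCLM ℂ (g j) φ - φ)) =ᶠ[𝓝 x] 0 := by
        have hopen : IsOpen {y : E | ‖ε j • y‖ < 1} :=
          isOpen_lt (by fun_prop) continuous_const
        filter_upwards [hopen.mem_nhds hx] with y hy
        have : χ (ε j • y) = 1 := χ.one_of_mem_closedBall (by
          rw [mem_closedBall_zero_iff]; exact le_of_lt hy)
        rw [sub_apply, smulLeftCLM_apply_apply (hgt j)]
        simp [g, this]
      have h0 := (hev.iteratedFDeriv ℝ n).eq_of_nhds
      rw [h0]
      have : iteratedFDeriv ℝ n (0 : E → ℂ) = 0 := iteratedFDeriv_fun_zero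
      rw [this]
      simp only [Pi.zero_apply, norm_zero, mul_zero]
      exact mul_nonneg hK0 (hε0 j).le
    · rw [norm_smul, Real.norm_of_nonneg (hε0 j).le, not_lt] at hx
      have h1 : iteratedFDeriv ℝ n (⇑(smulLeftCLM ℂ (g j) φ - φ)) x =
          iteratedFDeriv ℝ n (fun y ↦ g j y • φ y) x - iteratedFDeriv ℝ n φ x := by
        rw [FunLike.coe_sub, iteratedFDeriv_sub ((smulLeftCLM ℂ (g j) φ).smooth n) (φ.smooth n),
          smulLeftCLM_apply (hgt j)]
        rfl
      have h2 : ‖x‖ ^ k ≤ ‖x‖ ^ (k + 1) * ε j := by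
        rw [pow_succ, mul_assoc]
        refine le_mul_of_one_le_right (by positivity) ?_
        linarith
      have h3 := norm_iteratedFDeriv_smul_le (𝕜 := ℝ) (f := g j) (g := φ) (n := n)
          (N := (⊤ : ℕ∞)) (hgs j) (φ.smooth ⊤) x (by exact_mod_cast le_top)
      have h4 : ‖x‖ ^ (k + 1) * ‖iteratedFDeriv ℝ n (fun y ↦ g j y • φ y) x‖ ≤
          ∑ i ∈ Finset.range (n + 1),
            (n.choose i : ℝ) * C i * SchwartzMap.seminorm ℝ (k + 1) (n - i) φ := by
        refine (mul_le_mul_of_nonneg_left h3 (by positivity)).trans ?_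
        rw [Finset.mul_sum]
        refine Finset.sum_le_sum fun i _ ↦ ?_
        have e1 := le_seminorm ℝ (k + 1) (n - i) φ x
        have e2 := hC i j x
        have e3 := hC0 i
        calc _ = (n.choose i : ℝ) * ‖iteratedFDeriv ℝ i (g j) x‖ *
              (‖x‖ ^ (k + 1) * ‖iteratedFDeriv ℝ (n - i) φ x‖) := by ring
          _ ≤ _ := by gcongr
      have h5 := le_seminorm ℝ (k + 1) n φ x
      rw [h1]
      calc _ ≤ (‖x‖ ^ (k + 1) * ε j) * (‖iteratedFDeriv ℝ n (fun y ↦ g j y • φ y) x‖ +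
            ‖iteratedFDeriv ℝ n φ x‖) := by
            gcongr
            exact norm_sub_le _ _
        _ = (‖x‖ ^ (k + 1) * ‖iteratedFDeriv ℝ n (fun y ↦ g j y • φ y) x‖ +
            ‖x‖ ^ (k + 1) * ‖iteratedFDeriv ℝ n φ x‖) * ε j := by ring
        _ ≤ K * ε j := by
            have := (hε0 j).le
            rw [hK]
            gcongr
  have hlim : Tendsto (fun j ↦ K * ε j) atTop (𝓝 0) := by
    have := (tendsto_one_div_add_atTop_nhds_zero_nat (𝕜 := ℝ)).const_mul K
    rwa [mul_zero] at this
  filter_upwards [hlim.eventually (gt_mem_nhds hδ)] with j hj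
  exact (key j).trans_lt hj

/-- Uniqueness for first-order linear systems in `𝓢'` whose coefficients are polynomials in a
multiplication operator. -/
theorem system_eq_zero {ι : Type*} [Fintype ι] {X : E → ℂ} (hX : X.HasTemperateGrowth)
    {d : ℕ} (c : ι → ι → Fin d → ℂ) {u : ι → ℝ → 𝓢'(E, ℂ)}
    (hu : ∀ i φ t, 0 ≤ t → HasDerivWithinAt (fun τ ↦ u i τ φ)
      (∑ j, ∑ l : Fin d, c i j l * u j t ((smulLeftCLM ℂ X)^[(l : ℕ)] φ)) (Set.Ici 0) t)
    (h0 : ∀ i, u i 0 = 0) {T : ℝ} (hT : 0 ≤ T) (i : ι) : u i T = 0 := by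
  ext φ
  obtain ⟨ψ, hψ, hlim⟩ := exists_seq_hasCompactSupport_tendsto φ
  have h1 : Tendsto (fun j ↦ u i T (ψ j)) atTop (𝓝 (u i T φ)) :=
    ((u i T).continuous.tendsto φ).comp hlim
  have h2 : (fun j ↦ u i T (ψ j)) = fun _ ↦ 0 :=
    funext fun j ↦ system_apply_eq_zero hX c hu h0 hT (hψ j) i
  rw [h2] at h1
  exact (tendsto_nhds_unique tendsto_const_nhds h1).symm

end SchwartzMap

/-! ### Solving the Fourier-side equations, continuously in the frequency. -/

section Flow

/-- Linear systems with continuous parameter dependence have jointly continuous solutions. -/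
theorem exists_linear_flow {Y : Type*} [TopologicalSpace Y] {d : ℕ}
    {A : Y → Matrix (Fin d) (Fin d) ℂ} (hA : Continuous A) {U₀ : Y → Fin d → ℂ}
    (hU₀ : Continuous U₀) :
    ∃ U : ℝ → Y → Fin d → ℂ, Continuous (fun p : ℝ × Y ↦ U p.1 p.2) ∧ (∀ y, U 0 y = U₀ y) ∧
      ∀ t y i, HasDerivAt (fun τ ↦ U τ y i) (Matrix.mulVec (A y) (U t y) i) t := by
  let Φ : Matrix (Fin d) (Fin d) ℂ →ₗ[ℂ] ((Fin d → ℂ) →L[ℂ] (Fin d → ℂ)) :=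
    (LinearMap.toContinuousLinearMap (𝕜 := ℂ) (E := Fin d → ℂ) (F' := Fin d → ℂ)).toLinearMap ∘ₗ
      (Matrix.toLin' (R := ℂ)).toLinearMap
  let _ : NormedAlgebra ℚ ((Fin d → ℂ) →L[ℂ] (Fin d → ℂ)) :=
    NormedAlgebra.restrictScalars ℚ ℂ ((Fin d → ℂ) →L[ℂ] (Fin d → ℂ))
  have hΦ : Continuous Φ := Φ.continuous_of_finiteDimensional
  have hΦA : ∀ y w, Φ (A y) w = Matrix.mulVec (A y) w := fun y w ↦ rfl
  refine ⟨fun t y ↦ NormedSpace.exp (t • Φ (A y)) (U₀ y), ?_, fun y ↦ ?_, fun t y i ↦ ?_⟩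
  · have h1 : Continuous (fun p : ℝ × Y ↦ NormedSpace.exp (p.1 • Φ (A p.2))) :=
      NormedSpace.exp_continuous.comp
        (continuous_fst.smul (hΦ.comp (hA.comp continuous_snd)))
    exact h1.clm_apply (hU₀.comp continuous_snd)
  · have h0 : (0 : ℝ) • Φ (A y) = 0 := by
      ext w : 1
      exact zero_smul ℝ (Φ (A y) w)
    refine (congrArg (fun S : (Fin d → ℂ) →L[ℂ] (Fin d → ℂ) ↦ NormedSpace.exp S (U₀ y)) h0).trans ?_
    simp only [NormedSpace.exp_zero]
    rfl
  · have h1 := hasDerivAt_exp_smul_const' (𝕂 := ℝ) (Φ (A y)) t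
    have h2 := ((ContinuousLinearMap.apply ℂ (Fin d → ℂ) (U₀ y)).restrictScalars
      ℝ).hasFDerivAt.comp_hasDerivAt t h1
    rw [hasDerivAt_pi] at h2
    refine (h2 i).congr_deriv ?_
    simp [hΦA]

/-- Solutions of the Fourier-side equations, depending continuously on the frequency. -/
theorem exists_blackstockModes {Y : Type*} [TopologicalSpace Y] (a θ κ : ℝ) {X : Y → ℝ}
    (hX : Continuous X) {f₀ f₁ : Y → ℂ} (hf₀ : Continuous f₀) (hf₁ : Continuous f₁) :
    ∃ u u1 u2 v v1 I I1 : ℝ → Y → ℂ,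
      (∀ w ∈ [u, u1, u2, v, v1, I, I1], Continuous (fun p : ℝ × Y ↦ w p.1 p.2)) ∧
      (∀ y, BlackstockModes a θ κ (X y) (fun t ↦ u t y) (fun t ↦ u1 t y) (fun t ↦ u2 t y)
        (fun t ↦ v t y) (fun t ↦ v1 t y) (fun t ↦ I t y) (fun t ↦ I1 t y)) ∧
      v 0 = f₀ ∧ v1 0 = f₁ := by
  let x : Y → ℂ := fun y ↦ (X y : ℂ)
  have hx : Continuous x := Complex.continuous_ofReal.comp hX
  obtain ⟨U, hUc, hU0, hU⟩ := exists_linear_flow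
    (A := fun y ↦ !![0, 1, 0; 0, 0, 1; -(κ * x y ^ 2), -(x y + (1 + θ) * a * κ * x y ^ 2),
      -((a + (1 + θ) * κ) * x y)])
    (U₀ := fun y ↦ ![f₀ y, f₁ y, -(a * x y) * f₁ y - x y * f₀ y])
    (by
      refine continuous_matrix fun i j ↦ ?_
      fin_cases i <;> fin_cases j <;> simp <;> fun_prop)
    (by
      refine continuous_pi fun i ↦ ?_
      fin_cases i <;> simp <;> fun_prop)
  -- Since I is driven by v, the unknowns (v, v′, I, I′) form one block-triangular system.
  obtain ⟨V, hVc, hV0, hV⟩ := exists_linear_flow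
    (A := fun y ↦ !![0, 1, 0, 0; -x y, -(a * x y), 0, 0; 0, 0, 0, 1;
      -(θ * a * x y ^ 2), -(θ * x y), -x y, -(a * x y)])
    (U₀ := fun y ↦ ![f₀ y, f₁ y, -θ * (f₁ y + a * x y * f₀ y), 0])
    (by
      refine continuous_matrix fun i j ↦ ?_
      fin_cases i <;> fin_cases j <;> simp <;> fun_prop)
    (by
      refine continuous_pi fun i ↦ ?_
      fin_cases i <;> simp <;> fun_prop)
  refine ⟨fun t y ↦ U t y 0, fun t y ↦ U t y 1, fun t y ↦ U t y 2, fun t y ↦ V t y 0,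
    fun t y ↦ V t y 1, fun t y ↦ V t y 2, fun t y ↦ V t y 3, ?_, fun y ↦ ?_, ?_, ?_⟩
  · simp only [List.mem_cons, List.not_mem_nil, or_false]
    rintro w (rfl | rfl | rfl | rfl | rfl | rfl | rfl) <;> fun_prop
  · have hU0' := hU0 y
    have hV0' := hV0 y
    constructor
    case deriv_u =>
      exact fun t ↦ (hU t y 0).congr_deriv
        (by simp [Matrix.mulVec, dotProduct, Fin.sum_univ_succ])
    case deriv_u1 =>
      exact fun t ↦ (hU t y 1).congr_deriv
        (by simp [Matrix.mulVec, dotProduct, Fin.sum_univ_succ])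
    case deriv_u2 =>
      refine fun t ↦ (hU t y 2).congr_deriv ?_
      simp [Matrix.mulVec, dotProduct, Fin.sum_univ_succ, x]
      ring
    case deriv_v =>
      exact fun t ↦ (hV t y 0).congr_deriv
        (by simp [Matrix.mulVec, dotProduct, Fin.sum_univ_succ])
    case deriv_v1 =>
      refine fun t ↦ (hV t y 1).congr_deriv ?_
      simp [Matrix.mulVec, dotProduct, Fin.sum_univ_succ, x]
      ring
    case deriv_I =>
      exact fun t ↦ (hV t y 2).congr_deriv
        (by simp [Matrix.mulVec, dotProduct, Fin.sum_univ_succ])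
    case deriv_I1 =>
      refine fun t ↦ (hV t y 3).congr_deriv ?_
      simp [Matrix.mulVec, dotProduct, Fin.sum_univ_succ, x]
      ring
    all_goals simp [hU0', hV0', x]
    all_goals ring
  · funext y; simp [hV0 y]
  · funext y; simp [hV0 y]

end Flow

/-! ### Polynomial growth of the modes in frequency. -/

section Growth

variable {E : Type*} [NormedAddCommGroup E] [InnerProductSpace ℝ E]

/-- Polynomial growth of the solution of Blackstock's model, away from zero frequency. -/
theorem BlackstockModes.growth_u {a θ κ s M k : ℝ} (ha : 0 < a) (hθ : 0 < θ) (hκ : 0 < κ)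
    (hκa : κ < a) (hs : 1 ≤ s) {u u1 u2 v v1 I I1 : ℝ → E}
    (h : BlackstockModes a θ κ (s ^ 2) u u1 u2 v v1 I I1)
    (hv : ‖v 0‖ ≤ M) (hv1 : ‖v1 0‖ ≤ M) {β δ : ℝ} (hβ : 0 < β)
    (hβ2 : β ^ 2 = κ * (θ * (a - κ))) (hδ : δ = a + θ * κ) (hk : k = β + β + (a + δ + 2))
    {t : ℝ} (ht : 0 ≤ t) :
    ‖u1 t‖ ≤ k / β * ((1 + s ^ 2) ^ 2 * M) ∧ ‖u t‖ ≤ k / β * ((1 + s ^ 2) ^ 2 * M) ∧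
      ‖u2 t‖ ≤ (k + δ * (k / β) + k / β) * ((1 + s ^ 2) ^ 3 * M) := by
  have hδ0 : 0 < δ := by rw [hδ]; positivity
  have hk0 : 0 < k := by rw [hk]; positivity
  have hM0 : 0 ≤ M := (norm_nonneg _).trans hv
  have hs0 : 0 < s := by linarith
  have hx : 0 < s ^ 2 := by positivity
  obtain ⟨z, hz⟩ : ∃ z, z = 1 + s ^ 2 := ⟨_, rfl⟩
  rw [← hz]
  have hz1 : 1 ≤ z := by linarith
  have hsz : s ≤ z ^ 2 := by nlinarith
  have hs2z : s ^ 2 ≤ z := by linarith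
  have e1 : ‖-(a * s ^ 2) • v1 0 - s ^ 2 • v 0 + (δ * s ^ 2) • v1 0 + s ^ 2 • v 0‖ ≤
      (a + δ + 2) * s ^ 2 * M := by
    have : -(a * s ^ 2) • v1 0 - s ^ 2 • v 0 + (δ * s ^ 2) • v1 0 + s ^ 2 • v 0 =
      ((δ - a) * s ^ 2) • v1 0 := by module
    rw [this, norm_smul, norm_mul, Real.norm_of_nonneg hx.le]
    have : ‖δ - a‖ ≤ a + δ + 2 := by
      rw [Real.norm_eq_abs, abs_le]; constructor <;> linarith
    gcongr
  have e2 : β * s ^ 2 * ‖v1 0‖ + β * s ^ 3 * ‖v 0‖ + (a + δ + 2) * s ^ 2 * M ≤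
      k * z ^ 2 * M * s ^ 2 := by
    have f1 : s ^ 2 ≤ z ^ 2 * s ^ 2 := le_mul_of_one_le_left hx.le (one_le_pow₀ hz1)
    have f2 : s ^ 3 ≤ z ^ 2 * s ^ 2 := by
      calc s ^ 3 = s * s ^ 2 := by ring
        _ ≤ z ^ 2 * s ^ 2 := by gcongr
    calc _ ≤ β * (z ^ 2 * s ^ 2) * M + β * (z ^ 2 * s ^ 2) * M +
          (a + δ + 2) * (z ^ 2 * s ^ 2) * M := by gcongr
      _ = _ := by rw [hk]; ring
  -- The unforced coupled energy does not increase, so a constant serves as G. The bounds contain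
  -- 1/β and are not uniform in κ; only polynomial growth at fixed κ is needed for the modes to
  -- define distributions.
  obtain ⟨g1, g2, g3⟩ := coupled_energy_le (κ := κ) (δ := δ) (R := u) (R1 := u1)
    (Y := fun t ↦ u2 t + (δ * s ^ 2) • u1 t + s ^ 2 • u t)
    (H := fun _ ↦ 0) (Z := fun _ ↦ 0) (h := fun _ ↦ 0) (z := fun _ ↦ 0)
    (G := fun _ ↦ k * z ^ 2 * M * s ^ 2) (G' := fun _ ↦ 0) hβ hκ hδ0 hs0 h.deriv_u
    (fun t ↦ (h.deriv_u1 t).congr_deriv (by module))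
    (fun t ↦ ((((h.deriv_u2 t).add ((h.deriv_u1 t).const_smul (δ * s ^ 2))).add
      ((h.deriv_u t).const_smul (s ^ 2)))).congr_deriv (by
        rw [hβ2, hδ]; module))
    (by simp) (by simp) (fun t ↦ hasDerivAt_const t _) (fun t _ ↦ by positivity)
    (fun t _ ↦ by simp) (by
      rw [h.u_zero, h.u1_zero, h.u2_zero]
      exact (add_le_add_right e1 _).trans e2) ht
  have b1 : ‖u1 t‖ ≤ k / β * (z ^ 2 * M) := by
    have : (β * s ^ 2) * ‖u1 t‖ ≤ (β * s ^ 2) * (k / β * (z ^ 2 * M)) :=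
      g1.trans_eq (by field_simp)
    exact le_of_mul_le_mul_left this (by positivity)
  have b0 : ‖u t‖ ≤ k / β * (z ^ 2 * M) := by
    have h23 : s ^ 2 ≤ s ^ 3 := pow_le_pow_right₀ hs (by norm_num)
    have : (β * s ^ 2) * ‖u t‖ ≤ (β * s ^ 2) * (k / β * (z ^ 2 * M)) := by
      calc _ ≤ β * s ^ 3 * ‖u t‖ := by gcongr
        _ ≤ _ := g3
        _ = _ := by field_simp
    exact le_of_mul_le_mul_left this (by positivity)
  refine ⟨b1, b0, ?_⟩
  have e : u2 t = (u2 t + (δ * s ^ 2) • u1 t + s ^ 2 • u t) - (δ * s ^ 2) • u1 t -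
    s ^ 2 • u t := by module
  rw [e]
  have g2' := g2.trans (mul_le_mul_of_nonneg_left hs2z (by positivity : 0 ≤ k * z ^ 2 * M))
  have i1 : ‖(δ * s ^ 2) • u1 t‖ ≤ δ * z * (k / β * (z ^ 2 * M)) := by
    rw [norm_smul, Real.norm_of_nonneg (by positivity)]
    exact mul_le_mul (by gcongr) b1 (norm_nonneg _) (by positivity)
  have i2 : ‖s ^ 2 • u t‖ ≤ z * (k / β * (z ^ 2 * M)) := by
    rw [norm_smul, Real.norm_of_nonneg hx.le]
    exact mul_le_mul hs2z b0 (norm_nonneg _) (by positivity)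
  calc _ ≤ k * z ^ 2 * M * z + δ * z * (k / β * (z ^ 2 * M)) + z * (k / β * (z ^ 2 * M)) :=
        (norm_sub_le _ _).trans (add_le_add ((norm_sub_le _ _).trans (add_le_add g2' i1)) i2)
    _ = _ := by ring

/-- Polynomial growth of the profiles, away from zero frequency. -/
theorem BlackstockModes.growth_profiles {a θ κ s M T : ℝ} (ha : 0 < a) (hθ : 0 < θ)
    (hθ1 : θ ≤ 1) (hs : 1 ≤ s) {u u1 u2 v v1 I I1 : ℝ → E}
    (h : BlackstockModes a θ κ (s ^ 2) u u1 u2 v v1 I I1)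
    (hM : M = (1 + s ^ 2) * ‖v 0‖ + ‖v1 0‖) {t : ℝ} (ht : t ∈ Set.Icc 0 T) :
    √(oscillatorEnergy a (s ^ 2) (v t) (v1 t)) ≤ (3 + a) * ((1 + s ^ 2) * M) ∧
    √(oscillatorEnergy a (s ^ 2) (I t) (I1 t)) ≤
      ((a + 2) * (1 + a) + 2 * θ * (3 + a) * T) * ((1 + s ^ 2) * M) := by
  have hs0 : 0 < s := by linarith
  obtain ⟨-, hN, hN'⟩ := h.initial_bounds ha hθ hθ1 hs0 hM
  have hM0 : 0 ≤ M := by rw [hM]; positivity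
  have hx : 0 < s ^ 2 := by positivity
  obtain ⟨z, hz⟩ : ∃ z, z = 1 + s ^ 2 := ⟨_, rfl⟩
  rw [← hz]
  have hz1 : 1 ≤ z := by linarith
  have hsz : s ≤ z := by nlinarith
  have hs2z : s ^ 2 ≤ z := by linarith
  have hm := oscillatorRate_pos ha hx
  have hexp : Real.exp (-oscillatorRate a (s ^ 2) * t) ≤ 1 :=
    Real.exp_le_one_iff.2 (by nlinarith [mul_nonneg hm.le ht.1])
  have ht0 := ht.1
  have htT := ht.2
  have hT : 0 ≤ T := ht0.trans htT
  constructor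
  · refine (sqrt_oscillatorEnergy_le_exp ha hx h.deriv_v h.deriv_v1 ht0).trans ?_
    calc _ ≤ (3 + a) * M * 1 := mul_le_mul hN hexp (Real.exp_pos _).le (by positivity)
      _ ≤ (3 + a) * M * z := mul_le_mul_of_nonneg_left hz1 (by positivity)
      _ = _ := by ring
  · refine (sqrt_oscillatorEnergy_le_forced ha hx hθ.le h.deriv_v h.deriv_v1 h.deriv_I
      h.deriv_I1 ht0).trans ?_
    have i1 : √(oscillatorEnergy a (s ^ 2) (I 0) (I1 0)) ≤ (a * z + 2 * z) * ((1 + a) * M) :=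
      hN'.trans (mul_le_mul_of_nonneg_right (by gcongr) (by positivity))
    have i2 : 2 * θ * s ^ 2 * √(oscillatorEnergy a (s ^ 2) (v 0) (v1 0)) * t ≤
        2 * θ * z * ((3 + a) * M) * T := by gcongr
    calc _ ≤ ((a * z + 2 * z) * ((1 + a) * M) + 2 * θ * z * ((3 + a) * M) * T) * 1 :=
          mul_le_mul (add_le_add i1 i2) hexp (Real.exp_pos _).le (by positivity)
      _ = _ := by ring

/-- Polynomial growth in the frequency of the Fourier-side solutions, away from zero frequency. -/
theorem exists_blackstockModes_growth {a θ κ : ℝ} (ha : 0 < a) (hθ : 0 < θ) (hθ1 : θ ≤ 1)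
    (hκ : 0 < κ) (hκa : κ < a) {T : ℝ} (hT : 0 ≤ T) :
    ∃ K : ℝ, 0 ≤ K ∧ ∀ s : ℝ, 1 ≤ s → ∀ u u1 u2 v v1 I I1 : ℝ → E,
      BlackstockModes a θ κ (s ^ 2) u u1 u2 v v1 I I1 → ∀ t ∈ Set.Icc 0 T,
      ∀ w ∈ [u, u1, u2, v, v1, I, I1],
        ‖w t‖ ≤ K * ((1 + s ^ 2) ^ 3 * ((1 + s ^ 2) * ‖v 0‖ + ‖v1 0‖)) := by
  have hB : 0 < θ * (a - κ) := mul_pos hθ (by linarith)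
  obtain ⟨β, hβ, hβ2⟩ : ∃ β, 0 < β ∧ β ^ 2 = κ * (θ * (a - κ)) :=
    ⟨√(κ * (θ * (a - κ))), Real.sqrt_pos.2 (by positivity), Real.sq_sqrt (by positivity)⟩
  obtain ⟨δ, hδ⟩ : ∃ δ, δ = a + θ * κ := ⟨_, rfl⟩
  have hδ0 : 0 < δ := by rw [hδ]; positivity
  obtain ⟨k, hk⟩ : ∃ k, k = β + β + (a + δ + 2) := ⟨_, rfl⟩
  have hk0 : 0 < k := by rw [hk]; positivity
  obtain ⟨K, hK⟩ : ∃ K, K = (3 + a) + ((a + 2) * (1 + a) + 2 * θ * (3 + a) * T) +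
    (k + δ * (k / β) + k / β) := ⟨_, rfl⟩
  have p1 : 0 ≤ k / β := by positivity
  have p2 : 0 ≤ δ * (k / β) := by positivity
  have p3 : 0 ≤ (a + 2) * (1 + a) + 2 * θ * (3 + a) * T := by positivity
  have c1 : k / β ≤ K := by rw [hK]; linarith
  have c2 : k + δ * (k / β) + k / β ≤ K := by rw [hK]; linarith
  have c3 : 3 + a ≤ K := by rw [hK]; linarith
  have c4 : (a + 2) * (1 + a) + 2 * θ * (3 + a) * T ≤ K := by rw [hK]; linarith
  have hK0 : 0 ≤ K := p1.trans c1
  refine ⟨K, hK0, ?_⟩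
  intro s hs u u1 u2 v v1 I I1 h t ht
  have hs0 : 0 < s := by linarith
  have hx : 0 < s ^ 2 := by positivity
  obtain ⟨M, hM⟩ : ∃ M, M = (1 + s ^ 2) * ‖v 0‖ + ‖v1 0‖ := ⟨_, rfl⟩
  have n0 := norm_nonneg (v 0)
  have n1 := norm_nonneg (v1 0)
  have hM0 : 0 ≤ M := by rw [hM]; positivity
  have hv0M : ‖v 0‖ ≤ M := by
    rw [hM]; nlinarith [mul_nonneg hx.le n0]
  have hv1M : ‖v1 0‖ ≤ M := by
    rw [hM]; nlinarith [mul_nonneg hx.le n0]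
  obtain ⟨b1, b0, b2⟩ := h.growth_u ha hθ hκ hκa hs hv0M hv1M hβ hβ2 hδ hk ht.1
  obtain ⟨ev, eI⟩ := h.growth_profiles ha hθ hθ1 hs hM ht
  rw [← hM]
  have small : ∀ w w' : E, ‖w‖ ≤ √(oscillatorEnergy a (s ^ 2) w w') := fun w w' ↦ by
    have := (norm_le_sqrt_energy hx w w' (a := a)).2.2
    rw [Real.sqrt_sq hs0.le] at this
    nlinarith [norm_nonneg w]
  have hz1 : 1 ≤ 1 + s ^ 2 := by linarith
  have hfin : ∀ {c r : ℝ} (j : ℕ), j ≤ 3 → c ≤ K → r ≤ c * ((1 + s ^ 2) ^ j * M) →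
      r ≤ K * ((1 + s ^ 2) ^ 3 * M) := fun {c r} j hj hc hr ↦
    hr.trans (mul_le_mul hc (mul_le_mul_of_nonneg_right (pow_le_pow_right₀ hz1 hj) hM0)
      (by positivity) hK0)
  rw [← pow_one (1 + s ^ 2)] at ev eI
  simp only [List.mem_cons, List.not_mem_nil, or_false]
  rintro w (rfl | rfl | rfl | rfl | rfl | rfl | rfl)
  · exact hfin 2 (by norm_num) c1 b0
  · exact hfin 2 (by norm_num) c1 b1
  · exact hfin 3 le_rfl c2 b2
  · exact hfin 1 (by norm_num) c3 ((small _ _).trans ev)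
  · exact hfin 1 (by norm_num) c3 ((norm_le_sqrt_energy hx _ _).1.trans ev)
  · exact hfin 1 (by norm_num) c4 ((small _ _).trans eI)
  · exact hfin 1 (by norm_num) c4 ((norm_le_sqrt_energy hx _ _).1.trans eI)

end Growth

/-! ### Functions of polynomial growth as tempered distributions. -/

section OfFun

open Filter Topology TemperedDistribution
open scoped FourierTransform

variable {E : Type*} [NormedAddCommGroup E] [InnerProductSpace ℝ E] [FiniteDimensional ℝ E]
  [MeasurableSpace E] [BorelSpace E]

/-- Continuous functions with polynomial growth. -/
def PolynomiallyBounded (f : E → ℂ) : Prop :=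
  Continuous f ∧ ∃ (C : ℝ) (k : ℕ), ∀ ξ, ‖f ξ‖ ≤ C * (1 + ‖ξ‖ ^ 2) ^ k

omit [FiniteDimensional ℝ E] [MeasurableSpace E] [BorelSpace E] in
theorem hasTemperateGrowth_one_add_norm_sq_pow (k : ℕ) :
    (fun ξ : E ↦ (((1 + ‖ξ‖ ^ 2) ^ k : ℝ) : ℂ)).HasTemperateGrowth := by
  fun_prop

theorem SchwartzMap.integrable_one_add_norm_sq_pow_mul (φ : 𝓢(E, ℂ)) (C : ℝ) (k : ℕ) :
    Integrable (fun ξ ↦ ‖φ ξ‖ * (C * (1 + ‖ξ‖ ^ 2) ^ k)) := by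
  have h := (SchwartzMap.smulLeftCLM ℂ (fun ξ : E ↦ (((1 + ‖ξ‖ ^ 2) ^ k : ℝ) : ℂ)) φ).integrable
    (μ := volume)
  refine (h.norm.const_mul C).congr (Eventually.of_forall fun ξ ↦ ?_)
  simp only [SchwartzMap.smulLeftCLM_apply_apply (hasTemperateGrowth_one_add_norm_sq_pow k)]
  rw [norm_smul, Complex.norm_real, Real.norm_of_nonneg (by positivity)]
  ring

theorem PolynomiallyBounded.integrable {f : E → ℂ} (hf : PolynomiallyBounded f) (φ : 𝓢(E, ℂ)) :
    Integrable (fun ξ ↦ φ ξ * f ξ) := by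
  obtain ⟨hc, C, k, hC⟩ := hf
  refine (φ.integrable_one_add_norm_sq_pow_mul C k).mono'
    (φ.continuous.mul hc).aestronglyMeasurable (Eventually.of_forall fun ξ ↦ ?_)
  rw [norm_mul]
  gcongr
  exact hC ξ

/-- Dividing by a power of 1 + ‖ξ‖² gives an L^∞ function, hence a tempered distribution;
multiplication by that power, which has temperate growth, restores f. -/
theorem PolynomiallyBounded.exists_distribution {f : E → ℂ} (hf : PolynomiallyBounded f) :
    ∃ T : 𝓢'(E, ℂ), ∀ φ, T φ = ∫ ξ, φ ξ * f ξ := by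
  obtain ⟨hc, C, k, hC⟩ := hf
  have hw : ∀ ξ : E, 0 < (1 + ‖ξ‖ ^ 2) ^ k := fun ξ ↦ by positivity
  have hw' : ∀ ξ : E, (((1 + ‖ξ‖ ^ 2) ^ k : ℝ) : ℂ) ≠ 0 := fun ξ ↦
    Complex.ofReal_ne_zero.2 (hw ξ).ne'
  have hm : MemLp (fun ξ ↦ f ξ / (((1 + ‖ξ‖ ^ 2) ^ k : ℝ) : ℂ)) ∞ (volume : Measure E) := by
    refine memLp_top_of_bound ?_ C (Eventually.of_forall fun ξ ↦ ?_)
    · exact (hc.div (hasTemperateGrowth_one_add_norm_sq_pow k).1.continuous hw').aestronglyMeasurable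
    · rw [norm_div, Complex.norm_real, Real.norm_of_nonneg (hw ξ).le, div_le_iff₀ (hw ξ)]
      exact hC ξ
  refine ⟨smulLeftCLM ℂ (fun ξ : E ↦ (((1 + ‖ξ‖ ^ 2) ^ k : ℝ) : ℂ))
    (Lp.toTemperedDistribution (hm.toLp _)), fun φ ↦ ?_⟩
  rw [smulLeftCLM_apply_apply, Lp.toTemperedDistribution_apply]
  refine integral_congr_ae ?_
  filter_upwards [hm.coeFn_toLp] with ξ hξ
  rw [hξ, SchwartzMap.smulLeftCLM_apply_apply (hasTemperateGrowth_one_add_norm_sq_pow k)]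
  simp only [smul_eq_mul]
  rw [mul_assoc, mul_left_comm, mul_div_cancel₀ _ (hw' ξ)]

open Classical in
/-- The tempered distribution defined by a function. -/
noncomputable def distributionOf (f : E → ℂ) : 𝓢'(E, ℂ) :=
  -- The default 0 is never met for functions of polynomial growth.
  if h : ∃ T : 𝓢'(E, ℂ), ∀ φ, T φ = ∫ ξ, φ ξ * f ξ then h.choose else 0

theorem PolynomiallyBounded.distributionOf_apply {f : E → ℂ} (hf : PolynomiallyBounded f)
    (φ : 𝓢(E, ℂ)) : distributionOf f φ = ∫ ξ, φ ξ * f ξ := by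
  rw [distributionOf, dif_pos hf.exists_distribution]
  exact hf.exists_distribution.choose_spec φ

omit [InnerProductSpace ℝ E] [FiniteDimensional ℝ E] [MeasurableSpace E] [BorelSpace E] in
theorem PolynomiallyBounded.add {f g : E → ℂ} (hf : PolynomiallyBounded f)
    (hg : PolynomiallyBounded g) : PolynomiallyBounded (fun ξ ↦ f ξ + g ξ) := by
  obtain ⟨hc, C, k, hC⟩ := hf
  obtain ⟨hd, D, l, hD⟩ := hg
  refine ⟨hc.add hd, |C| + |D|, k + l, fun ξ ↦ (norm_add_le _ _).trans ?_⟩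
  have h1 : 1 ≤ 1 + ‖ξ‖ ^ 2 := by nlinarith [sq_nonneg ‖ξ‖]
  rw [add_mul]
  refine add_le_add ((hC ξ).trans ?_) ((hD ξ).trans ?_)
  · exact mul_le_mul (le_abs_self C) (pow_le_pow_right₀ h1 (by omega)) (by positivity)
      (abs_nonneg _)
  · exact mul_le_mul (le_abs_self D) (pow_le_pow_right₀ h1 (by omega)) (by positivity)
      (abs_nonneg _)

omit [InnerProductSpace ℝ E] [FiniteDimensional ℝ E] [MeasurableSpace E] [BorelSpace E] in
theorem PolynomiallyBounded.mul {f g : E → ℂ} (hf : PolynomiallyBounded f)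
    (hg : PolynomiallyBounded g) : PolynomiallyBounded (fun ξ ↦ f ξ * g ξ) := by
  obtain ⟨hc, C, k, hC⟩ := hf
  obtain ⟨hd, D, l, hD⟩ := hg
  refine ⟨hc.mul hd, C * D, k + l, fun ξ ↦ ?_⟩
  rw [norm_mul]
  calc _ ≤ C * (1 + ‖ξ‖ ^ 2) ^ k * (D * (1 + ‖ξ‖ ^ 2) ^ l) :=
        mul_le_mul (hC ξ) (hD ξ) (norm_nonneg _) ((norm_nonneg _).trans (hC ξ))
    _ = _ := by ring

omit [InnerProductSpace ℝ E] [FiniteDimensional ℝ E] [MeasurableSpace E] [BorelSpace E] in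
theorem polynomiallyBounded_of_norm_le {f : E → ℂ} (hc : Continuous f) {C : ℝ}
    (hC : ∀ ξ, ‖f ξ‖ ≤ C) : PolynomiallyBounded f :=
  ⟨hc, C, 0, fun ξ ↦ by simpa using hC ξ⟩

theorem distributionOf_add {f g : E → ℂ} (hf : PolynomiallyBounded f)
    (hg : PolynomiallyBounded g) :
    distributionOf (fun ξ ↦ f ξ + g ξ) = distributionOf f + distributionOf g := by
  ext φ
  rw [(hf.add hg).distributionOf_apply]
  simp only [mul_add]
  rw [integral_add (hf.integrable φ) (hg.integrable φ), ← hf.distributionOf_apply,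
    ← hg.distributionOf_apply]
  rfl

theorem distributionOf_const_mul (c : ℂ) {f : E → ℂ} (hf : PolynomiallyBounded f) :
    distributionOf (fun ξ ↦ c * f ξ) = c • distributionOf f := by
  ext φ
  rw [((polynomiallyBounded_of_norm_le continuous_const fun _ ↦ le_rfl).mul
    hf).distributionOf_apply]
  simp only [mul_left_comm _ c]
  rw [integral_const_mul, ← hf.distributionOf_apply]
  rfl

theorem distributionOf_mul {X f : E → ℂ} (hX : X.HasTemperateGrowth)
    (hX' : PolynomiallyBounded X) (hf : PolynomiallyBounded f) :
    distributionOf (fun ξ ↦ X ξ * f ξ) = smulLeftCLM ℂ X (distributionOf f) := by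
  ext φ
  rw [(hX'.mul hf).distributionOf_apply, smulLeftCLM_apply_apply, hf.distributionOf_apply]
  refine integral_congr_ae (Eventually.of_forall fun ξ ↦ ?_)
  simp only [SchwartzMap.smulLeftCLM_apply_apply hX, smul_eq_mul]
  ring

/-- The symbol of `-Δ`. -/
noncomputable def laplaceSymbol (ξ : E) : ℝ := ‖(2 * Real.pi) • ξ‖ ^ 2

omit [FiniteDimensional ℝ E] [MeasurableSpace E] [BorelSpace E] in
theorem laplaceSymbol_eq (ξ : E) : laplaceSymbol ξ = (2 * Real.pi) ^ 2 * ‖ξ‖ ^ 2 := by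
  rw [laplaceSymbol, norm_smul, mul_pow, Real.norm_of_nonneg (by positivity)]

omit [FiniteDimensional ℝ E] [MeasurableSpace E] [BorelSpace E] in
theorem continuous_laplaceSymbol : Continuous (laplaceSymbol : E → ℝ) := by
  unfold laplaceSymbol
  fun_prop

omit [FiniteDimensional ℝ E] [MeasurableSpace E] [BorelSpace E] in
theorem hasTemperateGrowth_laplaceSymbol :
    (fun ξ : E ↦ ((laplaceSymbol ξ : ℝ) : ℂ)).HasTemperateGrowth := by
  simp only [laplaceSymbol_eq]
  fun_prop

omit [FiniteDimensional ℝ E] [MeasurableSpace E] [BorelSpace E] in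
theorem polynomiallyBounded_laplaceSymbol :
    PolynomiallyBounded (fun ξ : E ↦ ((laplaceSymbol ξ : ℝ) : ℂ)) := by
  refine ⟨Complex.continuous_ofReal.comp continuous_laplaceSymbol, (2 * Real.pi) ^ 2, 1,
    fun ξ ↦ ?_⟩
  rw [Complex.norm_real, laplaceSymbol_eq, Real.norm_of_nonneg (by positivity), pow_one]
  gcongr
  linarith

theorem laplacian_eq_fourierInv_smulLeftCLM (T : 𝓢'(E, ℂ)) :
    Δ T = -𝓕⁻ (smulLeftCLM ℂ (fun ξ : E ↦ ((laplaceSymbol ξ : ℝ) : ℂ)) (𝓕 T)) := by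
  rw [laplacian_eq_fourierMultiplierCLM, fourierMultiplierCLM_apply]
  have h : (fun ξ : E ↦ ((laplaceSymbol ξ : ℝ) : ℂ)) =
      (((2 * Real.pi) ^ 2 : ℝ) : ℂ) • (fun ξ : E ↦ Complex.ofReal (‖ξ‖ ^ 2)) := by
    funext ξ
    rw [laplaceSymbol_eq]
    simp
  rw [h, smulLeftCLM_smul (by fun_prop)]
  ext φ
  simp

theorem fourier_laplacian (T : 𝓢'(E, ℂ)) :
    𝓕 (Δ T) = -smulLeftCLM ℂ (fun ξ : E ↦ ((laplaceSymbol ξ : ℝ) : ℂ)) (𝓕 T) := by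
  rw [laplacian_eq_fourierInv_smulLeftCLM, FourierTransform.fourier_neg,
    FourierTransform.fourier_fourierInv_eq]

theorem laplacian_fourierInv_distributionOf {f : E → ℂ} (hf : PolynomiallyBounded f) :
    Δ (𝓕⁻ (distributionOf f)) =
      𝓕⁻ (distributionOf (fun ξ ↦ -((laplaceSymbol ξ : ℝ) : ℂ) * f ξ)) := by
  have h : (fun ξ ↦ -((laplaceSymbol ξ : ℝ) : ℂ) * f ξ) =
      fun ξ ↦ (-1 : ℂ) * (((laplaceSymbol ξ : ℝ) : ℂ) * f ξ) := by
    funext ξ; ring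
  rw [h, distributionOf_const_mul _ (polynomiallyBounded_laplaceSymbol.mul hf),
    distributionOf_mul hasTemperateGrowth_laplaceSymbol polynomiallyBounded_laplaceSymbol hf,
    laplacian_eq_fourierInv_smulLeftCLM, FourierTransform.fourier_fourierInv_eq,
    FourierTransform.fourierInv_smul]
  exact (neg_one_smul ℂ _).symm

/-- Continuous curves of functions whose growth is polynomial, locally uniformly in time. -/
def PolynomiallyBoundedCurve (w : ℝ → E → ℂ) : Prop :=
  (∀ t, Continuous (w t)) ∧
    ∀ T : ℝ, ∃ (C : ℝ) (k : ℕ), ∀ t ∈ Set.Icc 0 T, ∀ ξ, ‖w t ξ‖ ≤ C * (1 + ‖ξ‖ ^ 2) ^ k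

omit [InnerProductSpace ℝ E] [FiniteDimensional ℝ E] [MeasurableSpace E] [BorelSpace E] in
theorem PolynomiallyBoundedCurve.apply {w : ℝ → E → ℂ} (hw : PolynomiallyBoundedCurve w) {t : ℝ}
    (ht : 0 ≤ t) : PolynomiallyBounded (w t) := by
  obtain ⟨C, k, h⟩ := hw.2 t
  exact ⟨hw.1 t, C, k, h t ⟨ht, le_rfl⟩⟩

/-- Dominated convergence for the difference quotients: by the mean value inequality they are
bounded by the growth of `w'` on [0, t + 1], an interval that leaves room to the right of t. -/
theorem PolynomiallyBoundedCurve.hasDerivWithinAt_distributionOf {w w' : ℝ → E → ℂ}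
    (hw : PolynomiallyBoundedCurve w) (hw' : PolynomiallyBoundedCurve w')
    (hd : ∀ t ξ, HasDerivAt (fun τ ↦ w τ ξ) (w' t ξ) t) (φ : 𝓢(E, ℂ)) {t : ℝ} (ht : 0 ≤ t) :
    HasDerivWithinAt (fun τ ↦ distributionOf (w τ) φ) (distributionOf (w' t) φ) (Set.Ici 0) t := by
  rw [hasDerivWithinAt_iff_tendsto_slope]
  obtain ⟨C, k, hC⟩ := hw'.2 (t + 1)
  have hev : ∀ᶠ τ in 𝓝[Set.Ici 0 \ {t}] t, τ ∈ Set.Icc 0 (t + 1) := by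
    have h1 : ∀ᶠ τ in 𝓝[Set.Ici 0 \ {t}] t, τ ≤ t + 1 :=
      nhdsWithin_le_nhds (Iic_mem_nhds (by linarith))
    filter_upwards [h1, self_mem_nhdsWithin] with τ h1 h2
    exact ⟨h2.1, h1⟩
  have hF : ∀ τ ∈ Set.Icc 0 (t + 1), slope (fun τ ↦ distributionOf (w τ) φ) t τ =
      ∫ ξ, φ ξ * slope (fun τ ↦ w τ ξ) t τ := by
    intro τ hτ
    simp only [slope_def_module]
    rw [(hw.apply hτ.1).distributionOf_apply, (hw.apply ht).distributionOf_apply,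
      ← integral_sub ((hw.apply hτ.1).integrable φ) ((hw.apply ht).integrable φ),
      ← integral_smul]
    refine integral_congr_ae (Eventually.of_forall fun ξ ↦ ?_)
    simp only [Complex.real_smul]
    ring
  refine Tendsto.congr' (hev.mono fun τ hτ ↦ (hF τ hτ).symm) ?_
  rw [(hw'.apply ht).distributionOf_apply]
  refine tendsto_integral_filter_of_dominated_convergence
    (fun ξ ↦ ‖φ ξ‖ * (C * (1 + ‖ξ‖ ^ 2) ^ k)) ?_ ?_
    (φ.integrable_one_add_norm_sq_pow_mul C k) (Eventually.of_forall fun ξ ↦ ?_)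
  · refine Eventually.of_forall fun τ ↦ Continuous.aestronglyMeasurable ?_
    simp only [slope_def_module]
    have h1 := hw.1 τ
    have h2 := hw.1 t
    have h3 := φ.continuous
    fun_prop
  · filter_upwards [hev] with τ hτ
    refine Eventually.of_forall fun ξ ↦ ?_
    rw [norm_mul]
    refine mul_le_mul_of_nonneg_left ?_ (norm_nonneg _)
    have h := (convex_Icc 0 (t + 1)).norm_image_sub_le_of_norm_hasDerivWithin_le
      (f := fun τ ↦ w τ ξ) (fun s _ ↦ (hd s ξ).hasDerivWithinAt) (fun s hs ↦ hC s hs ξ)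
      (⟨ht, by linarith⟩ : t ∈ Set.Icc 0 (t + 1)) hτ
    have h0 : 0 ≤ C * (1 + ‖ξ‖ ^ 2) ^ k := (norm_nonneg _).trans (hC τ hτ ξ)
    rw [slope_def_module, norm_smul, norm_inv]
    rcases eq_or_ne τ t with rfl | hne
    · simpa using h0
    · rw [inv_mul_le_iff₀ (norm_pos_iff.2 (sub_ne_zero.2 hne)), mul_comm]
      exact h
  · have h := (hasDerivAt_iff_tendsto_slope.1 (hd t ξ)).mono_left
      (nhdsWithin_mono t (s := Set.Ici 0 \ {t}) (t := {t}ᶜ) fun τ hτ ↦ hτ.2)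
    exact h.const_mul (φ ξ)

end OfFun

/-! ### Time derivatives and uniqueness on the physical side. -/

section Euclidean

open scoped FourierTransform

variable {n : ℕ}

theorem isTimeDeriv_fourierInv_distributionOf {w w' : ℝ → Rn n → ℂ}
    (hw : PolynomiallyBoundedCurve w) (hw' : PolynomiallyBoundedCurve w')
    (hd : ∀ t ξ, HasDerivAt (fun τ ↦ w τ ξ) (w' t ξ) t) :
    IsTimeDeriv (fun t ↦ 𝓕⁻ (distributionOf (w t))) (fun t ↦ 𝓕⁻ (distributionOf (w' t))) :=
  fun φ _ ht ↦ hw.hasDerivWithinAt_distributionOf hw' hd (𝓕⁻ φ) ht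

/-- Uniqueness for systems of constant coefficient equations in powers of the Laplacian. -/
theorem laplacian_system_eq_zero {ι : Type*} [Fintype ι] {d : ℕ} (c : ι → ι → Fin d → ℂ)
    {u u' : ι → ℝ → 𝓢'(Rn n, ℂ)} (hu : ∀ i, IsTimeDeriv (u i) (u' i))
    (hu' : ∀ i t, 0 ≤ t → u' i t = ∑ j, ∑ l : Fin d, c i j l • (Δ)^[(l : ℕ)] (u j t))
    (h0 : ∀ i, u i 0 = 0) {T : ℝ} (hT : 0 ≤ T) (i : ι) : u i T = 0 := by
  let X : Rn n → ℂ := fun ξ ↦ ((laplaceSymbol ξ : ℝ) : ℂ)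
  -- Each Laplacian becomes multiplication by -X, moved onto the test function; the signs are
  -- absorbed into the coefficients of the transformed system.
  have hit : ∀ (l : ℕ) (S : 𝓢'(Rn n, ℂ)) (φ : 𝓢(Rn n, ℂ)),
      𝓕 ((Δ)^[l] S) φ = (-1) ^ l * 𝓕 S ((SchwartzMap.smulLeftCLM ℂ X)^[l] φ) := by
    intro l
    induction l with
    | zero => intro S φ; simp
    | succ l ih =>
      intro S φ
      rw [Function.iterate_succ_apply, ih, fourier_laplacian, Function.iterate_succ_apply',
        pow_succ]
      simp [X]
  have h := SchwartzMap.system_eq_zero (X := X) hasTemperateGrowth_laplaceSymbol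
    (c := fun i j l ↦ c i j l * (-1) ^ (l : ℕ)) (u := fun i t ↦ 𝓕 (u i t)) (fun i φ t ht ↦ ?_)
    (fun i ↦ by simp [h0 i]) hT i
  · have h2 := congrArg (fun S ↦ 𝓕⁻ S) h
    simpa using h2
  · have h1 := hu i (𝓕 φ) t ht
    refine h1.congr_deriv ?_
    show 𝓕 (u' i t) φ = _
    rw [hu' i t ht]
    have : ∀ (f : ι → Fin d → 𝓢'(Rn n, ℂ)),
        𝓕 (∑ j, ∑ l, c i j l • f j l) φ = ∑ j, ∑ l, c i j l * 𝓕 (f j l) φ := by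
      intro f
      simp [TemperedDistribution.fourier_apply]
    rw [this]
    refine Finset.sum_congr rfl fun j _ ↦ Finset.sum_congr rfl fun l _ ↦ ?_
    rw [hit]
    ring

end Euclidean

/-! ### Uniqueness for the four Cauchy problems. -/

section Uniqueness

open TemperedDistribution LineDeriv

variable {n : ℕ}

theorem IsTimeDeriv.sub {u u' w w' : ℝ → 𝓢'(Rn n, ℂ)} (hu : IsTimeDeriv u u')
    (hw : IsTimeDeriv w w') : IsTimeDeriv (fun t ↦ u t - w t) (fun t ↦ u' t - w' t) :=
  fun φ t ht ↦ (hu φ t ht).sub (hw φ t ht)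

/-- The difference of two solutions has zero data and solves a homogeneous first-order system. The
entry `c i j l` is the coefficient of Δˡ of the j-th unknown in the derivative of the i-th; the
higher-order equations are treated alike. -/
theorem IsHeatSolution.eq {u₀ : 𝓢'(Rn n, ℂ)} {u w : ℝ → 𝓢'(Rn n, ℂ)}
    (hu : IsHeatSolution u₀ u) (hw : IsHeatSolution u₀ w) {t : ℝ} (ht : 0 ≤ t) : u t = w t := by
  obtain ⟨u', hu1, hu2, hu3⟩ := hu
  obtain ⟨w', hw1, hw2, hw3⟩ := hw
  have h := laplacian_system_eq_zero (n := n) (ι := Fin 1) (c := ![![![0, 1]]])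
    (u := ![fun t ↦ u t - w t]) (u' := ![fun t ↦ u' t - w' t])
    (fun i ↦ by fin_cases i; exact hu1.sub hw1)
    (fun i t ht ↦ by
      have h1 := hu2 t ht
      have h2 := hw2 t ht
      fin_cases i
      simp only [← laplacianCLM_apply] at h1 h2
      simp [Fin.sum_univ_succ, ← laplacianCLM_apply, map_sub]
      linear_combination (norm := module) h1 - h2)
    (fun i ↦ by fin_cases i; simp [hu3, hw3]) ht 0
  exact sub_eq_zero.1 h

/-- The sources are only asked to agree for t ≥ 0, and the time derivative is included in the
conclusion. Both are needed for `ψI`, whose source is built from `ψZ` and `ψZt`. -/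
theorem IsDampedWaveSolution.eq {b ν : ℝ} {f g : ℝ → 𝓢'(Rn n, ℂ)} (hfg : ∀ t, 0 ≤ t → f t = g t)
    {u₀ u₁ : 𝓢'(Rn n, ℂ)} {u ut w wt : ℝ → 𝓢'(Rn n, ℂ)}
    (hu : IsDampedWaveSolution b ν f u₀ u₁ u ut) (hw : IsDampedWaveSolution b ν g u₀ u₁ w wt)
    {t : ℝ} (ht : 0 ≤ t) : u t = w t ∧ ut t = wt t := by
  obtain ⟨u', hu1, hu2, hu3, hu4, hu5⟩ := hu
  obtain ⟨w', hw1, hw2, hw3, hw4, hw5⟩ := hw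
  have h := laplacian_system_eq_zero (n := n) (ι := Fin 2)
    (c := ![![![0, 0], ![1, 0]], ![![0, 1], ![0, ((b * ν : ℝ) : ℂ)]]])
    (u := ![fun t ↦ u t - w t, fun t ↦ ut t - wt t])
    (u' := ![fun t ↦ ut t - wt t, fun t ↦ u' t - w' t])
    (fun i ↦ by
      fin_cases i
      · exact hu1.sub hw1
      · exact hu2.sub hw2)
    (fun i t ht ↦ by
      have h1 := hu3 t ht
      have h2 := hw3 t ht
      have h3 := hfg t ht
      simp only [← laplacianCLM_apply] at h1 h2
      fin_cases i
      · simp [Fin.sum_univ_succ]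
        module
      · simp [Fin.sum_univ_succ, ← laplacianCLM_apply, map_sub]
        push_cast at h1 h2
        linear_combination (norm := module) h1 - h2 + h3)
    (fun i ↦ by fin_cases i <;> simp [hu4, hw4, hu5, hw5]) ht
  exact ⟨sub_eq_zero.1 (h 0), sub_eq_zero.1 (h 1)⟩

theorem IsBlackstockSolution.eq {b ν γ κ : ℝ} {u₀ u₁ u₂ : 𝓢'(Rn n, ℂ)} {u w : ℝ → 𝓢'(Rn n, ℂ)}
    (hu : IsBlackstockSolution b ν γ κ u₀ u₁ u₂ u) (hw : IsBlackstockSolution b ν γ κ u₀ u₁ u₂ w)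
    {t : ℝ} (ht : 0 ≤ t) : u t = w t := by
  obtain ⟨ut, utt, u', hu1, hu2, hu3, hu4, hu5, hu6, hu7⟩ := hu
  obtain ⟨wt, wtt, w', hw1, hw2, hw3, hw4, hw5, hw6, hw7⟩ := hw
  have h := laplacian_system_eq_zero (n := n) (ι := Fin 3)
    (c := ![![![0, 0, 0], ![1, 0, 0], ![0, 0, 0]], ![![0, 0, 0], ![0, 0, 0], ![1, 0, 0]],
      ![![0, 0, -κ], ![0, 1, -(κ * (b * ν + (γ - 1) * κ) + κ * (γ - 1) * (b * ν - κ))],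
        ![0, b * ν + (γ - 1) * κ + κ, 0]]])
    (u := ![fun t ↦ u t - w t, fun t ↦ ut t - wt t, fun t ↦ utt t - wtt t])
    (u' := ![fun t ↦ ut t - wt t, fun t ↦ utt t - wtt t, fun t ↦ u' t - w' t])
    (fun i ↦ by
      fin_cases i
      · exact hu1.sub hw1
      · exact hu2.sub hw2
      · exact hu3.sub hw3)
    (fun i t ht ↦ by
      have h1 := hu4 t ht
      have h2 := hw4 t ht
      simp only [← laplacianCLM_apply] at h1 h2
      fin_cases i
      · simp [Fin.sum_univ_succ]
        module
      · simp [Fin.sum_univ_succ]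
        module
      · simp [Fin.sum_univ_succ, ← laplacianCLM_apply, map_sub]
        simp only [map_sub, map_smul] at h1 h2
        push_cast at h1 h2
        linear_combination (norm := module) h1 - h2)
    (fun i ↦ by fin_cases i <;> simp [hu5, hw5, hu6, hw6, hu7, hw7]) ht 0
  exact sub_eq_zero.1 h

/-- Uniqueness of `ψZ` and its time derivative comes before that of `ψI`, since it makes the two
sources coincide. -/
theorem AreSolutionAndProfiles.eq {b ν γ κ : ℝ} {ψ₀ ψ₁ ψ₂ : 𝓢'(Rn n, ℂ)}
    {ψ ψZ ψI ψL φ φZ φI φL : ℝ → 𝓢'(Rn n, ℂ)}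
    (h : AreSolutionAndProfiles b ν γ κ ψ₀ ψ₁ ψ₂ ψ ψZ ψI ψL)
    (h' : AreSolutionAndProfiles b ν γ κ ψ₀ ψ₁ ψ₂ φ φZ φI φL) {t : ℝ} (ht : 0 ≤ t) :
    ψ t = φ t ∧ ψZ t = φZ t ∧ ψI t = φI t ∧ ψL t = φL t := by
  obtain ⟨h1, ⟨Zt, hZ, It, hI⟩, h4⟩ := h
  obtain ⟨h1', ⟨Zt', hZ', It', hI'⟩, h4'⟩ := h'
  refine ⟨h1.eq h1' ht, (hZ.eq (fun _ _ ↦ rfl) hZ' ht).1, (hI.eq (fun t ht ↦ ?_) hI' ht).1,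
    h4.eq h4' ht⟩
  obtain ⟨e1, e2⟩ := hZ.eq (fun _ _ ↦ rfl) hZ' ht
  simp only [e1, e2]

end Uniqueness

/-! ### Modes as curves of functions of polynomial growth. -/

section Modes

variable {E : Type*} [NormedAddCommGroup E] [InnerProductSpace ℝ E] [FiniteDimensional ℝ E]

omit [InnerProductSpace ℝ E] [FiniteDimensional ℝ E] in
theorem polynomiallyBounded_const (c : ℂ) : PolynomiallyBounded (fun _ : E ↦ c) :=
  polynomiallyBounded_of_norm_le continuous_const fun _ ↦ le_rfl

omit [InnerProductSpace ℝ E] [FiniteDimensional ℝ E] in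
theorem PolynomiallyBoundedCurve.add {w w' : ℝ → E → ℂ} (hw : PolynomiallyBoundedCurve w)
    (hw' : PolynomiallyBoundedCurve w') :
    PolynomiallyBoundedCurve (fun t ξ ↦ w t ξ + w' t ξ) := by
  refine ⟨fun t ↦ (hw.1 t).add (hw'.1 t), fun T ↦ ?_⟩
  obtain ⟨C, k, hC⟩ := hw.2 T
  obtain ⟨D, l, hD⟩ := hw'.2 T
  refine ⟨|C| + |D|, k + l, fun t ht ξ ↦ (norm_add_le _ _).trans ?_⟩
  have h1 : 1 ≤ 1 + ‖ξ‖ ^ 2 := by nlinarith [sq_nonneg ‖ξ‖]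
  rw [add_mul]
  refine add_le_add ((hC t ht ξ).trans ?_) ((hD t ht ξ).trans ?_)
  · exact mul_le_mul (le_abs_self C) (pow_le_pow_right₀ h1 (by omega)) (by positivity)
      (abs_nonneg _)
  · exact mul_le_mul (le_abs_self D) (pow_le_pow_right₀ h1 (by omega)) (by positivity)
      (abs_nonneg _)

omit [InnerProductSpace ℝ E] [FiniteDimensional ℝ E] in
theorem PolynomiallyBoundedCurve.mul_left {g : E → ℂ} (hg : PolynomiallyBounded g)
    {w : ℝ → E → ℂ} (hw : PolynomiallyBoundedCurve w) :
    PolynomiallyBoundedCurve (fun t ξ ↦ g ξ * w t ξ) := by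
  obtain ⟨hc, C, k, hC⟩ := hg
  refine ⟨fun t ↦ hc.mul (hw.1 t), fun T ↦ ?_⟩
  obtain ⟨D, l, hD⟩ := hw.2 T
  refine ⟨C * D, k + l, fun t ht ξ ↦ ?_⟩
  rw [norm_mul]
  calc _ ≤ C * (1 + ‖ξ‖ ^ 2) ^ k * (D * (1 + ‖ξ‖ ^ 2) ^ l) :=
        mul_le_mul (hC ξ) (hD t ht ξ) (norm_nonneg _) ((norm_nonneg _).trans (hC ξ))
    _ = _ := by ring

omit [FiniteDimensional ℝ E] in
theorem polynomiallyBoundedCurve_heat {h : E → ℂ} (hh : PolynomiallyBounded h) :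
    PolynomiallyBoundedCurve
      (fun z ξ ↦ ((Real.exp (-z * laplaceSymbol ξ) : ℝ) : ℂ) * h ξ) := by
  obtain ⟨hc, C, k, hC⟩ := hh
  have hX : Continuous (laplaceSymbol : E → ℝ) := continuous_laplaceSymbol
  refine ⟨fun t ↦ by fun_prop, fun T ↦ ⟨C, k, fun t ht ξ ↦ ?_⟩⟩
  rw [norm_mul, Complex.norm_real, Real.norm_of_nonneg (Real.exp_nonneg _)]
  refine (mul_le_of_le_one_left (norm_nonneg _) ?_).trans (hC ξ)
  rw [Real.exp_le_one_iff]
  have : 0 ≤ laplaceSymbol ξ := by unfold laplaceSymbol; positivity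
  have := mul_nonneg ht.1 this
  linarith

/-- The modes of bounded data have polynomial growth in frequency. -/
theorem exists_polynomiallyBounded_modes {a θ κ : ℝ} (ha : 0 < a) (hθ : 0 < θ) (hθ1 : θ ≤ 1)
    (hκ : 0 < κ) (hκa : κ < a) {f₀ f₁ : E → ℂ} (hf₀ : Continuous f₀) (hf₁ : Continuous f₁)
    {D : ℝ} (hD₀ : ∀ ξ, ‖f₀ ξ‖ ≤ D) (hD₁ : ∀ ξ, ‖f₁ ξ‖ ≤ D) :
    ∃ u u1 u2 v v1 I I1 : ℝ → E → ℂ,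
      (∀ w ∈ [u, u1, u2, v, v1, I, I1], PolynomiallyBoundedCurve w) ∧
      (∀ ξ, BlackstockModes a θ κ (laplaceSymbol ξ) (fun t ↦ u t ξ) (fun t ↦ u1 t ξ)
        (fun t ↦ u2 t ξ) (fun t ↦ v t ξ) (fun t ↦ v1 t ξ) (fun t ↦ I t ξ) (fun t ↦ I1 t ξ)) ∧
      v 0 = f₀ ∧ v1 0 = f₁ := by
  obtain ⟨u, u1, u2, v, v1, I, I1, hcont, hmodes, hv, hv1⟩ :=
    exists_blackstockModes a θ κ (continuous_laplaceSymbol (E := E)) hf₀ hf₁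
  refine ⟨u, u1, u2, v, v1, I, I1, fun w hw ↦ ⟨fun t ↦ ?_, fun T ↦ ?_⟩, hmodes, hv, hv1⟩
  · exact (hcont w hw).comp (Continuous.prodMk_right t)
  obtain ⟨B, hB⟩ := (isCompact_Icc (a := (0 : ℝ)) (b := T)).prod
    (isCompact_closedBall (0 : E) 1) |>.exists_bound_of_continuousOn (hcont w hw).continuousOn
  obtain ⟨K, hK0, hK⟩ := exists_blackstockModes_growth ha hθ hθ1 hκ hκa (E := ℂ)
    (T := max T 0) (le_max_right _ _)
  have hD0 : 0 ≤ D := (norm_nonneg _).trans (hD₀ 0)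
  refine ⟨|B| + K * (2 * D) * ((2 * Real.pi) ^ 2) ^ 4, 4, fun t ht ξ ↦ ?_⟩
  have h1 : 1 ≤ 1 + ‖ξ‖ ^ 2 := by nlinarith [sq_nonneg ‖ξ‖]
  have h14 : 1 ≤ (1 + ‖ξ‖ ^ 2) ^ 4 := one_le_pow₀ h1
  rw [add_mul]
  -- The energy bounds require 2π‖ξ‖ ≥ 1. Inside the unit ball, joint continuity and compactness of
  -- [0, T] times the ball suffice.
  rcases le_total ‖ξ‖ 1 with hξ | hξ
  · have h2 : ‖w t ξ‖ ≤ B := hB (t, ξ) ⟨ht, by simpa using hξ⟩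
    have h3 : |B| ≤ |B| * (1 + ‖ξ‖ ^ 2) ^ 4 := le_mul_of_one_le_right (abs_nonneg _) h14
    have h4 : 0 ≤ K * (2 * D) * ((2 * Real.pi) ^ 2) ^ 4 * (1 + ‖ξ‖ ^ 2) ^ 4 := by positivity
    linarith [le_abs_self B]
  · have hπ : 1 ≤ 2 * Real.pi := by linarith [Real.pi_gt_three]
    have hs : 1 ≤ ‖(2 * Real.pi) • ξ‖ := by
      rw [norm_smul, Real.norm_of_nonneg (by positivity)]
      nlinarith
    have h2 := hK _ hs _ _ _ _ _ _ _ (hmodes ξ) t ⟨ht.1, ht.2.trans (le_max_left _ _)⟩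
      (fun t ↦ w t ξ) (by
        simp only [List.mem_cons, List.not_mem_nil, or_false] at hw ⊢
        rcases hw with rfl | rfl | rfl | rfl | rfl | rfl | rfl <;> simp)
    have hz : 1 + ‖(2 * Real.pi) • ξ‖ ^ 2 ≤ (2 * Real.pi) ^ 2 * (1 + ‖ξ‖ ^ 2) := by
      have := laplaceSymbol_eq ξ
      rw [laplaceSymbol] at this
      rw [this]
      nlinarith [one_le_pow₀ hπ (n := 2)]
    obtain ⟨z, hz'⟩ : ∃ z, z = 1 + ‖(2 * Real.pi) • ξ‖ ^ 2 := ⟨_, rfl⟩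
    rw [← hz'] at h2 hz
    have hz1 : 1 ≤ z := by rw [hz']; nlinarith [sq_nonneg ‖(2 * Real.pi) • ξ‖]
    have h3 : z * ‖v 0 ξ‖ + ‖v1 0 ξ‖ ≤ 2 * D * z := by
      rw [hv, hv1]
      nlinarith [hD₀ ξ, hD₁ ξ, mul_le_mul_of_nonneg_left (hD₀ ξ) (zero_le_one.trans hz1)]
    calc ‖w t ξ‖ ≤ K * (z ^ 3 * (z * ‖v 0 ξ‖ + ‖v1 0 ξ‖)) := h2
      _ ≤ K * (z ^ 3 * (2 * D * z)) := by gcongr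
      _ = K * (2 * D) * z ^ 4 := by ring
      _ ≤ K * (2 * D) * ((2 * Real.pi) ^ 2 * (1 + ‖ξ‖ ^ 2)) ^ 4 := by gcongr
      _ = K * (2 * D) * ((2 * Real.pi) ^ 2) ^ 4 * (1 + ‖ξ‖ ^ 2) ^ 4 := by ring
      _ ≤ _ := le_add_of_nonneg_left (by positivity)

end Modes

/-! ### Solutions obtained by inverse Fourier transform. -/

section Existence

open scoped FourierTransform

variable (E : Type*) [NormedAddCommGroup E] [InnerProductSpace ℝ E]

/-- The space of continuous functions with polynomial growth. -/
def polynomiallyBoundedSubmodule : Submodule ℂ (E → ℂ) where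
  carrier := {f | PolynomiallyBounded f}
  zero_mem' := polynomiallyBounded_const 0
  add_mem' hf hg := hf.add hg
  smul_mem' c _ hf := (polynomiallyBounded_const c).mul hf

variable {E}

/-- Multiplication by the symbol of the Laplacian. -/
noncomputable def mulLaplaceSymbol :
    polynomiallyBoundedSubmodule E →ₗ[ℂ] polynomiallyBoundedSubmodule E where
  toFun f := ⟨fun ξ ↦ -((laplaceSymbol ξ : ℝ) : ℂ) * f.1 ξ, by
    have h : PolynomiallyBounded (fun ξ ↦ (-1 : ℂ) * ((laplaceSymbol ξ : ℝ) : ℂ) * f.1 ξ) :=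
      ((polynomiallyBounded_const (-1)).mul polynomiallyBounded_laplaceSymbol).mul f.2
    refine (congrArg PolynomiallyBounded (funext fun ξ ↦ ?_)).mp h
    ring⟩
  map_add' f g := by
    ext ξ
    exact mul_add _ _ _
  map_smul' c f := by
    ext ξ
    exact mul_left_comm _ _ _

theorem mulLaplaceSymbol_apply (f : polynomiallyBoundedSubmodule E) (ξ : E) :
    (mulLaplaceSymbol f).1 ξ = -((laplaceSymbol ξ : ℝ) : ℂ) * f.1 ξ := rfl

variable [FiniteDimensional ℝ E] [MeasurableSpace E] [BorelSpace E]

/-- The inverse Fourier transform of functions with polynomial growth. -/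
noncomputable def inverseFourier : polynomiallyBoundedSubmodule E →ₗ[ℂ] 𝓢'(E, ℂ) where
  toFun f := 𝓕⁻ (distributionOf f.1)
  map_add' f g := by
    have h := distributionOf_add f.2 g.2
    rw [← FourierTransform.fourierInv_add, ← h]
    rfl
  map_smul' c f := by
    have h := distributionOf_const_mul c f.2
    rw [RingHom.id_apply, ← FourierTransform.fourierInv_smul, ← h]
    rfl

theorem inverseFourier_apply (f : polynomiallyBoundedSubmodule E) :
    inverseFourier f = 𝓕⁻ (distributionOf f.1) := rfl

theorem laplacian_inverseFourier (f : polynomiallyBoundedSubmodule E) :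
    Δ (inverseFourier f) = inverseFourier (mulLaplaceSymbol f) :=
  laplacian_fourierInv_distributionOf f.2

variable {n : ℕ}

/-- The map `inverseFourier` is linear and carries multiplication by minus the symbol to Δ. Every
equation and initial condition is thus the image of a pointwise identity between modes. The
top-order derivatives are introduced as explicit combinations of lower ones, which gives them
polynomial growth. -/
theorem areSolutionAndProfiles_of_modes {b ν γ κ : ℝ} {u u1 u2 v v1 I I1 : ℝ → Rn n → ℂ}
    (hw : ∀ w ∈ [u, u1, u2, v, v1, I, I1], PolynomiallyBoundedCurve w)
    (hm : ∀ ξ, BlackstockModes (b * ν) (γ - 1) κ (laplaceSymbol ξ) (fun t ↦ u t ξ)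
      (fun t ↦ u1 t ξ) (fun t ↦ u2 t ξ) (fun t ↦ v t ξ) (fun t ↦ v1 t ξ) (fun t ↦ I t ξ)
      (fun t ↦ I1 t ξ)) {ψ₀ ψ₁ ψ₂ : 𝓢'(Rn n, ℂ)} (h₀ : ψ₀ = 𝓕⁻ (distributionOf (v 0)))
    (h₁ : ψ₁ = 𝓕⁻ (distributionOf (v1 0)))
    (h₂ : ψ₂ = ((b * ν : ℝ) : ℂ) • Δ ψ₁ + Δ ψ₀) :
    AreSolutionAndProfiles b ν γ κ ψ₀ ψ₁ ψ₂ (fun t ↦ 𝓕⁻ (distributionOf (u t)))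
      (fun t ↦ 𝓕⁻ (distributionOf (v t))) (fun t ↦ 𝓕⁻ (distributionOf (I t)))
      (fun z ↦ 𝓕⁻ (distributionOf (fun ξ ↦ ((Real.exp (-z * laplaceSymbol ξ) : ℝ) : ℂ) *
        (((γ - 1 : ℝ) : ℂ) * (v1 0 ξ + ((b * ν * laplaceSymbol ξ : ℝ) : ℂ) * v 0 ξ))))) := by
  simp only [List.mem_cons, List.not_mem_nil, or_false, forall_eq_or_imp, forall_eq] at hw
  obtain ⟨hu, hu1, hu2, hv, hv1, hI, hI1⟩ := hw
  have hc := polynomiallyBounded_const (E := Rn n)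
  have hX : PolynomiallyBounded (fun ξ : Rn n ↦ ((laplaceSymbol ξ : ℝ) : ℂ)) :=
    polynomiallyBounded_laplaceSymbol
  let L : (w : ℝ → Rn n → ℂ) → PolynomiallyBoundedCurve w → {t : ℝ} → 0 ≤ t →
    polynomiallyBoundedSubmodule (Rn n) := fun w hw t ht ↦ ⟨w t, hw.apply ht⟩
  have hL : ∀ (w : ℝ → Rn n → ℂ) (hw : PolynomiallyBoundedCurve w) {t : ℝ} (ht : 0 ≤ t),
    𝓕⁻ (distributionOf (w t)) = inverseFourier (L w hw ht) := fun w hw t ht ↦ rfl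
  have hL' : ∀ (w : ℝ → Rn n → ℂ) (hw : PolynomiallyBoundedCurve w) {t : ℝ} (ht : 0 ≤ t) ξ,
    (L w hw ht).1 ξ = w t ξ := fun w hw t ht ξ ↦ rfl
  rw [hL v hv le_rfl] at h₀
  rw [hL v1 hv1 le_rfl] at h₁
  obtain ⟨u3, hu3, hu3'⟩ : ∃ u3 : ℝ → Rn n → ℂ, PolynomiallyBoundedCurve u3 ∧ ∀ t ξ, u3 t ξ =
      -((b * ν + (1 + (γ - 1)) * κ) * laplaceSymbol ξ) • u2 t ξ
        - (laplaceSymbol ξ + (1 + (γ - 1)) * (b * ν) * κ * laplaceSymbol ξ ^ 2) • u1 t ξ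
        - (κ * laplaceSymbol ξ ^ 2) • u t ξ := by
    refine ⟨_, (hu2.mul_left ((hc (-(b * ν + (1 + (γ - 1)) * κ))).mul hX)).add
      ((hu1.mul_left (hX.mul ((hc (-1)).add ((hc (-((1 + (γ - 1)) * (b * ν) * κ))).mul hX)))).add
        (hu.mul_left ((hc (-κ)).mul (hX.mul hX)))), fun t ξ ↦ ?_⟩
    simp only [Complex.real_smul]
    push_cast
    ring
  obtain ⟨v2, hv2, hv2'⟩ : ∃ v2 : ℝ → Rn n → ℂ, PolynomiallyBoundedCurve v2 ∧ ∀ t ξ, v2 t ξ =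
      -(b * ν * laplaceSymbol ξ) • v1 t ξ - laplaceSymbol ξ • v t ξ := by
    refine ⟨_, (hv1.mul_left ((hc (-(b * ν))).mul hX)).add (hv.mul_left ((hc (-1)).mul hX)),
      fun t ξ ↦ ?_⟩
    simp only [Complex.real_smul]
    push_cast
    ring
  obtain ⟨I2, hI2, hI2'⟩ : ∃ I2 : ℝ → Rn n → ℂ, PolynomiallyBoundedCurve I2 ∧ ∀ t ξ, I2 t ξ =
      -(b * ν * laplaceSymbol ξ) • I1 t ξ - laplaceSymbol ξ • I t ξ
        - ((γ - 1) * laplaceSymbol ξ) • (v1 t ξ + (b * ν * laplaceSymbol ξ) • v t ξ) := by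
    refine ⟨_, ((hI1.mul_left ((hc (-(b * ν))).mul hX)).add
      (hI.mul_left ((hc (-1)).mul hX))).add
      (((hv1.add (hv.mul_left ((hc (b * ν)).mul hX)))).mul_left ((hc (-(γ - 1))).mul hX)),
      fun t ξ ↦ ?_⟩
    simp only [Complex.real_smul]
    push_cast
    ring
  have hheat : PolynomiallyBounded (fun ξ : Rn n ↦
      ((γ - 1 : ℝ) : ℂ) * (v1 0 ξ + ((b * ν * laplaceSymbol ξ : ℝ) : ℂ) * v 0 ξ)) := by
    have h := (hc ((γ - 1 : ℝ) : ℂ)).mul ((hv1.apply le_rfl).add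
      (((hc ((b * ν : ℝ) : ℂ)).mul hX).mul (hv.apply le_rfl)))
    refine (congrArg PolynomiallyBounded (funext fun ξ ↦ ?_)).mp h
    push_cast
    ring
  have hH := polynomiallyBoundedCurve_heat hheat
  have hH' := hH.mul_left ((hc (-1)).mul hX)
  refine ⟨⟨_, _, _, isTimeDeriv_fourierInv_distributionOf hu hu1 fun t ξ ↦ (hm ξ).deriv_u t,
    isTimeDeriv_fourierInv_distributionOf hu1 hu2 fun t ξ ↦ (hm ξ).deriv_u1 t,
    isTimeDeriv_fourierInv_distributionOf hu2 hu3 fun t ξ ↦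
      ((hm ξ).deriv_u2 t).congr_deriv (hu3' t ξ).symm, fun t ht ↦ ?_, ?_, ?_, ?_⟩,
    ⟨_, ⟨_, isTimeDeriv_fourierInv_distributionOf hv hv1 fun t ξ ↦ (hm ξ).deriv_v t,
      isTimeDeriv_fourierInv_distributionOf hv1 hv2 fun t ξ ↦
      ((hm ξ).deriv_v1 t).congr_deriv (hv2' t ξ).symm, fun t ht ↦ ?_, ?_, ?_⟩,
      _, ⟨_, isTimeDeriv_fourierInv_distributionOf hI hI1 fun t ξ ↦ (hm ξ).deriv_I t,
      isTimeDeriv_fourierInv_distributionOf hI1 hI2 fun t ξ ↦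
      ((hm ξ).deriv_I1 t).congr_deriv (hI2' t ξ).symm, fun t ht ↦ ?_, ?_, ?_⟩⟩,
    ⟨_, isTimeDeriv_fourierInv_distributionOf hH hH' fun t ξ ↦ ?_, fun z hz ↦ ?_, ?_⟩⟩
  · beta_reduce
    rw [hL u hu ht, hL u1 hu1 ht, hL u2 hu2 ht, hL u3 hu3 ht]
    simp only [laplacian_inverseFourier, ← map_smul, ← map_sub, ← map_add]
    convert LinearMap.map_zero inverseFourier
    ext ξ
    simp [mulLaplaceSymbol_apply, hL', hu3']
    ring
  · beta_reduce
    rw [h₀, hL u hu le_rfl]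
    congr 1
    ext ξ
    exact (hm ξ).u_zero
  · beta_reduce
    rw [h₁, hL u1 hu1 le_rfl]
    congr 1
    ext ξ
    exact (hm ξ).u1_zero
  · beta_reduce
    rw [h₂, h₀, h₁, hL u2 hu2 le_rfl]
    simp only [laplacian_inverseFourier, ← map_smul, ← map_add]
    congr 1
    ext ξ
    have h := (hm ξ).u2_zero
    simp [mulLaplaceSymbol_apply, hL'] at h ⊢
    rw [h]
    ring
  · beta_reduce
    rw [hL v hv ht, hL v1 hv1 ht, hL v2 hv2 ht]
    simp only [laplacian_inverseFourier, ← map_smul, ← map_sub]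
    convert LinearMap.map_zero inverseFourier
    ext ξ
    simp [mulLaplaceSymbol_apply, hL', hv2']
    ring
  · beta_reduce
    rw [h₀, hL v hv le_rfl]
  · beta_reduce
    rw [h₁, hL v1 hv1 le_rfl]
  · beta_reduce
    rw [hL v hv ht, hL v1 hv1 ht, hL I hI ht, hL I1 hI1 ht, hL I2 hI2 ht]
    simp only [laplacian_inverseFourier, ← map_smul, ← map_sub]
    congr 1
    ext ξ
    simp [mulLaplaceSymbol_apply, hL', hI2']
    ring
  · beta_reduce
    rw [h₀, h₁, hL I hI le_rfl]
    simp only [laplacian_inverseFourier, ← map_smul, ← map_sub]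
    congr 1
    ext ξ
    have h := (hm ξ).I_zero
    simp [mulLaplaceSymbol_apply, hL'] at h ⊢
    rw [h]
    ring
  · beta_reduce
    rw [hL I1 hI1 le_rfl]
    convert LinearMap.map_zero inverseFourier
    ext ξ
    exact (hm ξ).I1_zero
  · have h1 : HasDerivAt (fun z : ℝ ↦ Real.exp (-z * laplaceSymbol ξ))
        (Real.exp (-t * laplaceSymbol ξ) * (-1 * laplaceSymbol ξ)) t :=
      (((hasDerivAt_id t).neg).mul_const _).exp
    refine (h1.ofReal_comp.mul_const _).congr_deriv ?_
    push_cast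
    ring
  · beta_reduce
    rw [hL _ hH hz, hL _ hH' hz]
    simp only [laplacian_inverseFourier, ← map_sub]
    convert LinearMap.map_zero inverseFourier
    ext ξ
    simp [mulLaplaceSymbol_apply, hL']
  · beta_reduce
    rw [h₀, h₁, hL _ hH le_rfl]
    simp only [laplacian_inverseFourier, ← map_smul, ← map_sub]
    congr 1
    ext ξ
    simp [mulLaplaceSymbol_apply, hL']
    left
    ring

end Existence

/-! ### Fourier transforms of integrable functions. -/

section IntegrableTransform

open TemperedDistribution
open scoped FourierTransform

variable {E : Type*} [NormedAddCommGroup E] [InnerProductSpace ℝ E] [FiniteDimensional ℝ E]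
  [MeasurableSpace E] [BorelSpace E]

theorem norm_fourierTransform_apply_le (g : Lp ℂ 1 (volume : Measure E)) (ξ : E) :
    ‖Real.Lp.fourierTransform g ξ‖ ≤ ‖g‖ :=
  ((Real.Lp.fourierTransform g).norm_coe_le_norm ξ).trans
    (BoundedContinuousFunction.norm_ofNormedAddCommGroup_le _ (norm_nonneg g) _)

theorem polynomiallyBounded_fourierTransform (g : Lp ℂ 1 (volume : Measure E)) :
    PolynomiallyBounded (Real.Lp.fourierTransform g) :=
  polynomiallyBounded_of_norm_le (Real.Lp.fourierTransform g).continuous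
    (norm_fourierTransform_apply_le g)

/-- The distributional Fourier transform of an integrable function is given by its integral. -/
theorem fourier_toTemperedDistribution_eq_distributionOf (g : Lp ℂ 1 (volume : Measure E)) :
    𝓕 (Lp.toTemperedDistribution g) = distributionOf (Real.Lp.fourierTransform g) := by
  ext φ
  rw [(polynomiallyBounded_fourierTransform g).distributionOf_apply, TemperedDistribution.fourier_apply,
    Lp.toTemperedDistribution_apply]
  simpa using! VectorFourier.integral_bilin_fourierIntegral_eq_flip (ContinuousLinearMap.mul ℂ ℂ)
    (L := innerₗ E) Real.continuous_fourierChar continuous_inner (φ.integrable (μ := volume))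
    (L1.integrable_coeFn g)

/-- The inverse Fourier transform of an integrable function is bounded by its integral. -/
theorem exists_toTemperedDistribution_eq_fourierInv {f : E → ℂ} (hf : PolynomiallyBounded f)
    (hfi : Integrable f) :
    ∃ r : Lp ℂ ∞ (volume : Measure E), 𝓕⁻ (distributionOf f) = Lp.toTemperedDistribution r ∧
      ‖r‖ ≤ ∫ ξ, ‖f ξ‖ := by
  have hc : Continuous (𝓕⁻ f) :=
    VectorFourier.fourierIntegral_continuous Real.continuous_fourierChar
      (L := -innerₗ E) (continuous_inner.neg) hfi
  have hb : ∀ x, ‖𝓕⁻ f x‖ ≤ ∫ ξ, ‖f ξ‖ := fun x ↦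
    VectorFourier.norm_fourierIntegral_le_integral_norm _ _ _ _ _
  have hm : MemLp (𝓕⁻ f) ∞ (volume : Measure E) :=
    memLp_top_of_bound hc.aestronglyMeasurable _ (Filter.Eventually.of_forall hb)
  refine ⟨hm.toLp _, ?_, ?_⟩
  · ext φ
    rw [TemperedDistribution.fourierInv_apply, hf.distributionOf_apply, Lp.toTemperedDistribution_apply]
    have h := VectorFourier.integral_bilin_fourierIntegral_eq_flip (ContinuousLinearMap.mul ℂ ℂ)
      (L := -innerₗ E) Real.continuous_fourierChar continuous_inner.neg (φ.integrable (μ := volume)) hfi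
    have hflip : (-innerₗ E).flip = -innerₗ E := by
      ext x y
      simp [real_inner_comm]
    rw [hflip] at h
    refine (Eq.trans ?_ h).trans ?_
    · refine integral_congr_ae (Filter.Eventually.of_forall fun ξ ↦ ?_)
      simp only [ContinuousLinearMap.mul_apply', SchwartzMap.fourierInv_coe]
      rfl
    · refine integral_congr_ae ?_
      filter_upwards [hm.coeFn_toLp] with x hx
      rw [hx]
      rfl
  · rw [Lp.norm_toLp]
    refine ENNReal.toReal_le_of_le_ofReal (by positivity) ?_
    rw [eLpNorm_exponent_top]
    exact eLpNormEssSup_le_of_ae_bound (Filter.Eventually.of_forall hb)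

end IntegrableTransform

/-! ### Data on the Fourier side and integrability of the weight. -/

section Data

open TemperedDistribution
open scoped FourierTransform

variable {n : ℕ}

theorem japaneseSymbol_pos (s : ℝ) (ξ : Rn n) : 0 < japaneseSymbol s ξ := by
  unfold japaneseSymbol
  positivity

theorem japaneseSymbol_mul (s r : ℝ) (ξ : Rn n) :
    japaneseSymbol s ξ * japaneseSymbol r ξ = japaneseSymbol (s + r) ξ := by
  unfold japaneseSymbol
  rw [← Real.rpow_add (by positivity), add_div]

theorem japaneseSymbol_zero (ξ : Rn n) : japaneseSymbol 0 ξ = 1 := by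
  simp [japaneseSymbol]

theorem japaneseSymbol_neg_le_one {s : ℝ} (hs : 0 ≤ s) (ξ : Rn n) : japaneseSymbol (-s) ξ ≤ 1 := by
  unfold japaneseSymbol
  refine Real.rpow_le_one_of_one_le_of_nonpos ?_ (by linarith)
  linarith [sq_nonneg ‖(2 * Real.pi) • ξ‖]

theorem continuous_japaneseSymbol (s : ℝ) :
    Continuous (fun ξ : Rn n ↦ ((japaneseSymbol s ξ : ℝ) : ℂ)) :=
  (japaneseSymbol_hasTemperateGrowth s).1.continuous

/-- The symbols of orders s and -s are inverse to each other, so the transform of ψ is a continuous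
bounded function times ⟨ξ⟩^{-s}. This turns the L¹ hypothesis into pointwise decay. -/
theorem eq_fourierInv_of_japaneseD_eq {s : ℝ} (hs : 0 ≤ s) {ψ : 𝓢'(Rn n, ℂ)}
    {g : Lp ℂ 1 (volume : Measure (Rn n))}
    (h : japaneseD n s ψ = Lp.toTemperedDistribution g) :
    ψ = 𝓕⁻ (distributionOf
      (fun ξ ↦ ((japaneseSymbol (-s) ξ : ℝ) : ℂ) * Real.Lp.fourierTransform g ξ)) := by
  have hb : PolynomiallyBounded (fun ξ : Rn n ↦ ((japaneseSymbol (-s) ξ : ℝ) : ℂ)) := by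
    refine polynomiallyBounded_of_norm_le (continuous_japaneseSymbol _) (C := 1) fun ξ ↦ ?_
    rw [Complex.norm_real, Real.norm_of_nonneg (japaneseSymbol_pos _ _).le]
    exact japaneseSymbol_neg_le_one hs ξ
  rw [distributionOf_mul (japaneseSymbol_hasTemperateGrowth _) hb
    (polynomiallyBounded_fourierTransform g), ← fourier_toTemperedDistribution_eq_distributionOf,
    ← h, japaneseD, fourierMultiplierCLM_apply, FourierTransform.fourier_fourierInv_eq,
    smulLeftCLM_smulLeftCLM_apply (japaneseSymbol_hasTemperateGrowth _)
      (japaneseSymbol_hasTemperateGrowth _)]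
  have h1 : ((fun ξ : Rn n ↦ ((japaneseSymbol s ξ : ℝ) : ℂ)) *
      fun ξ : Rn n ↦ ((japaneseSymbol (-s) ξ : ℝ) : ℂ)) = fun _ ↦ 1 := by
    funext ξ
    rw [Pi.mul_apply, ← Complex.ofReal_mul, japaneseSymbol_mul, add_neg_cancel,
      japaneseSymbol_zero, Complex.ofReal_one]
  rw [h1, smulLeftCLM_const, one_smul, FourierTransform.fourierInv_fourier_eq]

/-- The weight of the frequency-wise remainder estimate is integrable. -/
theorem integrable_remainder_weight (hn : 2 ≤ n) {s₀ : ℝ} (hs₀ : (n : ℝ) + 3 < s₀) :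
    Integrable (fun ξ : Rn n ↦ (1 / ‖(2 * Real.pi) • ξ‖ + ‖(2 * Real.pi) • ξ‖ ^ 3) *
      japaneseSymbol (-s₀) ξ) := by
  have : Nontrivial (Rn n) := by
    have : Nonempty (Fin n) := ⟨⟨0, by omega⟩⟩
    infer_instance
  have hπ : 0 < 2 * Real.pi := by positivity
  have hπ1 : 1 ≤ 2 * Real.pi := by linarith [Real.pi_gt_three]
  let F : ℝ → ℝ := fun y ↦ (1 / (2 * Real.pi * y) + (2 * Real.pi * y) ^ 3) *
    (1 + (2 * Real.pi * y) ^ 2) ^ (-s₀ / 2)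
  have hF : (fun ξ : Rn n ↦ (1 / ‖(2 * Real.pi) • ξ‖ + ‖(2 * Real.pi) • ξ‖ ^ 3) *
      japaneseSymbol (-s₀) ξ) = fun ξ : Rn n ↦ F ‖ξ‖ := by
    funext ξ
    simp only [F, japaneseSymbol, norm_smul, Real.norm_of_nonneg hπ.le]
  rw [hF, integrable_fun_norm_addHaar]
  have hdim : Module.finrank ℝ (Rn n) = n := by simp
  rw [hdim]
  -- In polar coordinates the integrand is dominated by a power of order -(s₀ - n - 2), which is
  -- integrable on the line exactly because s₀ > n + 3.
  have hint : Integrable (fun y : ℝ ↦ 2 * (1 + ‖y‖ ^ 2) ^ (-(s₀ - n - 2) / 2)) :=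
    (integrable_rpow_neg_one_add_norm_sq (by simp; linarith)).const_mul 2
  refine hint.integrableOn.mono' ?_ ?_
  · refine (ContinuousOn.aestronglyMeasurable ?_ measurableSet_Ioi)
    have h1 : ContinuousOn (fun y : ℝ ↦ 1 / (2 * Real.pi * y)) (Set.Ioi 0) := by
      refine ContinuousOn.div (by fun_prop) (by fun_prop) fun y hy ↦ ?_
      have : (0 : ℝ) < y := hy
      positivity
    have h2 : ContinuousOn (fun y : ℝ ↦ (1 + (2 * Real.pi * y) ^ 2) ^ (-s₀ / 2)) (Set.Ioi 0) :=
      ContinuousOn.rpow_const (by fun_prop) fun y _ ↦ Or.inl (by positivity)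
    have h3 : ContinuousOn (fun y : ℝ ↦ (2 * Real.pi * y) ^ 3) (Set.Ioi 0) := by fun_prop
    have h4 : ContinuousOn (fun y : ℝ ↦ y ^ (n - 1)) (Set.Ioi 0) := by fun_prop
    exact h4.smul ((h1.add h3).mul h2)
  · refine (ae_restrict_iff' measurableSet_Ioi).2 (Filter.Eventually.of_forall fun y hy ↦ ?_)
    have hy0 : (0 : ℝ) < y := hy
    obtain ⟨m, rfl⟩ : ∃ m, n = m + 2 := ⟨n - 2, by omega⟩
    obtain ⟨Y, hY⟩ : ∃ Y, Y = 2 * Real.pi * y := ⟨_, rfl⟩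
    have hY0 : 0 < Y := by rw [hY]; positivity
    have hyY : y ≤ Y := by rw [hY]; nlinarith
    obtain ⟨p, hp⟩ : ∃ p, p = √(1 + Y ^ 2) := ⟨_, rfl⟩
    have hp1 : 1 ≤ p := by rw [hp, Real.one_le_sqrt]; nlinarith
    have hYp : Y ≤ p := by rw [hp]; exact Real.le_sqrt_of_sq_le (by linarith)
    have hyp : y ≤ p := hyY.trans hYp
    -- Here n = m + 2: the Jacobian y^{n-1} contains at least one factor y to absorb the singularity
    -- 1/Y.
    have h1 : y ^ (m + 1) * (1 / Y + Y ^ 3) ≤ 2 * p ^ (m + 4) := by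
      have e1 : y ^ (m + 1) * (1 / Y) ≤ p ^ (m + 4) := by
        calc y ^ (m + 1) * (1 / Y) = y ^ m * (y / Y) := by rw [pow_succ]; ring
          _ ≤ p ^ m * 1 := by
            gcongr
            exact (div_le_one hY0).2 hyY
          _ ≤ p ^ (m + 4) := by
            rw [mul_one]
            exact pow_le_pow_right₀ hp1 (by omega)
      have e2 : y ^ (m + 1) * Y ^ 3 ≤ p ^ (m + 4) := by
        calc y ^ (m + 1) * Y ^ 3 ≤ p ^ (m + 1) * p ^ 3 := by gcongr
          _ = p ^ (m + 4) := by ring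
      linarith
    have h2 : p ^ (m + 4) = (1 + Y ^ 2) ^ (((m + 4 : ℕ) : ℝ) / 2) := by
      rw [hp, Real.sqrt_eq_rpow, ← Real.rpow_natCast, ← Real.rpow_mul (by positivity)]
      congr 1
      ring
    have h3 : (1 + Y ^ 2) ^ (((m + 4 : ℕ) : ℝ) / 2) * (1 + Y ^ 2) ^ (-s₀ / 2) ≤
        (1 + ‖y‖ ^ 2) ^ (-(s₀ - ((m + 2 : ℕ) : ℝ) - 2) / 2) := by
      rw [← Real.rpow_add (by positivity)]
      have h4 : ((m + 4 : ℕ) : ℝ) / 2 + -s₀ / 2 = -(s₀ - ((m + 2 : ℕ) : ℝ) - 2) / 2 := by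
        push_cast
        ring
      rw [h4]
      refine Real.rpow_le_rpow_of_nonpos (by positivity) ?_ (by linarith)
      rw [Real.norm_of_nonneg hy0.le]
      gcongr
    rw [Real.norm_of_nonneg (by positivity)]
    show y ^ (m + 1) • F y ≤ _
    simp only [F, ← hY, smul_eq_mul]
    rw [← mul_assoc]
    calc _ ≤ 2 * p ^ (m + 4) * (1 + Y ^ 2) ^ (-s₀ / 2) := by gcongr
      _ = 2 * ((1 + Y ^ 2) ^ (((m + 4 : ℕ) : ℝ) / 2) * (1 + Y ^ 2) ^ (-s₀ / 2)) := by
        rw [h2]; ring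
      _ ≤ _ := by gcongr

end Data

/-! ### Integration over frequencies and conclusion. -/

section Main

open scoped FourierTransform

variable {n : ℕ}

/-- The remainder of the expansion, for the solutions built from the modes. -/
theorem exists_remainder_bound (hn : 2 ≤ n) {a θ s₀ : ℝ} (ha : 0 < a) (hθ : 0 < θ) (hθ1 : θ ≤ 1)
    (hs₀ : (n : ℝ) + 3 < s₀) :
    ∃ C : ℝ, 0 < C ∧ ∀ κ : ℝ, 0 < κ → κ ≤ min 1 (a / 2) → ∀ D : ℝ, 0 ≤ D →
      ∀ u u1 u2 v v1 I I1 : ℝ → Rn n → ℂ,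
      (∀ w ∈ [u, u1, u2, v, v1, I, I1], PolynomiallyBoundedCurve w) →
      (∀ ξ, BlackstockModes a θ κ (laplaceSymbol ξ) (fun t ↦ u t ξ) (fun t ↦ u1 t ξ)
        (fun t ↦ u2 t ξ) (fun t ↦ v t ξ) (fun t ↦ v1 t ξ) (fun t ↦ I t ξ) (fun t ↦ I1 t ξ)) →
      (∀ ξ, (1 + laplaceSymbol ξ) * ‖v 0 ξ‖ + ‖v1 0 ξ‖ ≤ japaneseSymbol (-s₀) ξ * D) →
      ∀ t, 0 ≤ t → ∃ r : Lp ℂ ∞ (volume : Measure (Rn n)),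
        𝓕⁻ (distributionOf (u t)) - (𝓕⁻ (distributionOf (v t)) +
          (κ : ℂ) • 𝓕⁻ (distributionOf (I t)) +
          (κ : ℂ) • 𝓕⁻ (distributionOf fun ξ ↦
            ((Real.exp (-(κ * t) * laplaceSymbol ξ) : ℝ) : ℂ) *
              ((θ : ℂ) * (v1 0 ξ + ((a * laplaceSymbol ξ : ℝ) : ℂ) * v 0 ξ)))) =
          Lp.toTemperedDistribution r ∧ ‖r‖ ≤ C * (κ * Real.sqrt κ) * D := by
  obtain ⟨C₀, hC₀, hbound⟩ := exists_expansionRemainder_le (E := ℂ) a θ ha hθ hθ1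
  have hint := integrable_remainder_weight hn hs₀
  set W := ∫ ξ : Rn n, (1 / ‖(2 * Real.pi) • ξ‖ + ‖(2 * Real.pi) • ξ‖ ^ 3) *
    japaneseSymbol (-s₀) ξ with hW
  have hW0 : 0 ≤ W := integral_nonneg fun ξ ↦
    mul_nonneg (by positivity) (japaneseSymbol_pos _ _).le
  refine ⟨C₀ * W + 1, by positivity, ?_⟩
  intro κ hκ hκ' D hD u u1 u2 v v1 I I1 hw hm hdata t ht
  have hu := (hw u (by simp)).apply ht
  have hv := (hw v (by simp)).apply ht
  have hI := (hw I (by simp)).apply ht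
  have hv₀ := (hw v (by simp)).apply le_rfl
  have hv1₀ := (hw v1 (by simp)).apply le_rfl
  have hheat : PolynomiallyBounded (fun ξ : Rn n ↦
      (θ : ℂ) * (v1 0 ξ + ((a * laplaceSymbol ξ : ℝ) : ℂ) * v 0 ξ)) := by
    have h := (polynomiallyBounded_const (θ : ℂ)).mul (hv1₀.add
      (((polynomiallyBounded_const (a : ℂ)).mul polynomiallyBounded_laplaceSymbol).mul hv₀))
    refine (congrArg PolynomiallyBounded (funext fun ξ ↦ ?_)).mp h
    push_cast
    ring
  have hL := (polynomiallyBoundedCurve_heat hheat).apply (mul_nonneg hκ.le ht)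
  let R : Rn n → ℂ := fun ξ ↦ expansionRemainder a θ κ (laplaceSymbol ξ) (fun t ↦ u t ξ)
    (fun t ↦ v t ξ) (fun t ↦ v1 t ξ) (fun t ↦ I t ξ) t
  let S : polynomiallyBoundedSubmodule (Rn n) :=
    (⟨u t, hu⟩ : polynomiallyBoundedSubmodule (Rn n)) - (⟨v t, hv⟩ + (κ : ℂ) • ⟨I t, hI⟩ +
      (κ : ℂ) • ⟨_, hL⟩)
  have hSR : S.1 = R := by
    funext ξ
    simp [S, R, expansionRemainder]
    ring
  have hR : PolynomiallyBounded R := hSR ▸ S.2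
  have hpt : ∀ ξ : Rn n, ξ ≠ 0 → ‖R ξ‖ ≤ C₀ * (κ * √κ) * D *
      ((1 / ‖(2 * Real.pi) • ξ‖ + ‖(2 * Real.pi) • ξ‖ ^ 3) * japaneseSymbol (-s₀) ξ) := by
    intro ξ hξ
    have hs : 0 < ‖(2 * Real.pi) • ξ‖ :=
      norm_pos_iff.2 (smul_ne_zero (by positivity) hξ)
    have hσ : √κ ^ 2 = κ := Real.sq_sqrt hκ.le
    have hσ3 : √κ ^ 3 = κ * √κ := by rw [pow_succ, hσ]
    have hm' := hm ξ
    rw [← hσ] at hm'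
    have h := hbound (√κ) ‖(2 * Real.pi) • ξ‖ (Real.sqrt_pos.2 hκ)
      (Real.sqrt_le_one.2 (hκ'.trans (min_le_left _ _)))
      (by rw [hσ]; exact hκ'.trans (min_le_right _ _)) hs _ _ _ _ _ _ _ hm' t ht
    rw [hσ, hσ3] at h
    refine h.trans ?_
    calc _ ≤ C₀ * (κ * √κ) * (1 / ‖(2 * Real.pi) • ξ‖ + ‖(2 * Real.pi) • ξ‖ ^ 3) *
        (japaneseSymbol (-s₀) ξ * D) := mul_le_mul_of_nonneg_left (hdata ξ) (by positivity)
      _ = _ := by ring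
  -- The frequency 0, which the energy method does not reach, is a null set in positive dimension.
  have : Nontrivial (Rn n) := by
    have : Nonempty (Fin n) := ⟨⟨0, by omega⟩⟩
    infer_instance
  have hae : ∀ᵐ ξ : Rn n, ‖R ξ‖ ≤ C₀ * (κ * √κ) * D *
      ((1 / ‖(2 * Real.pi) • ξ‖ + ‖(2 * Real.pi) • ξ‖ ^ 3) * japaneseSymbol (-s₀) ξ) := by
    filter_upwards [Measure.ae_ne volume (0 : Rn n)] with ξ hξ using hpt ξ hξ
  have hRi : Integrable R := (hint.const_mul _).mono' hR.1.aestronglyMeasurable hae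
  obtain ⟨r, hr, hr'⟩ := exists_toTemperedDistribution_eq_fourierInv hR hRi
  refine ⟨r, ?_, hr'.trans ?_⟩
  · rw [← hr, ← hSR, ← inverseFourier_apply]
    simp only [S, map_sub, map_add, map_smul]
    rfl
  · calc ∫ ξ, ‖R ξ‖ ≤ C₀ * (κ * √κ) * D * W := by
          rw [hW, ← integral_const_mul]
          exact integral_mono_ae hRi.norm (hint.const_mul _) hae
      _ = C₀ * W * (κ * √κ) * D := by ring
      _ ≤ _ := by
        gcongr
        linarith

end Main

theorem mainTheorem9 (n : ℕ) (hn : 2 ≤ n) (b ν γ : ℝ) (hb : 0 < b) (hν : 0 < ν)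
    (hγ : 1 < γ) (hγ' : γ ≤ 5 / 3) :
    ∃ κ₀ : ℝ, 0 < κ₀ ∧ ∀ s₀ : ℝ, (n : ℝ) + 3 < s₀ →
      ∃ C : ℝ, 0 < C ∧ ∀ κ : ℝ, 0 < κ → κ ≤ κ₀ →
        ∀ (ψ₀ ψ₁ ψ₂ : 𝓢'(Rn n, ℂ)) (g₀ g₁ : Lp ℂ 1 (volume : Measure (Rn n))),
          japaneseD n (s₀ + 2) ψ₀ = Lp.toTemperedDistribution g₀ →
          japaneseD n s₀ ψ₁ = Lp.toTemperedDistribution g₁ →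
          ψ₂ = ((b * ν : ℝ) : ℂ) • Δ ψ₁ + Δ ψ₀ →
          (∃ ψ ψZ ψI ψL : ℝ → 𝓢'(Rn n, ℂ),
            AreSolutionAndProfiles b ν γ κ ψ₀ ψ₁ ψ₂ ψ ψZ ψI ψL) ∧
          ∀ ψ ψZ ψI ψL : ℝ → 𝓢'(Rn n, ℂ),
            AreSolutionAndProfiles b ν γ κ ψ₀ ψ₁ ψ₂ ψ ψZ ψI ψL →
            ∀ t : ℝ, 0 ≤ t →
              ∃ r : Lp ℂ ∞ (volume : Measure (Rn n)),
                ψ t - (ψZ t + (κ : ℂ) • ψI t + (κ : ℂ) • ψL (κ * t)) = Lp.toTemperedDistribution r ∧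
                ‖r‖ ≤ C * (κ * Real.sqrt κ) * (‖g₀‖ + ‖g₁‖) := by
  have ha : 0 < b * ν := mul_pos hb hν
  have hθ : 0 < γ - 1 := by linarith
  have hθ1 : γ - 1 ≤ 1 := by linarith
  -- The bound κ ≤ 1 lets higher powers of κ be dropped; κ ≤ bν/2 keeps the coupling coefficient
  -- κθ(bν - κ) positive and comparable to κ.
  refine ⟨min 1 (b * ν / 2), by positivity, fun s₀ hs₀ ↦ ?_⟩
  obtain ⟨C, hC, hbound⟩ := exists_remainder_bound hn ha hθ hθ1 hs₀
  refine ⟨C, hC, fun κ hκ hκ' ψ₀ ψ₁ ψ₂ g₀ g₁ hg₀ hg₁ hψ₂ ↦ ?_⟩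
  have hs0 : 0 ≤ s₀ := by
    have : (0 : ℝ) ≤ n := Nat.cast_nonneg n
    linarith
  have hκa : κ < b * ν := by
    have := hκ'.trans (min_le_right _ _)
    linarith
  have hψ₀ := eq_fourierInv_of_japaneseD_eq (by linarith) hg₀
  have hψ₁ := eq_fourierInv_of_japaneseD_eq hs0 hg₁
  have hnorm : ∀ {s : ℝ}, 0 ≤ s → ∀ (g : Lp ℂ 1 (volume : Measure (Rn n))) (ξ : Rn n),
      ‖((japaneseSymbol (-s) ξ : ℝ) : ℂ) * Real.Lp.fourierTransform g ξ‖ ≤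
        japaneseSymbol (-s) ξ * ‖g‖ := by
    intro s hs g ξ
    rw [norm_mul, Complex.norm_real, Real.norm_of_nonneg (japaneseSymbol_pos _ _).le]
    exact mul_le_mul_of_nonneg_left (norm_fourierTransform_apply_le g ξ) (japaneseSymbol_pos _ _).le
  have hnorm' : ∀ {s : ℝ}, 0 ≤ s → ∀ (g : Lp ℂ 1 (volume : Measure (Rn n))) (ξ : Rn n),
      ‖((japaneseSymbol (-s) ξ : ℝ) : ℂ) * Real.Lp.fourierTransform g ξ‖ ≤ ‖g‖ :=
    fun hs g ξ ↦ (hnorm hs g ξ).trans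
      (mul_le_of_le_one_left (norm_nonneg g) (japaneseSymbol_neg_le_one hs ξ))
  obtain ⟨u, u1, u2, v, v1, I, I1, hw, hm, hv, hv1⟩ := exists_polynomiallyBounded_modes ha hθ hθ1
    hκ hκa
    ((continuous_japaneseSymbol (-(s₀ + 2))).mul (Real.Lp.fourierTransform g₀).continuous)
    ((continuous_japaneseSymbol (-s₀)).mul (Real.Lp.fourierTransform g₁).continuous)
    (D := ‖g₀‖ + ‖g₁‖)
    (fun ξ ↦ (hnorm' (by linarith) g₀ ξ).trans (le_add_of_nonneg_right (norm_nonneg _)))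
    (fun ξ ↦ (hnorm' hs0 g₁ ξ).trans (le_add_of_nonneg_left (norm_nonneg _)))
  replace hψ₀ : ψ₀ = FourierTransformInv.fourierInv (distributionOf (v 0)) := by
    rw [hv]
    exact hψ₀
  replace hψ₁ : ψ₁ = FourierTransformInv.fourierInv (distributionOf (v1 0)) := by
    rw [hv1]
    exact hψ₁
  have hsol := areSolutionAndProfiles_of_modes hw hm hψ₀ hψ₁ hψ₂
  refine ⟨⟨_, _, _, _, hsol⟩, fun ψ ψZ ψI ψL h t ht ↦ ?_⟩
  obtain ⟨e1, e2, e3, -⟩ := h.eq hsol ht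
  -- Uniqueness is used a second time, at the slow time κt where the layer is evaluated.
  obtain ⟨-, -, -, e4⟩ := h.eq hsol (mul_nonneg hκ.le ht)
  rw [e1, e2, e3, e4]
  refine hbound κ hκ hκ' _ (by positivity) u u1 u2 v v1 I I1 hw hm (fun ξ ↦ ?_) t ht
  -- The two extra derivatives on ψ₀ pay for the factor 1 + x that the remainder estimate puts on `v
  -- 0`.
  have h0 : (1 + laplaceSymbol ξ) * ‖v 0 ξ‖ ≤ japaneseSymbol (-s₀) ξ * ‖g₀‖ := by
    have h2 : 1 + laplaceSymbol ξ = japaneseSymbol 2 ξ := by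
      simp [laplaceSymbol, japaneseSymbol]
    have h3 : -s₀ = 2 + -(s₀ + 2) := by ring
    rw [h2, hv, h3, ← japaneseSymbol_mul, mul_assoc]
    exact mul_le_mul_of_nonneg_left (hnorm (by linarith) g₀ ξ) (japaneseSymbol_pos _ _).le
  have h1 : ‖v1 0 ξ‖ ≤ japaneseSymbol (-s₀) ξ * ‖g₁‖ := by
    rw [hv1]
    exact hnorm hs0 g₁ ξ
  linarith
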